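/- Let $\mathbb{T}=\mathbb{R}/2\pi\mathbb{Z}$, let $\xi,\sigma>0$, $s\ge 0$ and $\tfrac12<b<\tfrac58$, and consider the complex Gross--Pitaevskii equation $$i\partial_t u=-\partial_x^2u+|u|^2u+i(\xi-\sigma|u|^2)u,\qquad u|_{t=0}=u_0,\qquad x\in\mathbb{T}. \tag{1}$$ Write $\langle x\rangle=(1+x^2)^{1/2}$, $\|f\|_{H^s}=\|\langle k\rangle^s\mathcal{F}_xf(k)\|_{\ell^2_k}$ with $\mathcal F_xf(k)=\int_{\mathbb T}e^{-ikx}f(x)\,dx$, and $\|u\|_{X^{s,b}}=\|\langle k\rangle^s\langle\tau+k^2\rangle^b\hat u(k,\tau)\|_{\ell^2_kL^2_\tau}$, where $\hat u$ is the space-time Fourier transform of $u$ on $\mathbb{T}\times\mathbb{R}$. For $\delta>0$ let $\|u\|_{X^{s,b}_\delta}$ be the infimum of $\|\tilde u\|_{X^{s,b}}$ over all $\tilde u$ that agree with $u$ for (almost every) $t\in[-\delta,\delta]$, and let $X^{s,b}_\delta$ be the space of those $u$ for which it is finite. A solution of (1) on $[-\delta,\delta]$ is a function $u$ with $|u|^2u\in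 L^1([-\delta,\delta]\times\mathbb{T})$ such that for all $t\in[-\delta,\delta]$ $$u(t)=S(t)u_0+\int_0^tS(t-\tau)\big(\xi u-(\sigma+i)|u|^2u\big)(\tau)\,d\tau,\qquad S(t)=e^{it\partial_x^2},$$ the identity being understood for each spatial Fourier coefficient. Then (1) is locally well-posed in $H^s(\mathbb{T})$: for every $u_0\in H^s(\mathbb{T})$ there is a $\delta\in(0,1]$ such that (1) has a unique solution $$u\in C([-\delta,\delta];H^s(\mathbb{T}))\cap X^{s,b}_\delta.$$ Moreover, the solution depends continuously on the data: $\delta$ can be chosen so that there is an $r>0$ such that for every $v_0\in H^s(\mathbb{T})$ with $\|v_0-u_0\|_{H^s}<r$ there is a unique solution $v\in C([-\delta,\delta];H^s(\mathbb{T}))\cap X^{s,b}_\delta$ with initial value $v_0$, on the same interval $[-\delta,\delta]$, and the map $v_0\mapsto v$ is continuous from this ball in $H^s(\mathbb{T})$ to $C([-\delta,\delta];H^s(\mathbb{T}))\cap X^{s,b}_\delta$. -/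

import Mathlib

open MeasureTheory Set Filter Topology
open scoped ENNReal FourierTransform

namespace CGPE

instance factTwoPiPos : Fact (0 < 2 * Real.pi) := ⟨Real.two_pi_pos⟩

/-- The one-dimensional torus `ℝ / 2πℤ`. -/
abbrev Torus : Type := AddCircle (2 * Real.pi)

/-- Complex-valued square-integrable functions on the torus (modulo a.e. equality). -/
abbrev L2T : Type := Lp ℂ 2 (AddCircle.haarAddCircle : Measure Torus)

/-- Spatial Fourier transform `∫_𝕋 exp (-i k x) g x dx`, with respect to Lebesgue measure of total
mass `2π`. (Mathlib's `fourierCoeff` uses the normalized measure, whence the factor.) -/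
noncomputable def spaceFT (g : Torus → ℂ) (k : ℤ) : ℂ :=
  2 * (Real.pi : ℂ) * fourierCoeff g k

/-- Japanese bracket `⟨x⟩ = (1 + |x|²)^{1/2}`. -/
noncomputable def bracket (x : ℝ) : ℝ := Real.sqrt (1 + x ^ 2)

/-- The `H^s(𝕋)` norm `‖⟨k⟩^s F_x f(k)‖_{ℓ²_k}` (equal to `∞` when `f ∉ H^s`). -/
noncomputable def hsNorm (s : ℝ) (f : L2T) : ℝ≥0∞ :=
  (∑' k : ℤ, ENNReal.ofReal (bracket k ^ s * ‖spaceFT f k‖) ^ 2) ^ (1 / 2 : ℝ)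

/-- The Sobolev space `H^s(𝕋)`, for `s ≥ 0`, as a set of square-integrable functions. -/
def Hs (s : ℝ) : Set L2T := {f | hsNorm s f < ⊤}

/-- `u ∈ C([-δ, δ]; H^s(𝕋))`. -/
def ContinuousInHs (s δ : ℝ) (u : ℝ → L2T) : Prop :=
  (∀ t ∈ Icc (-δ) δ, u t ∈ Hs s) ∧
    ∀ t₀ ∈ Icc (-δ) δ, Tendsto (fun t => hsNorm s (u t - u t₀)) (𝓝[Icc (-δ) δ] t₀) (𝓝 0)

/-- The `C([-δ, δ]; H^s(𝕋))` norm, `sup_{|t| ≤ δ} ‖u(t)‖_{H^s}`. -/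
noncomputable def supHsNorm (s δ : ℝ) (u : ℝ → L2T) : ℝ≥0∞ :=
  ⨆ t ∈ Icc (-δ) δ, hsNorm s (u t)

open Classical in
/-- The Fourier transform `τ ↦ ∫ exp (-i t τ) g t dt` of `g ∈ L²(ℝ)`, in the `L²` (Plancherel)
sense. Mathlib's `𝓕` has the kernel `exp (-2π i t w)`, so it is evaluated at `w = τ / 2π`.
The value for `g ∉ L²(ℝ)` is a convention that is never used. -/
noncomputable def timeFT (g : ℝ → ℂ) (τ : ℝ) : ℂ :=
  if h : MemLp g 2 (volume : Measure ℝ) then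
    (𝓕 (h.toLp g) : Lp ℂ 2 (volume : Measure ℝ)) (τ / (2 * Real.pi))
  else 0

/-- Space-time Fourier transform `û(k, τ) = ∫∫ exp (-i k x - i t τ) u(x, t) dx dt`. -/
noncomputable def spaceTimeFT (u : ℝ → L2T) (k : ℤ) : ℝ → ℂ :=
  timeFT (fun t => spaceFT (u t) k)

open Classical in
/-- The Bourgain norm `‖⟨k⟩^s ⟨τ + k²⟩^b û(k, τ)‖_{ℓ²_k L²_τ}`, for `s, b ≥ 0`.
It is `∞` when a spatial Fourier coefficient of `u` is not in `L²_t`; finiteness for `s, b ≥ 0`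
characterizes membership in `X^{s,b} ⊆ L²(ℝ × 𝕋)`. -/
noncomputable def xNorm (s b : ℝ) (u : ℝ → L2T) : ℝ≥0∞ :=
  if ∀ k : ℤ, MemLp (fun t => spaceFT (u t) k) 2 (volume : Measure ℝ) then
    (∑' k : ℤ, ∫⁻ τ : ℝ,
      ENNReal.ofReal (bracket k ^ s * bracket (τ + (k : ℝ) ^ 2) ^ b * ‖spaceTimeFT u k τ‖) ^ 2)
        ^ (1 / 2 : ℝ)
  else ⊤

/-- The restricted norm of `X^{s,b}_δ`: the infimum of `‖ũ‖_{X^{s,b}}` over all `ũ` that agree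
with `u` on `[-δ, δ]`. The function `u` is in `X^{s,b}_δ` exactly when this is finite. -/
noncomputable def xNormRestr (s b δ : ℝ) (u : ℝ → L2T) : ℝ≥0∞ :=
  ⨅ (w : ℝ → L2T) (_ : ∀ᵐ t ∂(volume.restrict (Icc (-δ) δ)), w t = u t), xNorm s b w

/-- The function `|f|² f` on the torus. -/
noncomputable def cubic (f : L2T) (x : Torus) : ℂ := ((‖f x‖ ^ 2 : ℝ) : ℂ) * f x

/-- The symbol `exp (-i k² t)` of the free Schrödinger group `S(t) = exp (i t ∂ₓ²)`. -/
noncomputable def schrodingerSymbol (t : ℝ) (k : ℤ) : ℂ :=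
  Complex.exp (-(Complex.I * (k : ℂ) ^ 2 * (t : ℂ)))

/-- `u` solves, on `[-δ, δ]` and with initial value `u₀`, the equation
`i ∂ₜu = -∂ₓ²u + |u|²u + i (ξ - σ|u|²) u`, in the Duhamel form
`u(t) = S(t) u₀ + ∫₀ᵗ S(t - τ) (ξ u - (σ + i) |u|² u)(τ) dτ`,
written in spatial Fourier variables. The first two conditions say that the nonlinearity and
the time integral make sense: `|u|² u` is integrable on `[-δ, δ] × 𝕋`. -/
structure IsDuhamelSolution (ξ σ δ : ℝ) (u₀ : L2T) (u : ℝ → L2T) : Prop where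
  cubic_integrable :
    (∫⁻ t in Icc (-δ) δ, ∫⁻ x, ‖u t x‖ₑ ^ 3 ∂(AddCircle.haarAddCircle : Measure Torus)) < ⊤
  integrableOn : ∀ k : ℤ,
    IntegrableOn (fun t => (ξ : ℂ) * spaceFT (u t) k
      - ((σ : ℂ) + Complex.I) * spaceFT (cubic (u t)) k) (Icc (-δ) δ)
  duhamel : ∀ t ∈ Icc (-δ) δ, ∀ k : ℤ,
    spaceFT (u t) k = schrodingerSymbol t k * spaceFT u₀ k
      + ∫ τ in (0 : ℝ)..t, schrodingerSymbol (t - τ) k *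
          ((ξ : ℂ) * spaceFT (u τ) k - ((σ : ℂ) + Complex.I) * spaceFT (cubic (u τ)) k)

/-- `u ∈ C([-δ, δ]; H^s) ∩ X^{s,b}_δ` solves the complex Gross-Pitaevskii equation on `[-δ, δ]`
with initial value `u₀`. -/
structure IsSolution (ξ σ s b δ : ℝ) (u₀ : L2T) (u : ℝ → L2T) : Prop where
  continuousInHs : ContinuousInHs s δ u
  xNormRestr_lt_top : xNormRestr s b δ u < ⊤
  isDuhamelSolution : IsDuhamelSolution ξ σ δ u₀ u

end CGPE

/-! The equation is solved on the Fourier side by Bourgain's method. A function `u` of time and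
space is encoded by a function `f` on `ℤ × ℝ` with `û = 2π f`; the Duhamel formula, cut off in time,
becomes a fixed point equation for `f` in a weighted `L²` space, and the physical function is
reconstructed from the fixed point.

The core is the Strichartz embedding of `X^{0,3/8}` into `L⁴`, in the form of a convolution bound
(`exists_l2_lconv_le`). If `p` and `r - p` have modulations of sizes `2^m` and `2^(m+j)`, the sum of
the two modulations depends on `p` only through `k₁² + (k - k₁)²`. This leaves `O(2^((m+j)/2))`
spatial frequencies `k₁`, and over each of them an interval of length `O(2^m)` of time frequencies.
After Cauchy-Schwarz, weights of order `3/8` leave a factor `2^(-j/8)`, which is summable over the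
distance to the diagonal. Duality turns the bilinear bound into a trilinear one, from three factors
in `X^{s,3/8}` to `X^{s,-3/8}` (`exists_l2_triconv_le`).

The time interval has half-length `1/l`, and the weight `l + |τ + k²|` replaces `1 + |τ + k²|`. With
this weight the linear estimates for the cut-off free evolution and the cut-off Duhamel integral
have constants that scale exactly in `l` (`exists_freqNorm_freeOp_le`,
`exists_freqNorm_duhamelOp_le`). Since `b - 1 ≤ -3/8` and `3/8 < b`, the comparison with the fixed
weights of order `-3/8` and `3/8` gains `l^(b-5/8)` and `l^(3/8-b)`, together `l^(-1/4)`. The datum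
contributes `l^(b-1/2)`, which is smaller by `l^(-1/8)` than the radius `l^(b-3/8)` of the ball that
is used. So for large `l` the map is a contraction of this ball (`exists_contraction`), and its
fixed point is Lipschitz in the datum.

For the way back to physical space, `b > 1/2` makes the slices of `f` integrable, so that the
Fourier coefficients of `u` exist at every time and are continuous. The Strichartz bound puts `u²`
in `L²` of space-time; hence at almost every time the coefficients of `|u|² u` are convergent
series, and the fixed point equation is the Duhamel formula (`coeffAt_duhamelMap`).

Uniqueness needs no smallness. A representative `f` of a given solution need not be a fixed point,
but the map sends it to another representative of the same solution near time zero. Iteration halves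
the distance between the representatives of two solutions with the same datum, so the solutions
agree on an interval whose length depends only on the size of the representatives
(`exists_local_uniqueness`). Time translation preserves that size, so finitely many equal steps
exhaust `[-δ, δ]`. -/

open MeasureTheory Set Filter Topology
open scoped ENNReal FourierTransform

namespace CGPE

/-! ### `L²` norms of extended nonnegative functions, and duality. -/

section L2

variable {α : Type*} [MeasurableSpace α] {μ : Measure α}

/-- The `L²` norm of a nonnegative function. -/
noncomputable def l2 (μ : Measure α) (F : α → ℝ≥0∞) : ℝ≥0∞ := (∫⁻ x, F x ^ 2 ∂μ) ^ (1 / 2 : ℝ)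

theorem l2_sq (F : α → ℝ≥0∞) : l2 μ F ^ 2 = ∫⁻ x, F x ^ 2 ∂μ := by
  rw [l2, ← ENNReal.rpow_natCast, ← ENNReal.rpow_mul]; norm_num

theorem sqrt_sq (x : ℝ≥0∞) : (x ^ 2) ^ (1 / 2 : ℝ) = x := by
  rw [← ENNReal.rpow_natCast, ← ENNReal.rpow_mul]; norm_num

theorem sq_sqrt (x : ℝ≥0∞) : (x ^ (1 / 2 : ℝ)) ^ 2 = x := by
  rw [← ENNReal.rpow_natCast, ← ENNReal.rpow_mul]; norm_num

theorem le_of_sq_le_sq {x y : ℝ≥0∞} (h : x ^ 2 ≤ y ^ 2) : x ≤ y := by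
  simpa using (ENNReal.pow_le_pow_left_iff two_ne_zero).1 h

theorem l2_le_iff {F : α → ℝ≥0∞} {C : ℝ≥0∞} : l2 μ F ≤ C ↔ ∫⁻ x, F x ^ 2 ∂μ ≤ C ^ 2 := by
  rw [← l2_sq]
  exact (ENNReal.pow_le_pow_left_iff two_ne_zero).symm

theorem l2_mono_ae {F G : α → ℝ≥0∞} (h : ∀ᵐ x ∂μ, F x ≤ G x) : l2 μ F ≤ l2 μ G :=
  ENNReal.rpow_le_rpow (lintegral_mono_ae (h.mono fun _ hx => pow_le_pow_left' hx 2)) (by norm_num)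

theorem l2_mono {F G : α → ℝ≥0∞} (h : ∀ x, F x ≤ G x) : l2 μ F ≤ l2 μ G :=
  l2_mono_ae (Eventually.of_forall h)

theorem l2_congr_ae {F G : α → ℝ≥0∞} (h : F =ᵐ[μ] G) : l2 μ F = l2 μ G :=
  le_antisymm (l2_mono_ae (h.mono fun _ hx => hx.le)) (l2_mono_ae (h.mono fun _ hx => hx.ge))

theorem lintegral_mul_le_l2 {F G : α → ℝ≥0∞} (hF : AEMeasurable F μ) (hG : AEMeasurable G μ) :
    ∫⁻ x, F x * G x ∂μ ≤ l2 μ F * l2 μ G := by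
  simpa [l2] using ENNReal.lintegral_mul_le_Lp_mul_Lq μ Real.HolderConjugate.two_two hF hG

theorem l2_add_le {F G : α → ℝ≥0∞} (hF : AEMeasurable F μ) (hG : AEMeasurable G μ) :
    l2 μ (fun x => F x + G x) ≤ l2 μ F + l2 μ G := by
  simpa [l2] using ENNReal.lintegral_Lp_add_le (p := 2) hF hG (by norm_num)

theorem l2_const_mul (c : ℝ≥0∞) {F : α → ℝ≥0∞} (hF : AEMeasurable F μ) :
    l2 μ (fun x => c * F x) = c * l2 μ F := by
  simp only [l2, mul_pow]
  rw [lintegral_const_mul'' _ (hF.pow_const 2), ENNReal.mul_rpow_of_nonneg _ _ (by norm_num),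
    sqrt_sq]

/-- Testing against `H` itself would give the bound if its norm were known to be finite. So the test
functions are truncations of `H` in height and to sets of finite measure, for which one factor of
the norm can be cancelled; monotone convergence removes the truncation. -/
theorem l2_le_of_forall_lintegral_mul_le [SigmaFinite μ] {H : α → ℝ≥0∞} (hH : Measurable H)
    {C : ℝ≥0∞} (h : ∀ G : α → ℝ≥0∞, Measurable G → ∫⁻ x, H x * G x ∂μ ≤ C * l2 μ G) :
    l2 μ H ≤ C := by
  set S := spanningSets μ
  set T : ℕ → α → ℝ≥0∞ := fun n => (S n).indicator fun x => min (H x) n with hT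
  have hTm : ∀ n, Measurable (T n) := fun n =>
    (hH.min measurable_const).indicator (measurableSet_spanningSets μ n)
  have hTle : ∀ n x, T n x ≤ H x := fun n x =>
    (indicator_le_self _ _ _).trans (min_le_left _ _)
  have hfin : ∀ n, l2 μ (T n) ≠ ⊤ := by
    intro n
    refine ENNReal.rpow_ne_top_of_nonneg (by norm_num) (ne_of_lt ?_)
    calc ∫⁻ x, T n x ^ 2 ∂μ ≤ ∫⁻ x, (S n).indicator (fun _ => (n : ℝ≥0∞) ^ 2) x ∂μ := by
          refine lintegral_mono fun x => ?_
          by_cases hx : x ∈ S n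
          · simp only [hT, indicator_of_mem hx]; gcongr; exact min_le_right _ _
          · simp [hT, indicator_of_notMem hx]
      _ = (n : ℝ≥0∞) ^ 2 * μ (S n) := by
          rw [lintegral_indicator (measurableSet_spanningSets μ n)]; simp [S]
      _ < ⊤ := ENNReal.mul_lt_top (by simp) (measure_spanningSets_lt_top μ n)
  have hle : ∀ n, l2 μ (T n) ≤ C := by
    intro n
    rcases eq_or_ne (l2 μ (T n)) 0 with h0 | h0
    · simp [h0]
    have : l2 μ (T n) * l2 μ (T n) ≤ C * l2 μ (T n) := by
      rw [← sq, l2_sq]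
      refine le_trans (lintegral_mono fun x => ?_) (h (T n) (hTm n))
      rw [sq]; gcongr; exact hTle n x
    exact (ENNReal.mul_le_mul_iff_left h0 (hfin n)).1 this
  rw [l2_le_iff]
  have hmono : Monotone fun n x => T n x ^ 2 := by
    intro a b hab x
    refine pow_le_pow_left' ?_ 2
    refine (indicator_le_indicator_of_subset (monotone_spanningSets μ hab)
      (fun _ => zero_le) x).trans (indicator_le_indicator ?_)
    gcongr
  have hsup : ∀ x, ⨆ n, T n x ^ 2 = H x ^ 2 := by
    intro x
    refine iSup_eq_of_tendsto (fun a b hab => hmono hab x) ?_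
    have : Tendsto (fun n => T n x) atTop (𝓝 (H x)) := by
      have h1 : Tendsto (fun n : ℕ => min (H x) n) atTop (𝓝 (min (H x) ⊤)) :=
        tendsto_const_nhds.min ENNReal.tendsto_nat_nhds_top
      rw [min_eq_left le_top] at h1
      refine h1.congr' ?_
      filter_upwards [eventually_ge_atTop (spanningSetsIndex μ x)] with n hn
      simp only [hT]
      rw [indicator_of_mem]
      exact mem_spanningSets_of_index_le μ x hn
    exact ((ENNReal.continuous_pow 2).tendsto _).comp this
  simp_rw [← hsup]
  rw [lintegral_iSup (fun n => (hTm n).pow_const 2) hmono]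
  exact iSup_le fun n => l2_le_iff.1 (hle n)

end L2

/-! ### Dyadic summation and the space of frequencies. -/

/-- A discrete Schur bound with geometric off-diagonal decay. -/
theorem tsum_geometric_offdiag_le (r : ℝ≥0∞) (a b : ℕ → ℝ≥0∞) {f : ℕ → ℕ → ℝ≥0∞}
    (h₁ : ∀ m j, f m (m + j) ≤ r ^ j * (a m * b (m + j)))
    (h₂ : ∀ n j, f (n + j) n ≤ r ^ j * (a (n + j) * b n)) :
    ∑' m, ∑' n, f m n ≤
      2 * (1 - r)⁻¹ * ((∑' m, a m ^ 2) ^ (1 / 2 : ℝ) * (∑' m, b m ^ 2) ^ (1 / 2 : ℝ)) := by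
  have cs : ∀ c d : ℕ → ℝ≥0∞, ∑' m, c m * d m ≤
      (∑' m, c m ^ 2) ^ (1 / 2 : ℝ) * (∑' m, d m ^ 2) ^ (1 / 2 : ℝ) := by
    intro c d
    simpa [l2, lintegral_count] using
      lintegral_mul_le_l2 (μ := Measure.count) (F := c) (G := d) (by fun_prop) (by fun_prop)
  have shift : ∀ (c : ℕ → ℝ≥0∞) j, (∑' m, c (m + j) ^ 2) ^ (1 / 2 : ℝ) ≤
      (∑' m, c m ^ 2) ^ (1 / 2 : ℝ) := by
    intro c j
    refine ENNReal.rpow_le_rpow ?_ (by norm_num)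
    exact ENNReal.tsum_comp_le_tsum_of_injective (add_left_injective j) fun m => c m ^ 2
  set X := (∑' m, a m ^ 2) ^ (1 / 2 : ℝ) * (∑' m, b m ^ 2) ^ (1 / 2 : ℝ)
  have e₁ : ∀ j, ∑' m, f m (m + j) ≤ r ^ j * X := fun j => by
    refine (ENNReal.tsum_le_tsum fun m => h₁ m j).trans ?_
    rw [ENNReal.tsum_mul_left]
    gcongr
    exact (cs a fun m => b (m + j)).trans (mul_le_mul' le_rfl (shift b j))
  have e₂ : ∀ j, ∑' n, f (n + j) n ≤ r ^ j * X := fun j => by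
    refine (ENNReal.tsum_le_tsum fun m => h₂ m j).trans ?_
    rw [ENNReal.tsum_mul_left]
    gcongr
    exact (cs (fun m => a (m + j)) b).trans (mul_le_mul' (shift a j) le_rfl)
  -- A pair of indices is sorted by its distance `j` to the diagonal and by the side on which it
  -- lies. The diagonal is counted twice, which costs only a constant.
  have key : ∀ m n, f m n ≤
      ∑' j, ((if n = m + j then f m n else 0) + if m = n + j then f m n else 0) := by
    intro m n
    rcases le_total m n with hmn | hmn
    · obtain ⟨j, rfl⟩ := Nat.exists_eq_add_of_le hmn
      refine le_trans ?_ (ENNReal.le_tsum j)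
      simp
    · obtain ⟨j, rfl⟩ := Nat.exists_eq_add_of_le hmn
      refine le_trans ?_ (ENNReal.le_tsum j)
      simp
  calc ∑' m, ∑' n, f m n
      ≤ ∑' m, ∑' n, ∑' j, ((if n = m + j then f m n else 0) + if m = n + j then f m n else 0) :=
        ENNReal.tsum_le_tsum fun m => ENNReal.tsum_le_tsum fun n => key m n
    _ = (∑' j, ∑' m, f m (m + j)) + ∑' j, ∑' n, f (n + j) n := by
        simp_rw [ENNReal.tsum_add]
        congr 1
        · rw [ENNReal.tsum_comm (f := fun j m => f m (m + j))]
          refine tsum_congr fun m => ?_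
          rw [ENNReal.tsum_comm]
          exact tsum_congr fun j => tsum_ite_eq (m + j) (f m)
        · rw [ENNReal.tsum_comm, ENNReal.tsum_comm (f := fun j n => f (n + j) n)]
          refine tsum_congr fun n => ?_
          rw [ENNReal.tsum_comm]
          exact tsum_congr fun j => tsum_ite_eq (n + j) fun m => f m n
    _ ≤ (∑' j, r ^ j * X) + ∑' j, r ^ j * X :=
        add_le_add (ENNReal.tsum_le_tsum e₁) (ENNReal.tsum_le_tsum e₂)
    _ = 2 * (1 - r)⁻¹ * X := by
        rw [ENNReal.tsum_mul_right, ENNReal.tsum_geometric]; ring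

/-- Counting measure times Lebesgue measure on the space of frequencies `(k, τ)`. -/
noncomputable def freqMeasure : Measure (ℤ × ℝ) := (Measure.count : Measure ℤ).prod volume

instance : SigmaFinite freqMeasure := inferInstanceAs (SigmaFinite (Measure.prod _ _))

instance : freqMeasure.IsAddLeftInvariant :=
  inferInstanceAs ((Measure.count : Measure ℤ).prod (volume : Measure ℝ)).IsAddLeftInvariant

/-- The modulation `τ + k²` of a frequency `(k, τ)`. -/
noncomputable def modulation (p : ℤ × ℝ) : ℝ := p.2 + (p.1 : ℝ) ^ 2

@[fun_prop]
theorem measurable_modulation : Measurable modulation := by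
  unfold modulation
  have : Measurable fun k : ℤ => (k : ℝ) := measurable_from_top
  exact measurable_snd.add ((this.comp measurable_fst).pow_const 2)

theorem lintegral_freqMeasure {F : ℤ × ℝ → ℝ≥0∞} (hF : AEMeasurable F freqMeasure) :
    ∫⁻ p, F p ∂freqMeasure = ∑' k : ℤ, ∫⁻ τ, F (k, τ) := by
  rw [freqMeasure] at hF ⊢
  rw [lintegral_prod _ hF, lintegral_count]

/-! ### Counting frequencies near the paraboloid. -/

section Counting

theorem count_le_of_diam_le {A : Set ℤ} {R : ℝ} (hR : 0 ≤ R)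
    (h : ∀ x ∈ A, ∀ y ∈ A, |(x : ℝ) - y| ≤ R) :
    Measure.count A ≤ ENNReal.ofReal (2 * R + 1) := by
  rcases A.eq_empty_or_nonempty with rfl | ⟨a, ha⟩
  · simp
  have hsub : A ⊆ (Finset.Icc (a - ⌊R⌋) (a + ⌊R⌋) : Finset ℤ) := by
    intro x hx
    have h1 := abs_le.1 (h x hx a ha)
    have h2 : x - a ≤ ⌊R⌋ := Int.le_floor.2 (by push_cast; linarith)
    have h3 : a - x ≤ ⌊R⌋ := Int.le_floor.2 (by push_cast; linarith)
    simp only [Finset.coe_Icc, mem_Icc]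
    omega
  refine (measure_mono hsub).trans ?_
  rw [Measure.count_apply_finset, Int.card_Icc]
  have h0 : 0 ≤ ⌊R⌋ := Int.floor_nonneg.2 hR
  have : (((a + ⌊R⌋ + 1 - (a - ⌊R⌋)).toNat : ℕ) : ℝ) ≤ 2 * R + 1 := by
    have h4 : (((a + ⌊R⌋ + 1 - (a - ⌊R⌋)).toNat : ℤ)) = 2 * ⌊R⌋ + 1 := by
      rw [Int.toNat_of_nonneg (by omega)]; ring
    have h5 : (((a + ⌊R⌋ + 1 - (a - ⌊R⌋)).toNat : ℕ) : ℝ) = 2 * (⌊R⌋ : ℝ) + 1 := by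
      exact_mod_cast h4
    rw [h5]
    linarith [Int.floor_le R]
  rw [← ENNReal.ofReal_natCast]
  exact ENNReal.ofReal_le_ofReal this

/-- The number of integer points `k₁` with `k₁² + (k - k₁)²` in an interval. -/
theorem count_quadratic_le (c : ℝ) (k : ℤ) {L : ℝ} (hL : 1 ≤ L) :
    Measure.count {x : ℤ | |c + (x : ℝ) ^ 2 + ((k : ℝ) - x) ^ 2| ≤ L} ≤
      ENNReal.ofReal (6 * √L) := by
  have hs : 1 ≤ √L := Real.one_le_sqrt.2 hL
  have hsq : √L ^ 2 = L := Real.sq_sqrt (by linarith)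
  -- With `X = 2x - k` the quadratic form is `(X² + k²) / 2`, so two admissible points satisfy `|X²
  -- - Y²| ≤ 4L`. If `X` and `Y` have the same sign, then `(X - Y)² ≤ |X² - Y²|` and the points are
  -- within `√L`. The two signs together give `4√L + 2 ≤ 6√L` points.
  have key : ∀ x y : ℤ, |c + (x : ℝ) ^ 2 + ((k : ℝ) - x) ^ 2| ≤ L →
      |c + (y : ℝ) ^ 2 + ((k : ℝ) - y) ^ 2| ≤ L →
      0 ≤ (2 * (x : ℝ) - k) * (2 * y - k) → |(x : ℝ) - y| ≤ √L := by
    intro x y hx hy hxy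
    refine abs_le_of_sq_le_sq ?_ (by positivity)
    rw [hsq]
    have h1 := abs_le.1 hx
    have h2 := abs_le.1 hy
    have e : (2 * (x : ℝ) - k) ^ 2 - (2 * (y : ℝ) - k) ^ 2 =
      2 * ((c + (x : ℝ) ^ 2 + ((k : ℝ) - x) ^ 2) - (c + (y : ℝ) ^ 2 + ((k : ℝ) - y) ^ 2)) := by ring
    set X := 2 * (x : ℝ) - k
    set Y := 2 * (y : ℝ) - k
    have e2 : ((x : ℝ) - y) ^ 2 = (X - Y) ^ 2 / 4 := by simp only [X, Y]; ring
    have e3 : (X - Y) ^ 2 ≤ |X ^ 2 - Y ^ 2| := by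
      rcases le_total (Y ^ 2) (X ^ 2) with h | h
      · rw [abs_of_nonneg (by linarith)]
        nlinarith [sq_le_sq.1 h, abs_mul_abs_self Y, abs_mul X Y, abs_of_nonneg hxy,
          abs_nonneg Y, abs_nonneg X]
      · rw [abs_of_nonpos (by linarith)]
        nlinarith [sq_le_sq.1 h, abs_mul_abs_self X, abs_mul X Y, abs_of_nonneg hxy,
          abs_nonneg Y, abs_nonneg X]
    have e4 : |X ^ 2 - Y ^ 2| ≤ 4 * L := by rw [e, abs_le]; constructor <;> linarith
    rw [e2]; linarith
  set A := {x : ℤ | |c + (x : ℝ) ^ 2 + ((k : ℝ) - x) ^ 2| ≤ L}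
  have hA : A ⊆ (A ∩ {x | 0 ≤ 2 * (x : ℝ) - k}) ∪ (A ∩ {x | 2 * (x : ℝ) - k ≤ 0}) := by
    intro x hx
    rcases le_total 0 (2 * (x : ℝ) - k) with h | h
    · exact Or.inl ⟨hx, h⟩
    · exact Or.inr ⟨hx, h⟩
  have h1 : Measure.count (A ∩ {x | 0 ≤ 2 * (x : ℝ) - k}) ≤ ENNReal.ofReal (2 * √L + 1) :=
    count_le_of_diam_le (by positivity) fun x hx y hy => key x y hx.1 hy.1 (mul_nonneg hx.2 hy.2)
  have h2 : Measure.count (A ∩ {x | 2 * (x : ℝ) - k ≤ 0}) ≤ ENNReal.ofReal (2 * √L + 1) :=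
    count_le_of_diam_le (by positivity) fun x hx y hy =>
      key x y hx.1 hy.1 (mul_nonneg_of_nonpos_of_nonpos hx.2 hy.2)
  calc Measure.count A ≤ _ := measure_mono hA
    _ ≤ _ := measure_union_le _ _
    _ ≤ _ := add_le_add h1 h2
    _ = ENNReal.ofReal ((2 * √L + 1) + (2 * √L + 1)) :=
        (ENNReal.ofReal_add (by positivity) (by positivity)).symm
    _ ≤ _ := ENNReal.ofReal_le_ofReal (by linarith)

/-- By Fubini: the first condition leaves at most `6√L` spatial frequencies, and the second an
interval of length `2l` of time frequencies over each, with a center that may vary. -/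
theorem freqMeasure_le_of_section {A : Set (ℤ × ℝ)} (hA : MeasurableSet A) (c : ℝ) (k : ℤ)
    {L l : ℝ} (hL : 1 ≤ L) (hl : 0 ≤ l) (φ : ℤ → ℝ)
    (h₁ : ∀ p ∈ A, |c + (p.1 : ℝ) ^ 2 + ((k : ℝ) - p.1) ^ 2| ≤ L)
    (h₂ : ∀ p ∈ A, |p.2 - φ p.1| ≤ l) :
    freqMeasure A ≤ ENNReal.ofReal (12 * √L * l) := by
  set S := {x : ℤ | |c + (x : ℝ) ^ 2 + ((k : ℝ) - x) ^ 2| ≤ L}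
  rw [freqMeasure, Measure.prod_apply hA]
  calc ∫⁻ x, volume (Prod.mk x ⁻¹' A) ∂Measure.count
      ≤ ∫⁻ x, S.indicator (fun _ => ENNReal.ofReal (2 * l)) x ∂Measure.count := by
        refine lintegral_mono fun x => ?_
        by_cases hx : x ∈ S
        · rw [indicator_of_mem hx]
          calc volume (Prod.mk x ⁻¹' A) ≤ volume (Icc (φ x - l) (φ x + l)) := by
                refine measure_mono fun τ hτ => ?_
                have := abs_le.1 (h₂ (x, τ) hτ)
                simp only at this
                exact ⟨by linarith, by linarith⟩
            _ = ENNReal.ofReal (2 * l) := by rw [Real.volume_Icc]; congr 1; ring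
        · rw [indicator_of_notMem hx]
          have : Prod.mk x ⁻¹' A = ∅ := by
            ext τ; simp only [mem_preimage, mem_empty_iff_false, iff_false]
            exact fun h => hx (h₁ _ h)
          rw [this]; simp
    _ = ENNReal.ofReal (2 * l) * Measure.count S := by
        rw [lintegral_indicator (MeasurableSet.of_discrete)]; simp
    _ ≤ ENNReal.ofReal (2 * l) * ENNReal.ofReal (6 * √L) := by
        gcongr; exact count_quadratic_le c k hL
    _ = _ := by rw [← ENNReal.ofReal_mul (by positivity)]; congr 1; ring

/-- The dyadic block of frequencies whose modulation has size `2 ^ m`. -/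
def dyadicBlock (m : ℕ) : Set (ℤ × ℝ) :=
  {p | (2 : ℝ) ^ m ≤ 1 + |modulation p| ∧ 1 + |modulation p| < 2 ^ (m + 1)}

theorem measurableSet_dyadicBlock (m : ℕ) : MeasurableSet (dyadicBlock m) := by
  have : Measurable fun p => 1 + |modulation p| := by fun_prop
  exact (measurableSet_le measurable_const this).inter (measurableSet_lt this measurable_const)

theorem tsum_indicator_dyadicBlock (F : ℤ × ℝ → ℝ≥0∞) (p : ℤ × ℝ) :
    ∑' m, (dyadicBlock m).indicator F p = F p := by
  obtain ⟨n, hn⟩ := exists_nat_pow_near (x := 1 + |modulation p|) (y := 2)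
    (by linarith [abs_nonneg (modulation p)]) (by norm_num)
  rw [tsum_eq_single n, indicator_of_mem (s := dyadicBlock n) hn]
  intro m hm
  refine indicator_of_notMem (fun h => hm ?_) _
  have h1 : m < n + 1 := (pow_lt_pow_iff_right₀ (one_lt_two (α := ℝ))).1 (h.1.trans_lt hn.2)
  have h2 : n < m + 1 := (pow_lt_pow_iff_right₀ (one_lt_two (α := ℝ))).1 (hn.1.trans_lt h.2)
  omega

/-- The sum of the modulations of `p` and `r - p` does not involve the time frequency of `p`. Its
size is governed by the larger block, and this limits the spatial frequencies; for each of them the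
smaller block confines the time frequency. The two bounds differ in which of `p` and `r - p` lies in
the smaller block, hence in the center of the interval. -/
theorem freqMeasure_dyadicBlock_le (m j : ℕ) (r : ℤ × ℝ) :
    freqMeasure {p | p ∈ dyadicBlock m ∧ r - p ∈ dyadicBlock (m + j)} ≤
        ENNReal.ofReal (48 * √((2 : ℝ) ^ (m + j)) * 2 ^ m) ∧
      freqMeasure {p | p ∈ dyadicBlock (m + j) ∧ r - p ∈ dyadicBlock m} ≤
        ENNReal.ofReal (48 * √((2 : ℝ) ^ (m + j)) * 2 ^ m) := by
  have hms : ∀ a b, MeasurableSet {p | p ∈ dyadicBlock a ∧ r - p ∈ dyadicBlock b} := fun a b =>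
    (measurableSet_dyadicBlock a).inter
      ((measurable_const.sub measurable_id) (measurableSet_dyadicBlock b))
  have hpow : (2 : ℝ) ^ m ≤ 2 ^ (m + j) := pow_le_pow_right₀ (by norm_num) (by omega)
  have hone : (1 : ℝ) ≤ 2 ^ m := one_le_pow₀ (by norm_num)
  have hsum : ∀ p : ℤ × ℝ, r.2 + (p.1 : ℝ) ^ 2 + ((r.1 : ℝ) - p.1) ^ 2 =
      modulation p + modulation (r - p) := by
    intro p; simp only [modulation, Prod.fst_sub, Prod.snd_sub, Int.cast_sub]; ring
  have hval : 12 * √((2 : ℝ) ^ (m + j) * 4) * (2 * 2 ^ m) = 48 * √((2 : ℝ) ^ (m + j)) * 2 ^ m := by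
    rw [Real.sqrt_mul (by positivity), show (4 : ℝ) = 2 ^ 2 by norm_num,
      Real.sqrt_sq (by norm_num)]; ring
  rw [← hval]
  constructor
  · refine freqMeasure_le_of_section (hms _ _) r.2 r.1 (by linarith) (by positivity)
      (fun x => -(x : ℝ) ^ 2) ?_ ?_
    · rintro p ⟨h1, h2⟩
      rw [hsum]
      have := h1.2; have := h2.2
      rw [pow_succ] at *
      exact (abs_add_le _ _).trans (by linarith)
    · rintro p ⟨h1, h2⟩
      have := h1.2
      rw [pow_succ] at this
      have e : p.2 - -(p.1 : ℝ) ^ 2 = modulation p := by simp only [modulation]; ring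
      rw [e]; linarith
  · refine freqMeasure_le_of_section (hms _ _) r.2 r.1 (by linarith) (by positivity)
      (fun x => r.2 + ((r.1 : ℝ) - x) ^ 2) ?_ ?_
    · rintro p ⟨h1, h2⟩
      rw [hsum]
      have := h1.2; have := h2.2
      rw [pow_succ] at *
      exact (abs_add_le _ _).trans (by linarith)
    · rintro p ⟨h1, h2⟩
      have := h2.2
      rw [pow_succ] at this
      have e : p.2 - (r.2 + ((r.1 : ℝ) - p.1) ^ 2) = -modulation (r - p) := by
        simp only [modulation, Prod.fst_sub, Prod.snd_sub, Int.cast_sub]; ring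
      rw [e, abs_neg]; linarith

end Counting

/-! ### Bourgain's bilinear and trilinear estimates. -/

section Bilinear

theorem lintegral_comp_add_left (F : ℤ × ℝ → ℝ≥0∞) (p : ℤ × ℝ) :
    ∫⁻ q, F (p + q) ∂freqMeasure = ∫⁻ q, F q ∂freqMeasure :=
  lintegral_add_left_eq_self F p

theorem l2_tensor {F G : ℤ × ℝ → ℝ≥0∞} (hF : Measurable F) (hG : Measurable G) :
    l2 (freqMeasure.prod freqMeasure) (fun z => F z.1 * G z.2) =
      l2 freqMeasure F * l2 freqMeasure G := by
  simp only [l2, mul_pow]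
  rw [lintegral_prod_mul (hF.pow_const 2).aemeasurable (hG.pow_const 2).aemeasurable,
    ENNReal.mul_rpow_of_nonneg _ _ (by norm_num)]

/-- Cauchy-Schwarz on the product space, with `F ⊗ G` as one factor and the indicators times `H (p +
q)` as the other. In the variable `r = p + q` the square of the second factor integrates `H r ^ 2`
against the measure of the admissible `p`. -/
theorem lintegral_block_le {S S' : Set (ℤ × ℝ)} (hS : MeasurableSet S) (hS' : MeasurableSet S')
    {A : ℝ≥0∞} (hA : ∀ r, freqMeasure {p | p ∈ S ∧ r - p ∈ S'} ≤ A)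
    {F G H : ℤ × ℝ → ℝ≥0∞} (hF : Measurable F) (hG : Measurable G) (hH : Measurable H) :
    ∫⁻ p, ∫⁻ q, S.indicator F p * S'.indicator G q * H (p + q) ∂freqMeasure ∂freqMeasure ≤
      A ^ (1 / 2 : ℝ) * (l2 freqMeasure (S.indicator F) * l2 freqMeasure (S'.indicator G) *
        l2 freqMeasure H) := by
  have hFi := hF.indicator hS
  have hGi := hG.indicator hS'
  set χ : (ℤ × ℝ) × (ℤ × ℝ) → ℝ≥0∞ := fun z =>
    S.indicator 1 z.1 * S'.indicator 1 z.2 * H (z.1 + z.2)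
  have h1 : Measurable (S.indicator (1 : ℤ × ℝ → ℝ≥0∞)) := measurable_one.indicator hS
  have h2 : Measurable (S'.indicator (1 : ℤ × ℝ → ℝ≥0∞)) := measurable_one.indicator hS'
  have hχ : Measurable χ := by fun_prop
  have e : ∀ p q, S.indicator F p * S'.indicator G q * H (p + q) =
      (S.indicator F p * S'.indicator G q) * χ (p, q) := by
    intro p q
    by_cases hp : p ∈ S <;> by_cases hq : q ∈ S' <;> simp [χ, hp, hq]
  have hχ2 : l2 (freqMeasure.prod freqMeasure) χ ≤ A ^ (1 / 2 : ℝ) * l2 freqMeasure H := by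
    rw [l2_le_iff, mul_pow, sq_sqrt, l2_sq, lintegral_prod _ (hχ.pow_const 2).aemeasurable]
    calc ∫⁻ p, ∫⁻ q, χ (p, q) ^ 2 ∂freqMeasure ∂freqMeasure
        = ∫⁻ p, ∫⁻ r, S.indicator 1 p * S'.indicator 1 (r - p) * H r ^ 2
            ∂freqMeasure ∂freqMeasure := by
          refine lintegral_congr fun p => ?_
          rw [← lintegral_comp_add_left (fun r => _ * S'.indicator 1 (r - p) * H r ^ 2) p]
          refine lintegral_congr fun q => ?_
          by_cases hp : p ∈ S <;> by_cases hq : q ∈ S' <;> simp [χ, hp, hq]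
      _ = ∫⁻ r, ∫⁻ p, S.indicator 1 p * S'.indicator 1 (r - p) * H r ^ 2
            ∂freqMeasure ∂freqMeasure := by
          refine lintegral_lintegral_swap (Measurable.aemeasurable ?_)
          fun_prop
      _ ≤ ∫⁻ r, A * H r ^ 2 ∂freqMeasure := by
          refine lintegral_mono fun r => ?_
          rw [lintegral_mul_const _ (by fun_prop)]
          gcongr
          refine le_trans (le_of_eq ?_) (hA r)
          rw [← lintegral_indicator_one]
          · refine lintegral_congr fun p => ?_
            by_cases hp : p ∈ S <;> by_cases hq : r - p ∈ S' <;> simp [hp, hq]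
          · exact hS.inter ((measurable_const.sub measurable_id) hS')
      _ = A * ∫⁻ r, H r ^ 2 ∂freqMeasure := lintegral_const_mul _ (hH.pow_const 2)
  calc ∫⁻ p, ∫⁻ q, S.indicator F p * S'.indicator G q * H (p + q) ∂freqMeasure ∂freqMeasure
      = ∫⁻ z, (S.indicator F z.1 * S'.indicator G z.2) * χ z ∂(freqMeasure.prod freqMeasure) := by
        rw [lintegral_prod _ (by fun_prop)]
        simp_rw [e]
    _ ≤ _ := lintegral_mul_le_l2 (by fun_prop) (by fun_prop)
    _ ≤ (l2 freqMeasure (S.indicator F) * l2 freqMeasure (S'.indicator G)) *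
        (A ^ (1 / 2 : ℝ) * l2 freqMeasure H) := by
        rw [l2_tensor hFi hGi]; gcongr
    _ = _ := by ring

end Bilinear

/-- The weight `⟨k⟩^s (l + |τ + k²|)^b`. -/
noncomputable def wt (s b l : ℝ) (p : ℤ × ℝ) : ℝ := bracket p.1 ^ s * (l + |modulation p|) ^ b

/-- The weight `⟨k⟩^s (l + |τ + k²|)^b` as an extended nonnegative real. -/
noncomputable def ewt (s b l : ℝ) (p : ℤ × ℝ) : ℝ≥0∞ := ENNReal.ofReal (wt s b l p)

theorem one_le_bracket (x : ℝ) : 1 ≤ bracket x := by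
  unfold bracket; rw [Real.one_le_sqrt]; nlinarith [sq_nonneg x]

theorem bracket_pos (x : ℝ) : 0 < bracket x := one_pos.trans_le (one_le_bracket x)

@[fun_prop]
theorem measurable_intCast_fst : Measurable fun p : ℤ × ℝ => (p.1 : ℝ) := by
  have : Measurable fun k : ℤ => (k : ℝ) := measurable_from_top
  exact this.comp measurable_fst

@[fun_prop]
theorem measurable_wt (s b l : ℝ) : Measurable (wt s b l) := by
  unfold wt bracket
  fun_prop

@[fun_prop]
theorem measurable_ewt (s b l : ℝ) : Measurable (ewt s b l) := by
  unfold ewt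
  fun_prop

theorem wt_pos {s b l : ℝ} (hl : 0 < l) (p : ℤ × ℝ) : 0 < wt s b l p :=
  mul_pos (Real.rpow_pos_of_pos (bracket_pos _) _)
    (Real.rpow_pos_of_pos (by linarith [abs_nonneg (modulation p)]) _)

theorem tsum_l2_indicator_dyadicBlock {F : ℤ × ℝ → ℝ≥0∞} (hF : Measurable F) :
    ∑' m, l2 freqMeasure ((dyadicBlock m).indicator F) ^ 2 = l2 freqMeasure F ^ 2 := by
  simp_rw [l2_sq]
  rw [← lintegral_tsum fun m => ((hF.indicator (measurableSet_dyadicBlock m)).pow_const 2).aemeasurable]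
  refine lintegral_congr fun p => ?_
  rw [← tsum_indicator_dyadicBlock (fun p => F p ^ 2) p]
  refine tsum_congr fun m => ?_
  by_cases hp : p ∈ dyadicBlock m <;> simp [hp]

/-- On the block the weight of order `3/8` is at least `2^(3m/8)`. -/
theorem l2_indicator_dyadicBlock_le {F : ℤ × ℝ → ℝ≥0∞} (hF : Measurable F) (m : ℕ) :
    l2 freqMeasure ((dyadicBlock m).indicator F) ≤ (2 : ℝ≥0∞) ^ (-(3 / 8 * m) : ℝ) *
      l2 freqMeasure ((dyadicBlock m).indicator fun p => ewt 0 (3 / 8) 1 p * F p) := by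
  rw [← l2_const_mul _ (by
    exact (((measurable_ewt _ _ _).mul hF).indicator (measurableSet_dyadicBlock m)).aemeasurable)]
  refine l2_mono fun p => ?_
  by_cases hp : p ∈ dyadicBlock m
  · rw [indicator_of_mem hp, indicator_of_mem hp, ← mul_assoc]
    have h1 : (2 : ℝ≥0∞) ^ (3 / 8 * m : ℝ) ≤ ewt 0 (3 / 8) 1 p := by
      have h2 : (2 : ℝ) ^ (3 / 8 * m : ℝ) ≤ wt 0 (3 / 8) 1 p := by
        simp only [wt, Real.rpow_zero, one_mul]
        rw [mul_comm, Real.rpow_mul (by norm_num), Real.rpow_natCast]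
        exact Real.rpow_le_rpow (by positivity) hp.1 (by norm_num)
      rw [ewt]
      refine le_trans (le_of_eq ?_) (ENNReal.ofReal_le_ofReal h2)
      rw [← ENNReal.ofReal_rpow_of_pos (by norm_num)]; norm_num
    calc F p = (2 : ℝ≥0∞) ^ (-(3 / 8 * m) : ℝ) * (2 : ℝ≥0∞) ^ (3 / 8 * m : ℝ) * F p := by
          rw [← ENNReal.rpow_add _ _ two_ne_zero ENNReal.ofNat_ne_top, neg_add_cancel,
            ENNReal.rpow_zero, one_mul]
      _ ≤ _ := by gcongr
  · simp [indicator_of_notMem hp]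

/-- The balance of exponents that singles out `3/8`: the square root of the measure contributes
`3m/4 + j/4`, and the two weights remove `3m/4 + 3j/8`. The scale `m` cancels and a decay `2^(-j/8)`
off the diagonal remains. -/
theorem rpow_block_eq (m j : ℕ) :
    (ENNReal.ofReal (48 * √((2 : ℝ) ^ (m + j)) * 2 ^ m)) ^ (1 / 2 : ℝ) *
      ((2 : ℝ≥0∞) ^ (-(3 / 8 * m) : ℝ) * (2 : ℝ≥0∞) ^ (-(3 / 8 * (m + j : ℕ)) : ℝ)) =
    48 ^ (1 / 2 : ℝ) * ((2 : ℝ≥0∞) ^ (-(1 / 8) : ℝ)) ^ j := by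
  have e : ENNReal.ofReal (48 * √((2 : ℝ) ^ (m + j)) * 2 ^ m) =
      48 * (2 : ℝ≥0∞) ^ ((m + j) / 2 + m : ℝ) := by
    rw [mul_assoc, ENNReal.ofReal_mul (by norm_num)]
    congr 1
    · norm_num
    · rw [Real.sqrt_eq_rpow, ← Real.rpow_natCast, ← Real.rpow_mul (by norm_num),
        ← Real.rpow_natCast, ← Real.rpow_add (by norm_num),
        ← ENNReal.ofReal_rpow_of_pos (by norm_num)]
      push_cast
      rw [ENNReal.ofReal_ofNat]
      congr 1; ring
  rw [e, ENNReal.mul_rpow_of_nonneg _ _ (by norm_num), ← ENNReal.rpow_mul, mul_assoc,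
    ← ENNReal.rpow_add _ _ two_ne_zero ENNReal.ofNat_ne_top,
    ← ENNReal.rpow_add _ _ two_ne_zero ENNReal.ofNat_ne_top,
    ← ENNReal.rpow_natCast, ← ENNReal.rpow_mul]
  congr 2
  push_cast; ring

/-- Bourgain's bilinear `L²` estimate, with weights of order `3/8` in the modulation. -/
theorem exists_bilinear_le : ∃ C : ℝ≥0∞, C ≠ ⊤ ∧ ∀ F G H : ℤ × ℝ → ℝ≥0∞,
    Measurable F → Measurable G → Measurable H →
    ∫⁻ p, ∫⁻ q, F p * G q * H (p + q) ∂freqMeasure ∂freqMeasure ≤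
      C * (l2 freqMeasure (fun p => ewt 0 (3 / 8) 1 p * F p) *
        l2 freqMeasure (fun p => ewt 0 (3 / 8) 1 p * G p) * l2 freqMeasure H) := by
  set r : ℝ≥0∞ := (2 : ℝ≥0∞) ^ (-(1 / 8) : ℝ) with hr
  have hr1 : r < 1 := ENNReal.rpow_lt_one_of_one_lt_of_neg (by norm_num) (by norm_num)
  refine ⟨48 ^ (1 / 2 : ℝ) * (2 * (1 - r)⁻¹), ?_, fun F G H hF hG hH => ?_⟩
  · refine ENNReal.mul_ne_top (ENNReal.rpow_ne_top_of_nonneg (by norm_num) (by norm_num))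
      (ENNReal.mul_ne_top (by norm_num) ?_)
    rw [ENNReal.inv_ne_top]
    exact (tsub_pos_of_lt hr1).ne'
  set WF := fun p => ewt 0 (3 / 8) 1 p * F p with hWF
  set WG := fun p => ewt 0 (3 / 8) 1 p * G p with hWG
  have hWFm : Measurable WF := (measurable_ewt _ _ _).mul hF
  have hWGm : Measurable WG := (measurable_ewt _ _ _).mul hG
  set a : ℕ → ℝ≥0∞ := fun m => l2 freqMeasure ((dyadicBlock m).indicator WF)
  set c : ℕ → ℝ≥0∞ := fun m => l2 freqMeasure ((dyadicBlock m).indicator WG)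
  set B : ℕ → ℕ → ℝ≥0∞ := fun m n => ∫⁻ p, ∫⁻ q, (dyadicBlock m).indicator F p *
    (dyadicBlock n).indicator G q * H (p + q) ∂freqMeasure ∂freqMeasure with hB
  set N := l2 freqMeasure H
  have hFi := fun m => hF.indicator (measurableSet_dyadicBlock m)
  have hGi := fun m => hG.indicator (measurableSet_dyadicBlock m)
  have hsum : ∫⁻ p, ∫⁻ q, F p * G q * H (p + q) ∂freqMeasure ∂freqMeasure =
      ∑' m, ∑' n, B m n := by
    simp only [hB]
    have h2 : ∀ m, ∑' n, ∫⁻ p, ∫⁻ q, (dyadicBlock m).indicator F p *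
        (dyadicBlock n).indicator G q * H (p + q) ∂freqMeasure ∂freqMeasure =
        ∫⁻ p, ∫⁻ q, (dyadicBlock m).indicator F p * G q * H (p + q)
          ∂freqMeasure ∂freqMeasure := by
      intro m
      rw [← lintegral_tsum fun n => by
        exact (Measurable.lintegral_prod_right' (f := fun z : (ℤ × ℝ) × (ℤ × ℝ) =>
          (dyadicBlock m).indicator F z.1 * (dyadicBlock n).indicator G z.2 * H (z.1 + z.2))
          (by have := hFi m; have := hGi n; fun_prop)).aemeasurable]
      refine lintegral_congr fun p => ?_
      rw [← lintegral_tsum fun n => by have := hGi n; fun_prop]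
      refine lintegral_congr fun q => ?_
      rw [ENNReal.tsum_mul_right, ENNReal.tsum_mul_left, tsum_indicator_dyadicBlock]
    simp_rw [h2]
    rw [← lintegral_tsum fun m => by
        exact (Measurable.lintegral_prod_right' (f := fun z : (ℤ × ℝ) × (ℤ × ℝ) =>
          (dyadicBlock m).indicator F z.1 * G z.2 * H (z.1 + z.2))
          (by have := hFi m; fun_prop)).aemeasurable]
    refine lintegral_congr fun p => ?_
    rw [← lintegral_tsum fun m => by fun_prop]
    refine lintegral_congr fun q => ?_
    rw [ENNReal.tsum_mul_right, ENNReal.tsum_mul_right, tsum_indicator_dyadicBlock]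
  have hblock : ∀ m n (A D : ℝ≥0∞),
      (∀ r, freqMeasure {p | p ∈ dyadicBlock m ∧ r - p ∈ dyadicBlock n} ≤ A) →
      A ^ (1 / 2 : ℝ) * ((2 : ℝ≥0∞) ^ (-(3 / 8 * m) : ℝ) * (2 : ℝ≥0∞) ^ (-(3 / 8 * n) : ℝ)) = D →
      B m n ≤ D * (a m * c n * N) := by
    intro m n A D hA hD
    refine (lintegral_block_le (measurableSet_dyadicBlock m) (measurableSet_dyadicBlock n)
      hA hF hG hH).trans ?_
    calc _ ≤ A ^ (1 / 2 : ℝ) * (((2 : ℝ≥0∞) ^ (-(3 / 8 * m) : ℝ) * a m) *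
            ((2 : ℝ≥0∞) ^ (-(3 / 8 * n) : ℝ) * c n) * N) := by
          gcongr
          · exact l2_indicator_dyadicBlock_le hF m
          · exact l2_indicator_dyadicBlock_le hG n
      _ = _ := by rw [← hD]; ring
  -- The constant and the norm of `H` are absorbed in the second sequence, to match the form of the
  -- Schur bound.
  have h₁ : ∀ m j, B m (m + j) ≤ r ^ j * (a m * (48 ^ (1 / 2 : ℝ) * N * c (m + j))) := by
    intro m j
    refine (hblock m (m + j) _ _ (fun r => (freqMeasure_dyadicBlock_le m j r).1)
      (rpow_block_eq m j)).trans (le_of_eq ?_)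
    ring
  have h₂ : ∀ n j, B (n + j) n ≤ r ^ j * (a (n + j) * (48 ^ (1 / 2 : ℝ) * N * c n)) := by
    intro n j
    refine (hblock (n + j) n _ (48 ^ (1 / 2 : ℝ) * r ^ j)
      (fun r => (freqMeasure_dyadicBlock_le n j r).2) ?_).trans (le_of_eq ?_)
    · rw [mul_comm ((2 : ℝ≥0∞) ^ (-(3 / 8 * ((n + j : ℕ) : ℝ)) : ℝ))]
      exact rpow_block_eq n j
    · ring
  rw [hsum]
  refine (tsum_geometric_offdiag_le r a (fun n => 48 ^ (1 / 2 : ℝ) * N * c n) h₁ h₂).trans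
    (le_of_eq ?_)
  have ha : (∑' m, a m ^ 2) ^ (1 / 2 : ℝ) = l2 freqMeasure WF := by
    rw [tsum_l2_indicator_dyadicBlock hWFm, sqrt_sq]
  have hc : (∑' m, (48 ^ (1 / 2 : ℝ) * N * c m) ^ 2) ^ (1 / 2 : ℝ) =
      48 ^ (1 / 2 : ℝ) * N * l2 freqMeasure WG := by
    simp_rw [mul_pow _ (c _)]
    rw [ENNReal.tsum_mul_left, tsum_l2_indicator_dyadicBlock hWGm, ← mul_pow, sqrt_sq]
  rw [ha, hc]
  ring

/-- Convolution of nonnegative functions of the frequency. -/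
noncomputable def lconv (F G : ℤ × ℝ → ℝ≥0∞) (r : ℤ × ℝ) : ℝ≥0∞ :=
  ∫⁻ q, F q * G (r - q) ∂freqMeasure

/-- The trilinear convolution that corresponds to the product `f g h̄` of three functions. -/
noncomputable def triconv (F G H : ℤ × ℝ → ℝ≥0∞) (p : ℤ × ℝ) : ℝ≥0∞ :=
  ∫⁻ r, ∫⁻ q, F q * G (r - q) * H (r - p) ∂freqMeasure ∂freqMeasure

theorem measurable_lconv {F G : ℤ × ℝ → ℝ≥0∞} (hF : Measurable F) (hG : Measurable G) :
    Measurable (lconv F G) :=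
  Measurable.lintegral_prod_right' (f := fun z : (ℤ × ℝ) × (ℤ × ℝ) => F z.2 * G (z.1 - z.2))
    (by fun_prop)

theorem triconv_eq {F G H : ℤ × ℝ → ℝ≥0∞} (hF : Measurable F) (hG : Measurable G) (p : ℤ × ℝ) :
    triconv F G H p = ∫⁻ r, lconv F G r * H (r - p) ∂freqMeasure :=
  lintegral_congr fun r => lintegral_mul_const _ (by fun_prop)

theorem triconv_eq_lintegral_prod {F G H : ℤ × ℝ → ℝ≥0∞} (hF : Measurable F) (hG : Measurable G)
    (hH : Measurable H) (p : ℤ × ℝ) :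
    triconv F G H p =
      ∫⁻ z, F z.2 * G (z.1 - z.2) * H (z.1 - p) ∂(freqMeasure.prod freqMeasure) := by
  rw [lintegral_prod _ (by fun_prop), triconv]

theorem measurable_triconv {F G H : ℤ × ℝ → ℝ≥0∞} (hF : Measurable F) (hG : Measurable G)
    (hH : Measurable H) : Measurable (triconv F G H) := by
  have := measurable_lconv hF hG
  rw [funext (triconv_eq hF hG)]
  exact Measurable.lintegral_prod_right'
    (f := fun z : (ℤ × ℝ) × (ℤ × ℝ) => lconv F G z.2 * H (z.2 - z.1)) (by fun_prop)

/-- The dual form of the bilinear estimate. Through Plancherel it bounds the `L²` norm of a square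
by the norm of order `3/8`: it is the Strichartz estimate in `L⁴`. -/
theorem exists_l2_lconv_le : ∃ C : ℝ≥0∞, C ≠ ⊤ ∧ ∀ F G : ℤ × ℝ → ℝ≥0∞,
    Measurable F → Measurable G →
    l2 freqMeasure (lconv F G) ≤ C * (l2 freqMeasure (fun p => ewt 0 (3 / 8) 1 p * F p) *
        l2 freqMeasure (fun p => ewt 0 (3 / 8) 1 p * G p)) := by
  obtain ⟨C, hC, h⟩ := exists_bilinear_le
  refine ⟨C, hC, fun F G hF hG => ?_⟩
  refine l2_le_of_forall_lintegral_mul_le (measurable_lconv hF hG) fun H hH => ?_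
  rw [mul_assoc]
  refine le_trans (le_of_eq ?_) (h F G H hF hG hH)
  calc ∫⁻ r, lconv F G r * H r ∂freqMeasure
      = ∫⁻ r, ∫⁻ q, F q * G (r - q) * H r ∂freqMeasure ∂freqMeasure :=
        lintegral_congr fun r => (lintegral_mul_const _ (by fun_prop)).symm
    _ = ∫⁻ q, ∫⁻ r, F q * G (r - q) * H r ∂freqMeasure ∂freqMeasure :=
        lintegral_lintegral_swap (Measurable.aemeasurable (by fun_prop))
    _ = _ := by
        refine lintegral_congr fun q => ?_
        rw [← lintegral_comp_add_left (fun r => F q * G (r - q) * H r) q]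
        simp

/-- Paired with `K`, the trilinear form is the `L²` pairing of `F * G` with `K' * H`, where `K'` is
`K` with the output weight: the factor `H (r - p)`, which stands for the complex conjugate, is a
convolution in the dual variable. Two applications of the bilinear estimate suffice, because the
weight of order `3/8` turns `K'` back into `K`. -/
theorem exists_l2_triconv_le_zero : ∃ C : ℝ≥0∞, C ≠ ⊤ ∧ ∀ F G H : ℤ × ℝ → ℝ≥0∞,
    Measurable F → Measurable G → Measurable H →
    l2 freqMeasure (fun p => ewt 0 (-(3 / 8)) 1 p * triconv F G H p) ≤
      C * (l2 freqMeasure (fun p => ewt 0 (3 / 8) 1 p * F p) *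
        l2 freqMeasure (fun p => ewt 0 (3 / 8) 1 p * G p) *
        l2 freqMeasure (fun p => ewt 0 (3 / 8) 1 p * H p)) := by
  obtain ⟨C, hC, h⟩ := exists_l2_lconv_le
  refine ⟨C * C, ENNReal.mul_ne_top hC hC, fun F G H hF hG hH => ?_⟩
  have hFG := measurable_lconv hF hG
  have hT := measurable_triconv hF hG hH
  refine l2_le_of_forall_lintegral_mul_le (by fun_prop) fun K hK => ?_
  set K' := fun p => ewt 0 (-(3 / 8)) 1 p * K p with hK'
  have hK'm : Measurable K' := by fun_prop
  have hKK : (fun p => ewt 0 (3 / 8) 1 p * K' p) = K := by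
    ext p
    rw [hK', ← mul_assoc, ewt, ewt, ← ENNReal.ofReal_mul (wt_pos one_pos p).le]
    have : 0 < 1 + |modulation p| := by positivity
    simp only [wt, Real.rpow_zero, one_mul]
    rw [← Real.rpow_add this]
    simp
  calc ∫⁻ p, ewt 0 (-(3 / 8)) 1 p * triconv F G H p * K p ∂freqMeasure
      = ∫⁻ p, ∫⁻ r, lconv F G r * H (r - p) * K' p ∂freqMeasure ∂freqMeasure := by
        refine lintegral_congr fun p => ?_
        rw [lintegral_mul_const _ (by fun_prop), triconv_eq hF hG]
        ring
    _ = ∫⁻ r, ∫⁻ p, lconv F G r * H (r - p) * K' p ∂freqMeasure ∂freqMeasure :=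
        lintegral_lintegral_swap (Measurable.aemeasurable (by fun_prop))
    _ = ∫⁻ r, lconv F G r * lconv K' H r ∂freqMeasure := by
        refine lintegral_congr fun r => ?_
        rw [lconv, lconv, ← lintegral_const_mul _ (by fun_prop)]
        refine lintegral_congr fun p => ?_
        ring
    _ ≤ l2 freqMeasure (lconv F G) * l2 freqMeasure (lconv K' H) :=
        lintegral_mul_le_l2 hFG.aemeasurable (measurable_lconv hK'm hH).aemeasurable
    _ ≤ (C * (l2 freqMeasure (fun p => ewt 0 (3 / 8) 1 p * F p) *
        l2 freqMeasure (fun p => ewt 0 (3 / 8) 1 p * G p))) *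
        (C * (l2 freqMeasure K * l2 freqMeasure (fun p => ewt 0 (3 / 8) 1 p * H p))) := by
        gcongr
        · exact h F G hF hG
        · have := h K' H hK'm hH
          rwa [hKK] at this
    _ = _ := by ring

theorem abs_le_bracket (x : ℝ) : |x| ≤ bracket x :=
  Real.abs_le_sqrt (by linarith)

theorem bracket_add_le (x y : ℝ) : bracket (x + y) ≤ bracket x + |y| := by
  have h : bracket x ^ 2 = 1 + x ^ 2 := Real.sq_sqrt (by positivity)
  refine Real.sqrt_le_iff.2 ⟨by have := bracket_pos x; positivity, ?_⟩
  have := abs_le_bracket x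
  nlinarith [sq_abs y, le_abs_self (x * y), abs_mul x y, abs_nonneg y, abs_nonneg x]

theorem bracket_rpow_le {s : ℝ} (hs : 0 ≤ s) (x y z : ℝ) :
    bracket (x + y - z) ^ s ≤ 3 ^ s * (bracket x ^ s + bracket y ^ s + bracket z ^ s) := by
  have hx := bracket_pos x
  have hy := bracket_pos y
  have hz := bracket_pos z
  have hxs := Real.rpow_pos_of_pos hx s
  have hys := Real.rpow_pos_of_pos hy s
  have hzs := Real.rpow_pos_of_pos hz s
  have h : bracket (x + y - z) ≤ bracket x + bracket y + bracket z := by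
    have h1 := bracket_add_le (x + y) (-z)
    have h2 := bracket_add_le x y
    rw [abs_neg] at h1
    have := abs_le_bracket y
    have := abs_le_bracket z
    rw [sub_eq_add_neg]; linarith
  have key : ∀ M, 0 < M → bracket x + bracket y + bracket z ≤ 3 * M →
      M ^ s ≤ bracket x ^ s + bracket y ^ s + bracket z ^ s →
      bracket (x + y - z) ^ s ≤ 3 ^ s * (bracket x ^ s + bracket y ^ s + bracket z ^ s) := by
    intro M hM h1 h2
    calc bracket (x + y - z) ^ s ≤ (3 * M) ^ s :=
          Real.rpow_le_rpow (bracket_pos _).le (h.trans h1) hs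
      _ = 3 ^ s * M ^ s := Real.mul_rpow (by norm_num) hM.le
      _ ≤ _ := by gcongr
  rcases le_total (bracket x) (bracket y) with h1 | h1
  · rcases le_total (bracket y) (bracket z) with h2 | h2
    · exact key _ hz (by linarith) (by linarith)
    · exact key _ hy (by linarith) (by linarith)
  · rcases le_total (bracket x) (bracket z) with h2 | h2
    · exact key _ hz (by linarith) (by linarith)
    · exact key _ hx (by linarith) (by linarith)

theorem ewt_mul_ewt (s b s' b' : ℝ) {l : ℝ} (hl : 0 < l) (p : ℤ × ℝ) :
    ewt s b l p * ewt s' b' l p = ewt (s + s') (b + b') l p := by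
  rw [ewt, ewt, ewt, ← ENNReal.ofReal_mul (wt_pos hl p).le]
  congr 1
  have : 0 < l + |modulation p| := by positivity
  rw [wt, wt, wt, Real.rpow_add this, Real.rpow_add (bracket_pos _)]
  ring

theorem ewt_mono_left {s s' : ℝ} (h : s ≤ s') (b : ℝ) {l : ℝ} (hl : 0 < l) (p : ℤ × ℝ) :
    ewt s b l p ≤ ewt s' b l p := by
  refine ENNReal.ofReal_le_ofReal ?_
  unfold wt
  have : 0 < l + |modulation p| := by positivity
  gcongr
  exact one_le_bracket _

/-- Bourgain's trilinear estimate. -/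
theorem exists_l2_triconv_le {s : ℝ} (hs : 0 ≤ s) : ∃ C : ℝ≥0∞, C ≠ ⊤ ∧
    ∀ F G H : ℤ × ℝ → ℝ≥0∞, Measurable F → Measurable G → Measurable H →
    l2 freqMeasure (fun p => ewt s (-(3 / 8)) 1 p * triconv F G H p) ≤
      C * (l2 freqMeasure (fun p => ewt s (3 / 8) 1 p * F p) *
        l2 freqMeasure (fun p => ewt s (3 / 8) 1 p * G p) *
        l2 freqMeasure (fun p => ewt s (3 / 8) 1 p * H p)) := by
  obtain ⟨C, hC, h⟩ := exists_l2_triconv_le_zero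
  set c : ℝ≥0∞ := ENNReal.ofReal (3 ^ s)
  refine ⟨3 * (c * C), by finiteness, fun F G H hF hG hH => ?_⟩
  set B : ℤ × ℝ → ℝ≥0∞ := ewt s 0 1
  have hB : Measurable B := measurable_ewt _ _ _
  have hBF : Measurable fun p => B p * F p := by fun_prop
  have hBG : Measurable fun p => B p * G p := by fun_prop
  have hBH : Measurable fun p => B p * H p := by fun_prop
  have hW : ∀ p, ewt 0 (3 / 8) 1 p * B p = ewt s (3 / 8) 1 p := fun p => by
    rw [ewt_mul_ewt _ _ _ _ one_pos]; simp
  -- Since `p = q + (r - q) - (r - p)`, the spatial weight of the output can be moved to one of the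
  -- three factors.
  have hBp : ∀ p q r : ℤ × ℝ, B p ≤ c * (B q + B (r - q) + B (r - p)) := by
    intro p q r
    have e : ∀ p, B p = ENNReal.ofReal (bracket p.1 ^ s) := by intro p; simp [B, ewt, wt]
    have hp : ∀ x : ℝ, 0 ≤ bracket x ^ s := fun x => (Real.rpow_pos_of_pos (bracket_pos x) s).le
    rw [e, e, e, e, ← ENNReal.ofReal_add (hp _) (hp _),
      ← ENNReal.ofReal_add (add_nonneg (hp _) (hp _)) (hp _), ← ENNReal.ofReal_mul (by positivity)]
    refine ENNReal.ofReal_le_ofReal (le_trans (le_of_eq ?_) (bracket_rpow_le hs _ _ _))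
    congr 2
    simp
  have hT := measurable_triconv hF hG hH
  have hT₁ := measurable_triconv hBF hG hH
  have hT₂ := measurable_triconv hF hBG hH
  have hT₃ := measurable_triconv hF hG hBH
  have hpt : ∀ p, ewt s (-(3 / 8)) 1 p * triconv F G H p ≤
      c * (ewt 0 (-(3 / 8)) 1 p * triconv (fun p => B p * F p) G H p +
        ewt 0 (-(3 / 8)) 1 p * triconv F (fun p => B p * G p) H p +
        ewt 0 (-(3 / 8)) 1 p * triconv F G (fun p => B p * H p) p) := by
    intro p
    have e : ewt s (-(3 / 8)) 1 p = ewt 0 (-(3 / 8)) 1 p * B p := by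
      rw [ewt_mul_ewt _ _ _ _ one_pos]; simp
    rw [e, ← mul_add, ← mul_add, mul_assoc, mul_left_comm c]
    refine mul_le_mul' le_rfl ?_
    rw [triconv_eq_lintegral_prod hF hG hH, triconv_eq_lintegral_prod hBF hG hH,
      triconv_eq_lintegral_prod hF hBG hH, triconv_eq_lintegral_prod hF hG hBH,
      ← lintegral_add_left (by fun_prop), ← lintegral_add_left (by fun_prop),
      ← lintegral_const_mul' (B p) _ ENNReal.ofReal_ne_top,
      ← lintegral_const_mul' c _ ENNReal.ofReal_ne_top]
    refine lintegral_mono fun ⟨r, q⟩ => ?_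
    calc B p * (F q * G (r - q) * H (r - p))
        ≤ (c * (B q + B (r - q) + B (r - p))) * (F q * G (r - q) * H (r - p)) := by
          gcongr; exact hBp p q r
      _ = _ := by ring
  have hle : ∀ F : ℤ × ℝ → ℝ≥0∞, l2 freqMeasure (fun p => ewt 0 (3 / 8) 1 p * F p) ≤
      l2 freqMeasure (fun p => ewt s (3 / 8) 1 p * F p) := fun F =>
    l2_mono fun p => by gcongr; exact ewt_mono_left hs _ one_pos p
  have heq : ∀ F : ℤ × ℝ → ℝ≥0∞, l2 freqMeasure (fun p => ewt 0 (3 / 8) 1 p * (B p * F p)) =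
      l2 freqMeasure (fun p => ewt s (3 / 8) 1 p * F p) := fun F => by
    simp_rw [← mul_assoc, hW]
  refine (l2_mono hpt).trans ?_
  rw [l2_const_mul _ (by fun_prop)]
  set R := l2 freqMeasure (fun p => ewt s (3 / 8) 1 p * F p) *
        l2 freqMeasure (fun p => ewt s (3 / 8) 1 p * G p) *
        l2 freqMeasure (fun p => ewt s (3 / 8) 1 p * H p)
  calc _ ≤ c * (C * R + C * R + C * R) := by
        gcongr
        refine (l2_add_le (by fun_prop) (by fun_prop)).trans (add_le_add
          ((l2_add_le (by fun_prop) (by fun_prop)).trans (add_le_add ?_ ?_)) ?_)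
        · refine (h _ _ _ hBF hG hH).trans ?_
          rw [heq]
          exact mul_le_mul' le_rfl (mul_le_mul' (mul_le_mul' le_rfl (hle _)) (hle _))
        · refine (h _ _ _ hF hBG hH).trans ?_
          rw [heq]
          exact mul_le_mul' le_rfl (mul_le_mul' (mul_le_mul' (hle _) le_rfl) (hle _))
        · refine (h _ _ _ hF hG hBH).trans ?_
          rw [heq]
          exact mul_le_mul' le_rfl (mul_le_mul' (mul_le_mul' (hle _) (hle _)) le_rfl)
    _ = 3 * (c * C) * R := by ring

/-! ### Waves, time cutoffs and the kernel of the localized Duhamel integral. -/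

/-- The wave `exp (i τ t)`. -/
noncomputable def wave (τ t : ℝ) : ℂ := Complex.exp (((τ * t : ℝ) : ℂ) * Complex.I)

@[simp]
theorem norm_wave (τ t : ℝ) : ‖wave τ t‖ = 1 := Complex.norm_exp_ofReal_mul_I _

theorem wave_add_left (τ σ t : ℝ) : wave (τ + σ) t = wave τ t * wave σ t := by
  rw [wave, wave, wave, ← Complex.exp_add]; push_cast; ring_nf

theorem wave_add_right (τ t r : ℝ) : wave τ (t + r) = wave τ t * wave τ r := by
  rw [wave, wave, wave, ← Complex.exp_add]; push_cast; ring_nf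

@[simp]
theorem wave_zero_right (τ : ℝ) : wave τ 0 = 1 := by simp [wave]

theorem conj_wave (τ t : ℝ) : (starRingEnd ℂ) (wave τ t) = wave (-τ) t := by
  rw [wave, wave, ← Complex.exp_conj]; simp

@[fun_prop]
theorem continuous_wave : Continuous fun z : ℝ × ℝ => wave z.1 z.2 := by
  unfold wave; fun_prop

@[fun_prop]
theorem Continuous.wave {α : Type*} [TopologicalSpace α] {f g : α → ℝ} (hf : Continuous f)
    (hg : Continuous g) : Continuous fun a => wave (f a) (g a) :=
  continuous_wave.comp (hf.prodMk hg)

@[fun_prop]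
theorem Measurable.wave {α : Type*} [MeasurableSpace α] {f g : α → ℝ} (hf : Measurable f)
    (hg : Measurable g) : Measurable fun a => wave (f a) (g a) :=
  continuous_wave.measurable.comp (hf.prodMk hg)

/-- The properties of the Fourier transform of a time cutoff that equals `1` on `[-1/l, 1/l]`. -/
structure IsCutoff (C l : ℝ) (g : ℝ → ℂ) : Prop where
  differentiable : Differentiable ℝ g
  norm_le : ∀ ρ, ‖g ρ‖ ≤ C * l / (l + |ρ|) ^ 2
  norm_deriv_le : ∀ ρ, ‖deriv g ρ‖ ≤ C / (l + |ρ|) ^ 2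
  integral_eq : ∀ t, |t| ≤ 1 / l → ∫ ρ, g ρ * wave ρ t = 1

theorem _root_.SchwartzMap.exists_norm_le_div_sq (φ : SchwartzMap ℝ ℂ) :
    ∃ C : ℝ, 0 < C ∧ ∀ x, ‖φ x‖ ≤ C / (1 + |x|) ^ 2 := by
  obtain ⟨C₀, h₀, h0⟩ := φ.decay 0 0
  obtain ⟨C₂, h₂, h2⟩ := φ.decay 2 0
  refine ⟨2 * (C₀ + C₂), by positivity, fun x => ?_⟩
  have e0 := h0 x
  have e2 := h2 x
  simp only [pow_zero, one_mul, norm_iteratedFDeriv_zero, Real.norm_eq_abs] at e0 e2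
  rw [le_div_iff₀ (by positivity)]
  nlinarith [norm_nonneg (φ x), sq_nonneg (1 - |x|),
    mul_nonneg (norm_nonneg (φ x)) (sq_nonneg (1 - |x|))]

/-- For a bump `η` with Fourier transform `φ`, the choice `g ρ = φ (ρ / a) / a` with `a = 2πl`
represents `η (l t)` as a superposition of waves. All cutoffs are dilations of one, so the Schwartz
decay of `φ` and its derivative gives one constant for all `l`. -/
theorem exists_isCutoff : ∃ C : ℝ, 0 < C ∧ ∀ l : ℝ, 0 < l → ∃ g, IsCutoff C l g := by
  let β : ContDiffBump (0 : ℝ) := ⟨1, 2, one_pos, one_lt_two⟩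
  have hβ : HasCompactSupport fun x => (β x : ℂ) :=
    β.hasCompactSupport.comp_left (g := Complex.ofReal) rfl
  have hβ' : ContDiff ℝ (⊤ : ℕ∞) fun x => (β x : ℂ) :=
    Complex.ofRealCLM.contDiff.comp β.contDiff
  let η : SchwartzMap ℝ ℂ := hβ.toSchwartzMap hβ'
  have hη : ∀ t, η t = β t := fun t => rfl
  let φ : SchwartzMap ℝ ℂ := 𝓕 η
  have hinv : ∀ t, η t = ∫ w, wave (2 * Real.pi * w) t * φ w := by
    intro t
    have h1 : 𝓕⁻ φ = η := FourierTransform.fourierInv_fourier_eq η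
    rw [← h1, SchwartzMap.fourierInv_coe, Real.fourierInv_eq']
    refine integral_congr_ae (Eventually.of_forall fun w => ?_)
    simp only [smul_eq_mul, wave]
    congr 3
    simp; ring
  obtain ⟨C₁, hC₁, h1⟩ := φ.exists_norm_le_div_sq
  obtain ⟨C₂, hC₂, h2⟩ := (SchwartzMap.derivCLM ℂ ℂ φ).exists_norm_le_div_sq
  refine ⟨2 * Real.pi * (C₁ + C₂), by positivity, fun l hl => ?_⟩
  set a : ℝ := 2 * Real.pi * l with ha
  have hpi : 1 ≤ 2 * Real.pi := by linarith [Real.pi_gt_three]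
  have hla : l ≤ a := by rw [ha]; nlinarith
  have ha0 : 0 < a := hl.trans_le hla
  have hscale : ∀ ρ : ℝ, (1 + |ρ / a|) ^ 2 = (a + |ρ|) ^ 2 / a ^ 2 := fun ρ => by
    rw [abs_div, abs_of_pos ha0, ← div_pow]; congr 1; field_simp
  have hd : ∀ ρ : ℝ, HasDerivAt (fun ρ : ℝ => (a : ℂ)⁻¹ * φ (ρ / a))
      ((a : ℂ)⁻¹ * (a⁻¹ • deriv φ (ρ / a))) ρ := by
    intro ρ
    refine HasDerivAt.const_mul _ ?_
    have hφ : HasDerivAt φ (deriv φ (ρ / a)) (ρ / a) := φ.differentiableAt.hasDerivAt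
    have := hφ.scomp ρ ((hasDerivAt_id ρ).div_const a)
    simpa [Function.comp_def] using this
  refine ⟨fun ρ => (a : ℂ)⁻¹ * φ (ρ / a), fun ρ => (hd ρ).differentiableAt, fun ρ => ?_, fun ρ => ?_,
    fun t ht => ?_⟩
  · rw [norm_mul, norm_inv, Complex.norm_real, Real.norm_of_nonneg ha0.le]
    calc a⁻¹ * ‖φ (ρ / a)‖ ≤ a⁻¹ * (C₁ / (1 + |ρ / a|) ^ 2) := by gcongr; exact h1 _
      _ = C₁ * a / (a + |ρ|) ^ 2 := by rw [hscale]; field_simp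
      _ ≤ (C₁ + C₂) * a / (l + |ρ|) ^ 2 := by gcongr; linarith
      _ = _ := by rw [ha]; ring
  · rw [(hd ρ).deriv, norm_mul, norm_inv, Complex.norm_real, norm_smul, norm_inv,
      Real.norm_of_nonneg ha0.le]
    calc a⁻¹ * (a⁻¹ * ‖deriv φ (ρ / a)‖) ≤ a⁻¹ * (a⁻¹ * (C₂ / (1 + |ρ / a|) ^ 2)) := by
          gcongr; exact h2 _
      _ = 1 * C₂ / (a + |ρ|) ^ 2 := by rw [hscale]; field_simp
      _ ≤ (2 * Real.pi) * (C₁ + C₂) / (l + |ρ|) ^ 2 := by gcongr; linarith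
  · have h3 : ∀ ρ : ℝ, (a : ℂ)⁻¹ * φ (ρ / a) * wave ρ t =
        (fun w => (a : ℂ)⁻¹ * (wave (2 * Real.pi * w) (l * t) * φ w)) (ρ / a) := by
      intro ρ
      have : wave ρ t = wave (2 * Real.pi * (ρ / a)) (l * t) := by
        unfold wave; congr 3; rw [ha]; field_simp
      rw [this]; ring
    simp_rw [h3]
    rw [Measure.integral_comp_div (fun w => (a : ℂ)⁻¹ * (wave (2 * Real.pi * w) (l * t) * φ w)),
      integral_const_mul, ← hinv, hη, abs_of_pos ha0, Complex.real_smul, ← mul_assoc,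
      mul_inv_cancel₀ (by exact_mod_cast ha0.ne'), one_mul]
    have : β (l * t) = 1 := by
      refine β.one_of_mem_closedBall ?_
      rw [mem_closedBall_zero_iff, Real.norm_eq_abs, abs_mul, abs_of_pos hl]
      calc l * |t| ≤ l * (1 / l) := by gcongr
        _ = 1 := by field_simp
    rw [this]; simp

/-- The kernel of the localized Duhamel operator. -/
noncomputable def duhamelKernel (g : ℝ → ℂ) (ρ θ : ℝ) : ℂ :=
  (g (ρ - θ) - g ρ) / (Complex.I * θ)

/-- For `|θ| ≥ l` the two values of `g` are bounded separately and the denominator gives the decay.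
For `|θ| ≤ l` the numerator is small by the mean value inequality; on the segment from `ρ` to `ρ -
θ` the quantity `l + |x|` is at least half of `l + |ρ|`. -/
theorem IsCutoff.norm_duhamelKernel_le {C l : ℝ} {g : ℝ → ℂ} (hg : IsCutoff C l g) (hC : 0 < C)
    (hl : 0 < l) (ρ θ : ℝ) :
    ‖duhamelKernel g ρ θ‖ ≤
      8 * C * (l / (l + |θ|) * (1 / (l + |ρ - θ|) ^ 2 + 1 / (l + |ρ|) ^ 2)) := by
  rw [duhamelKernel, norm_div, norm_mul, Complex.norm_I, one_mul, Complex.norm_real,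
    Real.norm_eq_abs]
  have hw : 0 < l + |θ| := by positivity
  rcases le_total l |θ| with h | h
  · have h0 : 0 < |θ| := hl.trans_le h
    have e1 : ‖g (ρ - θ) - g ρ‖ ≤ C * l * (1 / (l + |ρ - θ|) ^ 2 + 1 / (l + |ρ|) ^ 2) := by
      refine (norm_sub_le _ _).trans ((add_le_add (hg.norm_le _) (hg.norm_le _)).trans ?_)
      apply le_of_eq; ring
    rw [div_le_iff₀ h0]
    refine e1.trans ?_
    have e2 : 1 ≤ 8 * (1 / (l + |θ|)) * |θ| := by
      rw [mul_one_div, div_mul_eq_mul_div, le_div_iff₀ hw]; linarith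
    set X := 1 / (l + |ρ - θ|) ^ 2 + 1 / (l + |ρ|) ^ 2
    have hX : 0 ≤ C * l * X := by positivity
    calc C * l * X ≤ C * l * X * (8 * (1 / (l + |θ|)) * |θ|) := le_mul_of_one_le_right hX e2
      _ = _ := by ring
  · have e1 : ‖g (ρ - θ) - g ρ‖ ≤ 4 * C / (l + |ρ|) ^ 2 * |θ| := by
      have := (convex_uIcc ρ (ρ - θ)).norm_image_sub_le_of_norm_deriv_le (f := g)
        (C := 4 * C / (l + |ρ|) ^ 2) (fun x _ => hg.differentiable x) (fun x hx => ?_)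
        left_mem_uIcc right_mem_uIcc
      · simpa using this
      · refine (hg.norm_deriv_le x).trans ?_
        have h1 : |x - ρ| ≤ |θ| := by
          have := abs_sub_left_of_mem_uIcc hx
          simpa using this
        have h2 : |ρ| ≤ |x| + |θ| := by
          have := abs_sub_abs_le_abs_sub ρ x
          rw [abs_sub_comm] at this
          linarith
        rw [div_le_div_iff₀ (by positivity) (by positivity)]
        have h3 : l + |ρ| ≤ 2 * (l + |x|) := by linarith [abs_nonneg x]
        have h4 : (l + |ρ|) ^ 2 ≤ (2 * (l + |x|)) ^ 2 := by gcongr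
        nlinarith
    have e2 : ‖g (ρ - θ) - g ρ‖ / |θ| ≤ 4 * C / (l + |ρ|) ^ 2 :=
      div_le_of_le_mul₀ (abs_nonneg _) (by positivity) e1
    refine e2.trans ?_
    have e3 : 1 ≤ 2 * (l / (l + |θ|)) := by
      rw [← mul_div_assoc, le_div_iff₀ hw]; linarith
    have e4 : 0 ≤ 1 / (l + |ρ - θ|) ^ 2 := by positivity
    have e5 : 0 ≤ 8 * C * (l / (l + |θ|)) := by positivity
    calc 4 * C / (l + |ρ|) ^ 2 ≤ 4 * C / (l + |ρ|) ^ 2 * (2 * (l / (l + |θ|))) :=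
          le_mul_of_one_le_right (by positivity) e3
      _ = 8 * C * (l / (l + |θ|)) * (1 / (l + |ρ|) ^ 2) := by ring
      _ ≤ 8 * C * (l / (l + |θ|)) * (1 / (l + |ρ - θ|) ^ 2 + 1 / (l + |ρ|) ^ 2) := by
          gcongr; linarith
      _ = _ := by ring

/-! ### One-dimensional estimates in the modulation variable. -/

/-- `∫ (1 + |x|)^{-a} dx`. -/
noncomputable def bracketIntegral (a : ℝ) : ℝ≥0∞ := ∫⁻ x : ℝ, ENNReal.ofReal ((1 + |x|) ^ (-a))

theorem bracketIntegral_ne_top {a : ℝ} (ha : 1 < a) : bracketIntegral a ≠ ⊤ :=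
  (finite_integral_one_add_norm (E := ℝ) (by simpa using ha)).ne

theorem lintegral_rpow_add_abs {l : ℝ} (hl : 0 < l) (a : ℝ) :
    ∫⁻ x : ℝ, ENNReal.ofReal ((l + |x|) ^ (-a)) =
      ENNReal.ofReal (l ^ (1 - a)) * bracketIntegral a := by
  have h1 : ∀ x : ℝ, ENNReal.ofReal ((l + |l * x|) ^ (-a)) =
      ENNReal.ofReal (l ^ (-a)) * ENNReal.ofReal ((1 + |x|) ^ (-a)) := fun x => by
    rw [← ENNReal.ofReal_mul (by positivity), ← Real.mul_rpow hl.le (by positivity), abs_mul,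
      abs_of_pos hl]
    congr 2; ring
  have h2 : ∫⁻ x : ℝ, ENNReal.ofReal ((l + |x|) ^ (-a)) =
      ENNReal.ofReal |l| * ∫⁻ x : ℝ, ENNReal.ofReal ((l + |l * x|) ^ (-a)) := by
    nth_rewrite 1 [← Real.smul_map_volume_mul_left hl.ne']
    rw [lintegral_smul_measure, lintegral_map (by fun_prop) (by fun_prop), smul_eq_mul]
  rw [h2]
  simp_rw [h1]
  rw [lintegral_const_mul _ (by fun_prop), ← mul_assoc, ← ENNReal.ofReal_mul (abs_nonneg _),
    abs_of_pos hl, bracketIntegral, sub_eq_add_neg, Real.rpow_add hl, Real.rpow_one]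

/-- Young's inequality `L¹ * L² ⊆ L²`. -/
theorem l2_conv_le {j M : ℝ → ℝ≥0∞} (hj : Measurable j) (hM : Measurable M) :
    l2 volume (fun ρ => ∫⁻ θ, j (ρ - θ) * M θ) ≤ (∫⁻ x, j x) * l2 volume M := by
  have hpt : ∀ ρ, (∫⁻ θ, j (ρ - θ) * M θ) ^ 2 ≤ (∫⁻ x, j x) * ∫⁻ θ, j (ρ - θ) * M θ ^ 2 := by
    intro ρ
    -- Cauchy-Schwarz with `j` split into two square roots; half of the mass of `j` goes to each
    -- factor.
    have h1 : ∫⁻ θ, j (ρ - θ) * M θ =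
        ∫⁻ θ, (j (ρ - θ)) ^ (1 / 2 : ℝ) * ((j (ρ - θ)) ^ (1 / 2 : ℝ) * M θ) := by
      refine lintegral_congr fun θ => ?_
      rw [← mul_assoc, ← sq, sq_sqrt]
    have h2 : ∫⁻ θ, j (ρ - θ) = ∫⁻ x, j x := lintegral_sub_left_eq_self j ρ
    rw [h1, ← h2]
    refine (pow_le_pow_left' (lintegral_mul_le_l2 (by fun_prop) (by fun_prop)) 2).trans ?_
    rw [mul_pow, l2_sq, l2_sq]
    simp_rw [mul_pow, sq_sqrt]
    rfl
  rw [l2_le_iff]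
  calc ∫⁻ ρ, (∫⁻ θ, j (ρ - θ) * M θ) ^ 2
      ≤ ∫⁻ ρ, (∫⁻ x, j x) * ∫⁻ θ, j (ρ - θ) * M θ ^ 2 := lintegral_mono hpt
    _ = (∫⁻ x, j x) * ∫⁻ ρ, ∫⁻ θ, j (ρ - θ) * M θ ^ 2 :=
        lintegral_const_mul _ (Measurable.lintegral_prod_right'
          (f := fun z : ℝ × ℝ => j (z.1 - z.2) * M z.2 ^ 2) (by fun_prop))
    _ = (∫⁻ x, j x) * ∫⁻ θ, ∫⁻ ρ, j (ρ - θ) * M θ ^ 2 := by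
        rw [lintegral_lintegral_swap (Measurable.aemeasurable (by fun_prop))]
    _ = (∫⁻ x, j x) * ∫⁻ θ, (∫⁻ x, j x) * M θ ^ 2 := by
        congr 1
        refine lintegral_congr fun θ => ?_
        rw [lintegral_mul_const _ (by fun_prop), lintegral_sub_right_eq_self j θ]
    _ = _ := by
        rw [lintegral_const_mul _ (by fun_prop), ← l2_sq]; ring

/-- Bound for the localized Duhamel operator on functions of time. -/
theorem exists_l2_duhamel_le {b : ℝ} (hb : 1 / 2 < b) (hb1 : b < 1) : ∃ C : ℝ≥0∞, C ≠ ⊤ ∧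
    ∀ l : ℝ, 0 < l → ∀ N : ℝ → ℝ≥0∞, Measurable N →
      l2 volume (fun ρ => ENNReal.ofReal ((l + |ρ|) ^ b) * ∫⁻ θ, ENNReal.ofReal
          (l / (l + |θ|) * (1 / (l + |ρ - θ|) ^ 2 + 1 / (l + |ρ|) ^ 2)) * N θ) ≤
        C * l2 volume (fun θ => ENNReal.ofReal ((l + |θ|) ^ (b - 1)) * N θ) := by
  refine ⟨bracketIntegral (2 - b) + (bracketIntegral (4 - 2 * b)) ^ (1 / 2 : ℝ) *
    (bracketIntegral (2 * b)) ^ (1 / 2 : ℝ), ?_, fun l hl N hN => ?_⟩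
  · have h1 := bracketIntegral_ne_top (a := 2 - b) (by linarith)
    have h2 := bracketIntegral_ne_top (a := 4 - 2 * b) (by linarith)
    have h3 := bracketIntegral_ne_top (a := 2 * b) (by linarith)
    finiteness
  set M : ℝ → ℝ≥0∞ := fun θ => ENNReal.ofReal ((l + |θ|) ^ (b - 1)) * N θ with hMdef
  have hM : Measurable M := by fun_prop
  set j : ℝ → ℝ≥0∞ := fun x => ENNReal.ofReal (l ^ (1 - b) * (l + |x|) ^ (-(2 - b)))
  have hj : Measurable j := by fun_prop
  have hw : ∀ x : ℝ, 0 < l + |x| := fun x => by positivity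
  have hjint : ∫⁻ x, j x = bracketIntegral (2 - b) := by
    simp only [j]
    simp_rw [ENNReal.ofReal_mul (Real.rpow_nonneg hl.le (1 - b))]
    rw [lintegral_const_mul _ (by fun_prop), lintegral_rpow_add_abs hl, ← mul_assoc,
      ← ENNReal.ofReal_mul (by positivity), ← Real.rpow_add hl]
    ring_nf; simp
  -- The first term of the kernel becomes a convolution after `(l + |ρ|)^b` is distributed over `l +
  -- |ρ - θ|` and `l + |θ|`; the convolution kernel is integrable because `b < 1`. The second term
  -- is a product of a function of `ρ` and a function of `θ`, and `(l + |θ|)^(-b)` is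
  -- square-integrable because `b > 1/2`. The powers of `l` cancel in both.
  have hpt : ∀ ρ, ENNReal.ofReal ((l + |ρ|) ^ b) * ∫⁻ θ, ENNReal.ofReal
          (l / (l + |θ|) * (1 / (l + |ρ - θ|) ^ 2 + 1 / (l + |ρ|) ^ 2)) * N θ ≤
      (∫⁻ θ, j (ρ - θ) * M θ) + ENNReal.ofReal (l * (l + |ρ|) ^ (-(2 - b))) *
        ∫⁻ θ, ENNReal.ofReal ((l + |θ|) ^ (-b)) * M θ := by
    intro ρ
    rw [← lintegral_const_mul _ (by fun_prop), ← lintegral_const_mul _ (by fun_prop),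
      ← lintegral_add_left (by fun_prop)]
    refine lintegral_mono fun θ => ?_
    simp only [hMdef, j]
    rw [← mul_assoc, ← mul_assoc, ← mul_assoc, ← mul_assoc, ← add_mul,
      ← ENNReal.ofReal_mul (by positivity), ← ENNReal.ofReal_mul (by positivity),
      ← ENNReal.ofReal_mul (by positivity), ← ENNReal.ofReal_mul (by positivity),
      ← ENNReal.ofReal_add (by positivity) (by positivity)]
    gcongr
    set x := l + |ρ| with hx
    set y := l + |θ| with hy
    set z := l + |ρ - θ| with hz
    have hx0 : 0 < x := hw _
    have hy0 : 0 < y := hw _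
    have hz0 : 0 < z := hw _
    have hxyz : x ≤ z * y / l := by
      rw [le_div_iff₀ hl]
      have h1 : |ρ| ≤ |ρ - θ| + |θ| := by
        have := abs_add_le (ρ - θ) θ
        simpa using this
      rw [hx, hy, hz]
      nlinarith [mul_nonneg (abs_nonneg (ρ - θ)) (abs_nonneg θ)]
    have hxb : x ^ b ≤ z ^ b * y ^ b * l ^ (-b) := by
      calc x ^ b ≤ (z * y / l) ^ b := Real.rpow_le_rpow hx0.le hxyz (by linarith)
        _ = _ := by
          rw [Real.div_rpow (by positivity) hl.le, Real.mul_rpow hz0.le hy0.le,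
            Real.rpow_neg hl.le, div_eq_mul_inv]
    have e1 : l / y * (1 / z ^ 2) * (z ^ b * y ^ b * l ^ (-b)) =
        l ^ (1 - b) * z ^ (-(2 - b)) * y ^ (b - 1) := by
      rw [show (1 : ℝ) - b = 1 + -b by ring, Real.rpow_add hl, Real.rpow_one,
        show -(2 - b) = b + -(2 : ℕ) by push_cast; ring, Real.rpow_add hz0, Real.rpow_neg hz0.le,
        Real.rpow_natCast, show b - 1 = b + -1 by ring, Real.rpow_add hy0, Real.rpow_neg_one]
      field_simp
    have e2 : x ^ b * (l / y * (1 / x ^ 2)) =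
        l * x ^ (-(2 - b)) * y ^ (-b) * y ^ (b - 1) := by
      rw [mul_assoc (l * _), ← Real.rpow_add hy0, show -b + (b - 1) = -1 by ring,
        Real.rpow_neg_one, show -(2 - b) = b + -(2 : ℕ) by push_cast; ring, Real.rpow_add hx0,
        Real.rpow_neg hx0.le, Real.rpow_natCast]
      field_simp
    rw [← e1, ← e2]
    have h3 : 0 ≤ l / y * (1 / z ^ 2) := by positivity
    nlinarith [mul_le_mul_of_nonneg_left hxb h3]
  have hX : l2 volume (fun ρ => ENNReal.ofReal (l * (l + |ρ|) ^ (-(2 - b)))) =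
      ENNReal.ofReal (l ^ (b - 1 / 2)) * (bracketIntegral (4 - 2 * b)) ^ (1 / 2 : ℝ) := by
    have h1 : ∀ ρ : ℝ, ENNReal.ofReal (l * (l + |ρ|) ^ (-(2 - b))) ^ 2 =
        ENNReal.ofReal (l ^ 2) * ENNReal.ofReal ((l + |ρ|) ^ (-(4 - 2 * b))) := fun ρ => by
      rw [← ENNReal.ofReal_pow (mul_nonneg hl.le (Real.rpow_nonneg (hw ρ).le _)),
        ← ENNReal.ofReal_mul (by positivity), mul_pow, ← Real.rpow_mul_natCast (hw ρ).le]
      congr 3; push_cast; ring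
    simp only [l2, h1]
    rw [lintegral_const_mul _ (by fun_prop), lintegral_rpow_add_abs hl, ← mul_assoc,
      ENNReal.mul_rpow_of_nonneg _ _ (by norm_num), ← ENNReal.ofReal_mul (by positivity),
      ENNReal.ofReal_rpow_of_pos (by positivity), ← Real.rpow_natCast l 2, ← Real.rpow_add hl,
      ← Real.rpow_mul hl.le]
    congr 3; push_cast; ring
  have hY : l2 volume (fun θ => ENNReal.ofReal ((l + |θ|) ^ (-b))) =
      ENNReal.ofReal (l ^ (1 / 2 - b)) * (bracketIntegral (2 * b)) ^ (1 / 2 : ℝ) := by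
    have h1 : ∀ ρ : ℝ, ENNReal.ofReal ((l + |ρ|) ^ (-b)) ^ 2 =
        ENNReal.ofReal ((l + |ρ|) ^ (-(2 * b))) := fun ρ => by
      rw [← ENNReal.ofReal_pow (Real.rpow_nonneg (hw ρ).le _), ← Real.rpow_mul_natCast (hw ρ).le]
      congr 2; push_cast; ring
    simp only [l2, h1]
    rw [lintegral_rpow_add_abs hl, ENNReal.mul_rpow_of_nonneg _ _ (by norm_num),
      ENNReal.ofReal_rpow_of_pos (by positivity), ← Real.rpow_mul hl.le]
    congr 3; ring
  refine (l2_mono hpt).trans ?_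
  refine (l2_add_le (Measurable.aemeasurable (Measurable.lintegral_prod_right'
    (f := fun z : ℝ × ℝ => j (z.1 - z.2) * M z.2) (by fun_prop))) (by fun_prop)).trans ?_
  rw [add_mul]
  gcongr
  · exact (l2_conv_le hj hM).trans (by rw [hjint])
  · simp_rw [mul_comm (ENNReal.ofReal (l * _))]
    rw [l2_const_mul _ (by fun_prop), hX]
    calc _ ≤ (ENNReal.ofReal (l ^ (1 / 2 - b)) * (bracketIntegral (2 * b)) ^ (1 / 2 : ℝ) *
          l2 volume M) * (ENNReal.ofReal (l ^ (b - 1 / 2)) *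
            (bracketIntegral (4 - 2 * b)) ^ (1 / 2 : ℝ)) := by
          gcongr
          rw [← hY]
          exact lintegral_mul_le_l2 (by fun_prop) hM.aemeasurable
      _ = (ENNReal.ofReal (l ^ (1 / 2 - b)) * ENNReal.ofReal (l ^ (b - 1 / 2))) *
          ((bracketIntegral (4 - 2 * b)) ^ (1 / 2 : ℝ) * (bracketIntegral (2 * b)) ^ (1 / 2 : ℝ) *
          l2 volume M) := by ring
      _ = _ := by
        rw [← ENNReal.ofReal_mul (by positivity), ← Real.rpow_add hl]
        simp

/-! ### Weighted norms on the frequency side and the linear estimates. -/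

/-- The norm `‖⟨k⟩^s (l + |τ + k²|)^b f‖` of a function of the frequency. -/
noncomputable def freqNorm (s b l : ℝ) (f : ℤ × ℝ → ℂ) : ℝ≥0∞ :=
  l2 freqMeasure (fun p => ewt s b l p * ‖f p‖ₑ)

/-- The norm `‖⟨k⟩^s c‖_{ℓ²}` of a sequence. -/
noncomputable def seqNorm (s : ℝ) (c : ℤ → ℝ≥0∞) : ℝ≥0∞ :=
  l2 Measure.count (fun k : ℤ => ENNReal.ofReal (bracket k ^ s) * c k)

/-- The `k`-th spatial Fourier coefficient at time `t` of the function with space-time Fourier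
transform `2π f`. -/
noncomputable def coeffAt (f : ℤ × ℝ → ℂ) (t : ℝ) (k : ℤ) : ℂ := ∫ τ, f (k, τ) * wave τ t

theorem ewt_eq_mul (s b : ℝ) (l : ℝ) (p : ℤ × ℝ) :
    ewt s b l p = ENNReal.ofReal (bracket p.1 ^ s) * ENNReal.ofReal ((l + |modulation p|) ^ b) := by
  rw [ewt, wt, ENNReal.ofReal_mul (Real.rpow_nonneg (bracket_pos _).le _)]

/-- The slice of the weighted norm at a spatial frequency, in the modulation variable. -/
theorem l2_ewt_sq {s b l : ℝ} {F : ℤ × ℝ → ℝ≥0∞} (hF : Measurable F) :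
    l2 freqMeasure (fun p => ewt s b l p * F p) ^ 2 = ∑' k : ℤ, (ENNReal.ofReal (bracket k ^ s) *
      l2 volume (fun θ => ENNReal.ofReal ((l + |θ|) ^ b) * F (k, θ - (k : ℝ) ^ 2))) ^ 2 := by
  rw [l2_sq, lintegral_freqMeasure (by fun_prop)]
  refine tsum_congr fun k => ?_
  rw [← l2_const_mul _ (by fun_prop), l2_sq,
    ← lintegral_sub_right_eq_self _ ((k : ℝ) ^ 2)]
  refine lintegral_congr fun θ => ?_
  rw [ewt_eq_mul]
  simp [modulation, mul_assoc]

theorem seqNorm_sq (s : ℝ) (c : ℤ → ℝ≥0∞) :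
    seqNorm s c ^ 2 = ∑' k : ℤ, (ENNReal.ofReal (bracket k ^ s) * c k) ^ 2 := by
  rw [seqNorm, l2_sq, lintegral_count]

theorem seqNorm_mono {s : ℝ} {c d : ℤ → ℝ≥0∞} (h : ∀ k, c k ≤ d k) : seqNorm s c ≤ seqNorm s d :=
  l2_mono fun k => by gcongr; exact h k

/-- The spatial weight is constant on a slice, so a one-dimensional bound with a constant
independent of `k` is enough. -/
theorem le_const_mul_of_forall_slice {s b b' l : ℝ} {F G : ℤ × ℝ → ℝ≥0∞} (hF : Measurable F)
    (hG : Measurable G) {C : ℝ≥0∞}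
    (h : ∀ k : ℤ, l2 volume (fun θ => ENNReal.ofReal ((l + |θ|) ^ b) * F (k, θ - (k : ℝ) ^ 2)) ≤
      C * l2 volume (fun θ => ENNReal.ofReal ((l + |θ|) ^ b') * G (k, θ - (k : ℝ) ^ 2))) :
    l2 freqMeasure (fun p => ewt s b l p * F p) ≤
      C * l2 freqMeasure (fun p => ewt s b' l p * G p) := by
  refine le_of_sq_le_sq ?_
  rw [mul_pow, l2_ewt_sq hF, l2_ewt_sq hG, ← ENNReal.tsum_mul_left]
  refine ENNReal.tsum_le_tsum fun k => ?_
  rw [← mul_pow, mul_left_comm]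
  gcongr
  exact h k

theorem measurable_duhamelKernel {g : ℝ → ℂ} (hg : Measurable g) :
    Measurable fun z : ℝ × ℝ => duhamelKernel g z.1 z.2 := by
  unfold duhamelKernel; fun_prop

/-- The localized Duhamel operator, on the frequency side. -/
noncomputable def duhamelOp (g : ℝ → ℂ) (n : ℤ × ℝ → ℂ) (p : ℤ × ℝ) : ℂ :=
  ∫ τ, duhamelKernel g (modulation p) (τ + (p.1 : ℝ) ^ 2) * n (p.1, τ)

/-- The localized free evolution, on the frequency side. -/
noncomputable def freeOp (g : ℝ → ℂ) (c : ℤ → ℂ) (p : ℤ × ℝ) : ℂ := g (modulation p) * c p.1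

theorem measurable_freeOp {g : ℝ → ℂ} (hg : Measurable g) (c : ℤ → ℂ) :
    Measurable (freeOp g c) := by
  have : Measurable c := measurable_from_top
  unfold freeOp
  fun_prop

theorem measurable_duhamelOp {g : ℝ → ℂ} (hg : Measurable g) {n : ℤ × ℝ → ℂ} (hn : Measurable n) :
    Measurable (duhamelOp g n) := by
  have hK := measurable_duhamelKernel hg
  have hm : Measurable fun z : (ℤ × ℝ) × ℝ =>
      duhamelKernel g (modulation z.1) (z.2 + (z.1.1 : ℝ) ^ 2) * n (z.1.1, z.2) := by
    have h1 : Measurable fun z : (ℤ × ℝ) × ℝ => (modulation z.1, z.2 + (z.1.1 : ℝ) ^ 2) := by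
      have : Measurable fun z : (ℤ × ℝ) × ℝ => (z.1.1 : ℝ) :=
        measurable_intCast_fst.comp measurable_fst
      fun_prop
    exact (hK.comp h1).mul (hn.comp (by fun_prop))
  exact hm.stronglyMeasurable.integral_prod_right'.measurable

theorem IsCutoff.measurable {C l : ℝ} {g : ℝ → ℂ} (hg : IsCutoff C l g) : Measurable g :=
  hg.differentiable.continuous.measurable

/-- In the modulation variable every slice is dominated by the same one-dimensional operator, the
one of `exists_l2_duhamel_le`; neither `k` nor `l` enters the constant. -/
theorem exists_freqNorm_duhamelOp_le {b : ℝ} (hb : 1 / 2 < b) (hb1 : b < 1) {C₀ : ℝ}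
    (hC₀ : 0 < C₀) : ∃ C : ℝ≥0∞, C ≠ ⊤ ∧
    ∀ (s l : ℝ), 0 < l → ∀ g, IsCutoff C₀ l g → ∀ n : ℤ × ℝ → ℂ, Measurable n →
      freqNorm s b l (duhamelOp g n) ≤ C * freqNorm s (b - 1) l n := by
  obtain ⟨C, hC, h⟩ := exists_l2_duhamel_le hb hb1
  refine ⟨ENNReal.ofReal (8 * C₀) * C, by finiteness, fun s l hl g hg n hn => ?_⟩
  refine le_const_mul_of_forall_slice (measurable_duhamelOp hg.measurable hn).enorm hn.enorm
    fun k => ?_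
  set N : ℝ → ℝ≥0∞ := fun θ => ‖n (k, θ - (k : ℝ) ^ 2)‖ₑ
  have hN : Measurable N := by fun_prop
  have hpt : ∀ ρ : ℝ, ‖duhamelOp g n (k, ρ - (k : ℝ) ^ 2)‖ₑ ≤ ENNReal.ofReal (8 * C₀) *
      ∫⁻ θ, ENNReal.ofReal (l / (l + |θ|) * (1 / (l + |ρ - θ|) ^ 2 + 1 / (l + |ρ|) ^ 2)) *
        N θ := by
    intro ρ
    rw [← lintegral_const_mul _ (by fun_prop)]
    refine (enorm_integral_le_lintegral_enorm _).trans ?_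
    rw [← lintegral_sub_right_eq_self _ ((k : ℝ) ^ 2)]
    refine lintegral_mono fun θ => ?_
    simp only [enorm_mul, modulation, sub_add_cancel, N]
    rw [← mul_assoc, ← ENNReal.ofReal_mul (by positivity)]
    gcongr
    rw [← ofReal_norm]
    exact ENNReal.ofReal_le_ofReal (hg.norm_duhamelKernel_le hC₀ hl ρ θ)
  have hmeas : Measurable fun ρ => ∫⁻ θ, ENNReal.ofReal
      (l / (l + |θ|) * (1 / (l + |ρ - θ|) ^ 2 + 1 / (l + |ρ|) ^ 2)) * N θ :=
    Measurable.lintegral_prod_right' (f := fun z : ℝ × ℝ => ENNReal.ofReal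
      (l / (l + |z.2|) * (1 / (l + |z.1 - z.2|) ^ 2 + 1 / (l + |z.1|) ^ 2)) * N z.2) (by fun_prop)
  calc _ ≤ l2 volume (fun ρ => ENNReal.ofReal (8 * C₀) * (ENNReal.ofReal ((l + |ρ|) ^ b) *
        ∫⁻ θ, ENNReal.ofReal (l / (l + |θ|) * (1 / (l + |ρ - θ|) ^ 2 + 1 / (l + |ρ|) ^ 2)) *
        N θ)) := by
        refine l2_mono fun ρ => ?_
        rw [mul_left_comm]
        gcongr
        exact hpt ρ
    _ = ENNReal.ofReal (8 * C₀) * l2 volume (fun ρ => (ENNReal.ofReal ((l + |ρ|) ^ b) *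
        ∫⁻ θ, ENNReal.ofReal (l / (l + |θ|) * (1 / (l + |ρ - θ|) ^ 2 + 1 / (l + |ρ|) ^ 2)) *
        N θ)) := l2_const_mul _ (by fun_prop)
    _ ≤ _ := by
        rw [mul_assoc]
        gcongr
        exact h l hl N hN

/-- In the modulation variable every slice is `c k` times the fixed function `g`. The bound `C₀ l /
(l + |θ|)²` gives its weighted norm by scaling, which produces the power of `l`. -/
theorem exists_freqNorm_freeOp_le {b : ℝ} (hb1 : b < 1) {C₀ : ℝ}
    (hC₀ : 0 < C₀) : ∃ C : ℝ≥0∞, C ≠ ⊤ ∧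
    ∀ (s l : ℝ), 0 < l → ∀ g, IsCutoff C₀ l g → ∀ c : ℤ → ℂ,
      freqNorm s b l (freeOp g c) ≤ C * ENNReal.ofReal (l ^ (b - 1 / 2)) *
        seqNorm s (fun k => ‖c k‖ₑ) := by
  refine ⟨ENNReal.ofReal C₀ * (bracketIntegral (4 - 2 * b)) ^ (1 / 2 : ℝ), ?_,
    fun s l hl g hg c => ?_⟩
  · have h2 := bracketIntegral_ne_top (a := 4 - 2 * b) (by linarith)
    finiteness
  have hgm := hg.measurable
  have hw : ∀ x : ℝ, 0 < l + |x| := fun x => by positivity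
  have hX : l2 volume (fun θ => ENNReal.ofReal ((l + |θ|) ^ b) * ‖g θ‖ₑ) ≤
      ENNReal.ofReal C₀ * (bracketIntegral (4 - 2 * b)) ^ (1 / 2 : ℝ) *
        ENNReal.ofReal (l ^ (b - 1 / 2)) := by
    rw [l2_le_iff]
    calc ∫⁻ θ, (ENNReal.ofReal ((l + |θ|) ^ b) * ‖g θ‖ₑ) ^ 2
        ≤ ∫⁻ θ : ℝ, ENNReal.ofReal (C₀ ^ 2 * l ^ 2) *
            ENNReal.ofReal ((l + |θ|) ^ (-(4 - 2 * b))) := by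
          refine lintegral_mono fun θ => ?_
          rw [← ofReal_norm, ← ENNReal.ofReal_mul (by positivity),
            ← ENNReal.ofReal_mul (by positivity), ← ENNReal.ofReal_pow (by positivity)]
          refine ENNReal.ofReal_le_ofReal ?_
          calc ((l + |θ|) ^ b * ‖g θ‖) ^ 2 ≤ ((l + |θ|) ^ b * (C₀ * l / (l + |θ|) ^ 2)) ^ 2 := by
                gcongr; exact hg.norm_le θ
            _ = _ := by
              rw [show -(4 - 2 * b) = b * (2 : ℕ) + -(4 : ℕ) by push_cast; ring,
                Real.rpow_add (hw θ), Real.rpow_neg (hw θ).le, Real.rpow_natCast,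
                Real.rpow_mul_natCast (hw θ).le]
              have := (hw θ).ne'
              field_simp
      _ = _ := by
          rw [lintegral_const_mul _ (by fun_prop), lintegral_rpow_add_abs hl, mul_pow, mul_pow,
            sq_sqrt, ← ENNReal.ofReal_pow hC₀.le, ← ENNReal.ofReal_pow (by positivity), ← mul_assoc,
            ← ENNReal.ofReal_mul (by positivity), mul_right_comm (ENNReal.ofReal (C₀ ^ 2)), ← ENNReal.ofReal_mul (by positivity)]
          congr 2
          rw [← Real.rpow_mul_natCast hl.le, mul_assoc, ← Real.rpow_natCast l 2, ← Real.rpow_add hl]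
          congr 2; push_cast; ring
  refine le_of_sq_le_sq ?_
  rw [freqNorm, mul_pow, l2_ewt_sq (measurable_freeOp hgm c).enorm, seqNorm_sq,
    ← ENNReal.tsum_mul_left]
  refine ENNReal.tsum_le_tsum fun k => ?_
  rw [← mul_pow]
  refine pow_le_pow_left' ?_ 2
  have e : (fun θ => ENNReal.ofReal ((l + |θ|) ^ b) * ‖freeOp g c (k, θ - (k : ℝ) ^ 2)‖ₑ) =
      fun θ => ‖c k‖ₑ * (ENNReal.ofReal ((l + |θ|) ^ b) * ‖g θ‖ₑ) := by
    funext θ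
    simp only [freeOp, modulation, sub_add_cancel, enorm_mul]
    ring
  rw [e, l2_const_mul _ (by fun_prop)]
  calc _ ≤ ENNReal.ofReal (bracket k ^ s) * (‖c k‖ₑ * (ENNReal.ofReal C₀ *
        (bracketIntegral (4 - 2 * b)) ^ (1 / 2 : ℝ) * ENNReal.ofReal (l ^ (b - 1 / 2)))) := by
        gcongr
    _ = _ := by ring

/-- Cauchy-Schwarz in the time frequency. -/
theorem lintegral_slice_le {b l : ℝ} (hl : 0 < l) {F : ℤ × ℝ → ℝ≥0∞}
    (hF : Measurable F) (k : ℤ) :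
    ∫⁻ τ, ewt 0 (-b) l (k, τ) * F (k, τ) ≤ ENNReal.ofReal (l ^ (1 / 2 - b)) *
      (bracketIntegral (2 * b)) ^ (1 / 2 : ℝ) * l2 volume (fun τ => F (k, τ)) := by
  refine (lintegral_mul_le_l2 (by fun_prop) (by fun_prop)).trans ?_
  gcongr
  rw [l2_le_iff, ← lintegral_sub_right_eq_self _ ((k : ℝ) ^ 2)]
  have hw : ∀ x : ℝ, 0 < l + |x| := fun x => by positivity
  have h1 : ∀ θ : ℝ, ewt 0 (-b) l (k, θ - (k : ℝ) ^ 2) ^ 2 =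
      ENNReal.ofReal ((l + |θ|) ^ (-(2 * b))) := fun θ => by
    rw [ewt, ← ENNReal.ofReal_pow (wt_pos hl _).le]
    simp only [wt, modulation, sub_add_cancel, Real.rpow_zero, one_mul]
    rw [← Real.rpow_mul_natCast (hw θ).le]
    congr 2; push_cast; ring
  simp_rw [h1]
  rw [lintegral_rpow_add_abs hl, mul_pow, sq_sqrt, ← ENNReal.ofReal_pow (by positivity),
    ← Real.rpow_mul_natCast hl.le]
  apply le_of_eq
  congr 3; push_cast; ring

/-- The embedding of `X^{s,b}` into bounded functions of time with values in `H^s`. -/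
theorem seqNorm_lintegral_le {s b l : ℝ} (hl : 0 < l) {f : ℤ × ℝ → ℂ}
    (hf : Measurable f) :
    seqNorm s (fun k => ∫⁻ τ, ‖f (k, τ)‖ₑ) ≤ ENNReal.ofReal (l ^ (1 / 2 - b)) *
      (bracketIntegral (2 * b)) ^ (1 / 2 : ℝ) * freqNorm s b l f := by
  refine le_of_sq_le_sq ?_
  rw [freqNorm, mul_pow, l2_sq, lintegral_freqMeasure (by fun_prop), seqNorm_sq,
    ← ENNReal.tsum_mul_left]
  refine ENNReal.tsum_le_tsum fun k => ?_
  rw [← l2_sq, ← mul_pow]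
  refine pow_le_pow_left' ?_ 2
  have e : ∀ τ, ‖f (k, τ)‖ₑ = ewt 0 (-b) l (k, τ) * (ewt 0 b l (k, τ) * ‖f (k, τ)‖ₑ) := fun τ => by
    rw [← mul_assoc, ewt_mul_ewt _ _ _ _ hl]; simp [ewt, wt]
  have e2 : ∀ τ, ewt s b l (k, τ) * ‖f (k, τ)‖ₑ =
      ENNReal.ofReal (bracket k ^ s) * (ewt 0 b l (k, τ) * ‖f (k, τ)‖ₑ) := fun τ => by
    rw [ewt_eq_mul, ewt_eq_mul]; simp [mul_assoc]
  rw [funext e2, l2_const_mul _ (by fun_prop), mul_left_comm]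
  gcongr
  calc _ = _ := lintegral_congr e
    _ ≤ _ := lintegral_slice_le hl (F := fun p => ewt 0 b l p * ‖f p‖ₑ) (by fun_prop) k

/-! ### The linear operators seen at a fixed time. -/

/-- The integral of a wave over the time interval from `0` to `t`. -/
noncomputable def timeInt (θ t : ℝ) : ℂ := ∫ x in (0 : ℝ)..t, wave θ x

theorem timeInt_eq {θ : ℝ} (hθ : θ ≠ 0) (t : ℝ) :
    timeInt θ t = (wave θ t - 1) / (Complex.I * θ) := by
  have hc : Complex.I * (θ : ℂ) ≠ 0 := mul_ne_zero Complex.I_ne_zero (by exact_mod_cast hθ)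
  have e : ∀ x : ℝ, wave θ x = Complex.exp (Complex.I * θ * x) := fun x => by
    rw [wave]; congr 1; push_cast; ring
  simp_rw [timeInt, e]
  rw [integral_exp_mul_complex hc]
  simp

theorem norm_timeInt_le_abs (θ t : ℝ) : ‖timeInt θ t‖ ≤ |t| := by
  have := intervalIntegral.norm_integral_le_of_norm_le_const (a := 0) (b := t) (C := 1)
    (f := wave θ) fun x _ => (norm_wave θ x).le
  simpa [timeInt] using this

/-- Decay of the time integral of a wave. -/
theorem norm_timeInt_le (θ t : ℝ) : ‖timeInt θ t‖ ≤ (|t| + 2) * (2 / (1 + |θ|)) := by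
  have h0 : 0 < 1 + |θ| := by positivity
  rw [← mul_div_assoc, le_div_iff₀ h0]
  rcases le_total |θ| 1 with h | h
  · have := norm_timeInt_le_abs θ t
    nlinarith [norm_nonneg (timeInt θ t), abs_nonneg t]
  · have hθ : θ ≠ 0 := by rintro rfl; simp at h; linarith
    have h1 : ‖timeInt θ t‖ * |θ| ≤ 2 := by
      rw [timeInt_eq hθ, norm_div, norm_mul, Complex.norm_I, one_mul, Complex.norm_real,
        Real.norm_eq_abs, div_mul_cancel₀ _ (abs_ne_zero.2 hθ)]
      refine (norm_sub_le _ _).trans ?_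
      simp; norm_num
    nlinarith [norm_nonneg (timeInt θ t), abs_nonneg t]

theorem continuous_timeInt : Continuous fun z : ℝ × ℝ => timeInt z.1 z.2 := by
  unfold timeInt
  exact intervalIntegral.continuous_parametric_intervalIntegral_of_continuous
    (f := fun (z : ℝ × ℝ) x => wave z.1 x) (by fun_prop) continuous_snd

theorem l2_slice_le {F : ℤ × ℝ → ℝ≥0∞} (hF : Measurable F) (k : ℤ) :
    l2 volume (fun τ => F (k, τ)) ≤ l2 freqMeasure F := by
  refine le_of_sq_le_sq ?_
  rw [l2_sq, l2_sq, lintegral_freqMeasure (by fun_prop)]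
  exact ENNReal.le_tsum (f := fun k : ℤ => ∫⁻ τ, F (k, τ) ^ 2) k

theorem IsCutoff.lintegral_lt_top (l : ℝ) (hl : 0 < l) :
    ∫⁻ ρ : ℝ, ENNReal.ofReal (1 / (l + |ρ|) ^ 2) < ⊤ := by
  have e : ∀ ρ : ℝ, (1 : ℝ) / (l + |ρ|) ^ 2 = (l + |ρ|) ^ (-2 : ℝ) := fun ρ => by
    rw [Real.rpow_neg (by positivity), ← Real.rpow_natCast]; norm_num
  simp_rw [e]
  rw [lintegral_rpow_add_abs hl]
  exact ENNReal.mul_lt_top ENNReal.ofReal_lt_top (bracketIntegral_ne_top (by norm_num)).lt_top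

theorem IsCutoff.integrable {C l : ℝ} {g : ℝ → ℂ} (hg : IsCutoff C l g) (hC : 0 < C)
    (hl : 0 < l) : Integrable g := by
  refine ⟨hg.measurable.aestronglyMeasurable, ?_⟩
  calc ∫⁻ ρ, ‖g ρ‖ₑ ≤ ∫⁻ ρ : ℝ, ENNReal.ofReal (C * l) * ENNReal.ofReal (1 / (l + |ρ|) ^ 2) := by
        refine lintegral_mono fun ρ => ?_
        rw [← ofReal_norm, ← ENNReal.ofReal_mul (by positivity)]
        exact ENNReal.ofReal_le_ofReal ((hg.norm_le ρ).trans (le_of_eq (by ring)))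
    _ < ⊤ := by
        rw [lintegral_const_mul _ (by fun_prop)]
        exact ENNReal.mul_lt_top ENNReal.ofReal_lt_top (IsCutoff.lintegral_lt_top l hl)

theorem integrable_mul_wave {g : ℝ → ℂ} (hg : Integrable g) (t : ℝ) :
    Integrable fun ρ => g ρ * wave ρ t := by
  refine hg.mul_bdd (c := 1) ?_ (Eventually.of_forall fun x => (norm_wave x t).le)
  exact (by fun_prop : Continuous fun ρ => wave ρ t).aestronglyMeasurable

theorem coeffAt_freeOp {C l : ℝ} {g : ℝ → ℂ} (hg : IsCutoff C l g) (c : ℤ → ℂ) {t : ℝ}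
    (ht : |t| ≤ 1 / l) (k : ℤ) : coeffAt (freeOp g c) t k = wave (-(k : ℝ) ^ 2) t * c k := by
  unfold coeffAt
  rw [← integral_sub_right_eq_self _ ((k : ℝ) ^ 2)]
  have e : ∀ ρ : ℝ, freeOp g c (k, ρ - (k : ℝ) ^ 2) * wave (ρ - (k : ℝ) ^ 2) t =
      (wave (-(k : ℝ) ^ 2) t * c k) * (g ρ * wave ρ t) := fun ρ => by
    simp only [freeOp, modulation, sub_add_cancel]
    rw [sub_eq_add_neg, wave_add_left]; ring
  simp_rw [e]
  rw [integral_const_mul, hg.integral_eq t ht, mul_one]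

/-- This identity is the reason for the form of the kernel: the time integral `(exp (iθt) - 1) /
(iθ)` of a wave, multiplied by a cutoff with transform `g`, has transform `(g (ρ - θ) - g ρ) /
(iθ)`. At `θ = 0` division by zero gives the kernel a default value, hence the exclusion. -/
theorem integral_duhamelKernel {C l : ℝ} {g : ℝ → ℂ} (hg : IsCutoff C l g) (hC : 0 < C)
    (hl : 0 < l) {t θ : ℝ} (ht : |t| ≤ 1 / l) (hθ : θ ≠ 0) :
    ∫ ρ, duhamelKernel g ρ θ * wave ρ t = timeInt θ t := by
  have hi := integrable_mul_wave (hg.integrable hC hl) t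
  have e : ∀ ρ : ℝ, duhamelKernel g ρ θ * wave ρ t = (Complex.I * θ)⁻¹ *
      (wave θ t * (g (ρ - θ) * wave (ρ - θ) t) - g ρ * wave ρ t) := fun ρ => by
    have : wave ρ t = wave θ t * wave (ρ - θ) t := by rw [← wave_add_left]; simp
    rw [duhamelKernel, div_eq_inv_mul]
    rw [this]
    ring
  simp_rw [e]
  rw [integral_const_mul, integral_sub ((hi.comp_sub_right θ).const_mul _) hi, integral_const_mul,
    integral_sub_right_eq_self (fun ρ => g ρ * wave ρ t) θ, hg.integral_eq t ht, timeInt_eq hθ]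
  ring

/-- The order `-1` is split as `-b + (b - 1)`, and the first weight is square-integrable in the time
frequency because `b > 1/2`. This supplies the absolute convergence behind the Duhamel formula,
whose kernel decays like the inverse of the modulation. -/
theorem lintegral_ewt_neg_one_mul_lt_top {b l : ℝ} (hb : 1 / 2 < b) (hl : 0 < l)
    {F : ℤ × ℝ → ℝ≥0∞} (hF : Measurable F)
    (hfin : l2 freqMeasure (fun p => ewt 0 (b - 1) l p * F p) < ⊤) (k : ℤ) :
    ∫⁻ τ, ewt 0 (-1) l (k, τ) * F (k, τ) < ⊤ := by
  have e : ∀ τ, ewt 0 (-1) l (k, τ) * F (k, τ) =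
      ewt 0 (-b) l (k, τ) * (ewt 0 (b - 1) l (k, τ) * F (k, τ)) := fun τ => by
    rw [← mul_assoc, ewt_mul_ewt _ _ _ _ hl]; congr 2 <;> ring
  simp_rw [e]
  have h1 := lintegral_slice_le (b := b) hl (F := fun p => ewt 0 (b - 1) l p * F p)
    (by fun_prop) k
  refine h1.trans_lt ?_
  have h2 := bracketIntegral_ne_top (a := 2 * b) (by linarith)
  have h3 : l2 volume (fun τ => ewt 0 (b - 1) l (k, τ) * F (k, τ)) < ⊤ :=
    (l2_slice_le (F := fun p => ewt 0 (b - 1) l p * F p) (by fun_prop) k).trans_lt hfin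
  have h4 := h3.ne
  finiteness

theorem lintegral_ewt_neg_one_lt_top {b l : ℝ} (hb : 1 / 2 < b) (hl : 0 < l) {n : ℤ × ℝ → ℂ}
    (hn : Measurable n) (hfin : freqNorm 0 (b - 1) l n < ⊤) (k : ℤ) :
    ∫⁻ τ, ewt 0 (-1) l (k, τ) * ‖n (k, τ)‖ₑ < ⊤ :=
  lintegral_ewt_neg_one_mul_lt_top hb hl hn.enorm hfin k

/-- Fubini in the output and input frequencies, followed by `integral_duhamelKernel`. The exchange
is legitimate because the `L¹` norm of the kernel in `ρ` is `O(1 / (l + |θ|))`. -/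
theorem coeffAt_duhamelOp {b C l : ℝ} (hb : 1 / 2 < b) {g : ℝ → ℂ} (hg : IsCutoff C l g)
    (hC : 0 < C) (hl : 0 < l) {n : ℤ × ℝ → ℂ} (hn : Measurable n)
    (hfin : freqNorm 0 (b - 1) l n < ⊤) {t : ℝ} (ht : |t| ≤ 1 / l) (k : ℤ) :
    coeffAt (duhamelOp g n) t k =
      wave (-(k : ℝ) ^ 2) t * ∫ τ, n (k, τ) * timeInt (τ + (k : ℝ) ^ 2) t := by
  have hK := measurable_duhamelKernel hg.measurable
  have hw : ∀ x : ℝ, 0 < l + |x| := fun x => by positivity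
  set J := ∫⁻ ρ : ℝ, ENNReal.ofReal (1 / (l + |ρ|) ^ 2) with hJ
  have hJt : J < ⊤ := IsCutoff.lintegral_lt_top l hl
  have hKint : ∀ θ, ∫⁻ ρ, ‖duhamelKernel g ρ θ‖ₑ ≤
      ENNReal.ofReal (8 * C * l) * ENNReal.ofReal ((l + |θ|) ^ (-1 : ℝ)) * (J + J) := by
    intro θ
    calc ∫⁻ ρ, ‖duhamelKernel g ρ θ‖ₑ
        ≤ ∫⁻ ρ, ENNReal.ofReal (8 * C * l) * ENNReal.ofReal ((l + |θ|) ^ (-1 : ℝ)) *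
            (ENNReal.ofReal (1 / (l + |ρ - θ|) ^ 2) + ENNReal.ofReal (1 / (l + |ρ|) ^ 2)) := by
          refine lintegral_mono fun ρ => ?_
          rw [← ofReal_norm, ← ENNReal.ofReal_add (by positivity) (by positivity),
            ← ENNReal.ofReal_mul (by positivity), ← ENNReal.ofReal_mul (by positivity)]
          refine ENNReal.ofReal_le_ofReal
            ((hg.norm_duhamelKernel_le hC hl ρ θ).trans (le_of_eq ?_))
          rw [Real.rpow_neg_one]; ring
      _ = _ := by
          rw [lintegral_const_mul _ (by fun_prop), lintegral_add_left (by fun_prop),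
            lintegral_sub_right_eq_self (fun ρ => ENNReal.ofReal (1 / (l + |ρ|) ^ 2)) θ]
  set Φ : ℝ → ℝ → ℂ := fun ρ τ =>
    duhamelKernel g (ρ + (k : ℝ) ^ 2) (τ + (k : ℝ) ^ 2) * n (k, τ) * wave ρ t with hΦ
  have hΦm : Measurable (Function.uncurry Φ) := by
    have h1 : Measurable fun z : ℝ × ℝ =>
        duhamelKernel g (z.1 + (k : ℝ) ^ 2) (z.2 + (k : ℝ) ^ 2) :=
      hK.comp (by fun_prop : Measurable fun z : ℝ × ℝ => (z.1 + (k : ℝ) ^ 2, z.2 + (k : ℝ) ^ 2))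
    exact (h1.mul (by fun_prop)).mul (by fun_prop)
  have hint : Integrable (Function.uncurry Φ) (volume.prod volume) := by
    refine ⟨hΦm.aestronglyMeasurable, ?_⟩
    unfold HasFiniteIntegral
    rw [lintegral_prod_symm _ hΦm.enorm.aemeasurable]
    calc ∫⁻ τ, ∫⁻ ρ, ‖Function.uncurry Φ (ρ, τ)‖ₑ
        ≤ ∫⁻ τ, ENNReal.ofReal (8 * C * l) * (J + J) *
            (ewt 0 (-1) l (k, τ) * ‖n (k, τ)‖ₑ) := by
          refine lintegral_mono fun τ => ?_
          have e : ∀ ρ, ‖Function.uncurry Φ (ρ, τ)‖ₑ =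
              ‖duhamelKernel g (ρ + (k : ℝ) ^ 2) (τ + (k : ℝ) ^ 2)‖ₑ * ‖n (k, τ)‖ₑ := fun ρ => by
            simp only [Function.uncurry, hΦ, enorm_mul]
            rw [← ofReal_norm (wave _ _)]; simp
          simp_rw [e]
          rw [lintegral_mul_const' _ _ (by simp),
            lintegral_add_right_eq_self
              (fun ρ => ‖duhamelKernel g ρ (τ + (k : ℝ) ^ 2)‖ₑ) ((k : ℝ) ^ 2)]
          refine (mul_le_mul' (hKint _) le_rfl).trans (le_of_eq ?_)
          rw [ewt_eq_mul]
          simp only [modulation, Real.rpow_zero, ENNReal.ofReal_one, one_mul]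
          ring
      _ < ⊤ := by
          rw [lintegral_const_mul _ (by fun_prop)]
          have := (lintegral_ewt_neg_one_lt_top hb hl hn hfin k).ne
          have := hJt.ne
          finiteness
  have h1 : coeffAt (duhamelOp g n) t k = ∫ ρ, ∫ τ, Φ ρ τ := by
    unfold coeffAt duhamelOp
    refine integral_congr_ae (Eventually.of_forall fun ρ => ?_)
    simp only [hΦ]
    rw [integral_mul_const]
    rfl
  rw [h1, integral_integral_swap hint, ← integral_const_mul]
  refine integral_congr_ae ?_
  -- The input frequency of modulation zero, where the kernel has a default value, is a null set.
  filter_upwards [compl_mem_ae_iff.2 (measure_singleton (μ := volume) (-(k : ℝ) ^ 2))] with τ hτ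
  have hθ : τ + (k : ℝ) ^ 2 ≠ 0 := fun h => hτ (by simp; linarith)
  have e : ∀ ρ, Φ ρ τ = (fun ρ => wave (-(k : ℝ) ^ 2) t * n (k, τ) *
      (duhamelKernel g ρ (τ + (k : ℝ) ^ 2) * wave ρ t)) (ρ + (k : ℝ) ^ 2) := fun ρ => by
    simp only [hΦ]
    have : wave ρ t = wave (-(k : ℝ) ^ 2) t * wave (ρ + (k : ℝ) ^ 2) t := by
      rw [← wave_add_left]; congr 1; ring
    rw [this]; ring
  simp_rw [e]
  rw [integral_add_right_eq_self (fun ρ => wave (-(k : ℝ) ^ 2) t * n (k, τ) *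
      (duhamelKernel g ρ (τ + (k : ℝ) ^ 2) * wave ρ t)), integral_const_mul,
    integral_duhamelKernel hg hC hl ht hθ]
  ring

/-! ### Fourier inversion and Plancherel in time. -/

theorem integral_fourierInv_mul_schwartz {h : ℝ → ℂ} (hh : Integrable h) (φ : SchwartzMap ℝ ℂ) :
    ∫ x, 𝓕⁻ h x * φ x = ∫ x, h x * 𝓕⁻ (φ : ℝ → ℂ) x := by
  have := VectorFourier.integral_fourierIntegral_smul_eq_flip (μ := (volume : Measure ℝ))
    (ν := (volume : Measure ℝ)) (L := -innerₗ ℝ) (e := Real.fourierChar)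
    Real.continuous_fourierChar 
    (continuous_inner (𝕜 := ℝ) (E := ℝ)).neg hh φ.integrable
  have e : (-innerₗ ℝ : ℝ →ₗ[ℝ] ℝ →ₗ[ℝ] ℝ).flip = -innerₗ ℝ := by
    ext; simp
  rw [e] at this
  exact this

/-- The `L²` inverse Fourier transform is given by the integral on `L¹ ∩ L²`. -/
theorem fourierInv_toLp_ae_eq {h : ℝ → ℂ} (hh : Integrable h) (h2 : MemLp h 2 volume) :
    (𝓕⁻ (h2.toLp h) : Lp ℂ 2 (volume : Measure ℝ)) =ᵐ[volume] 𝓕⁻ h := by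
  set F : Lp ℂ 2 (volume : Measure ℝ) := 𝓕⁻ (h2.toLp h) with hF
  have hcont : Continuous (𝓕⁻ h) := by
    have : 𝓕⁻ h = fun x => 𝓕 h (-x) := by
      ext x; exact Real.fourierInv_eq_fourier_neg h x
    rw [this]
    exact (VectorFourier.fourierIntegral_continuous Real.continuous_fourierChar
      (continuous_inner (𝕜 := ℝ) (E := ℝ)) hh).comp continuous_neg
  -- The two definitions are compared as distributions: against a test function both transforms pass
  -- to the test function, where they coincide.
  refine ae_eq_of_integral_contDiff_smul_eq ((Lp.memLp F).locallyIntegrable (by norm_num))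
    hcont.locallyIntegrable fun g hg hgs => ?_
  have hgs' : HasCompactSupport fun x => (g x : ℂ) := hgs.comp_left (g := Complex.ofReal) rfl
  have hg' : ContDiff ℝ (⊤ : ℕ∞) fun x => (g x : ℂ) := Complex.ofRealCLM.contDiff.comp hg
  let φ : SchwartzMap ℝ ℂ := hgs'.toSchwartzMap hg'
  have hφ : ∀ x, φ x = g x := fun _ => rfl
  have h1 := congrArg (fun T : TemperedDistribution ℝ ℂ => T φ)
    (Lp.fourierInv_toTemperedDistribution_eq (h2.toLp h))
  simp only [TemperedDistribution.fourierInv_apply, Lp.toTemperedDistribution_apply] at h1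
  have h3 : ∫ x, φ x • F x = ∫ x, h x * 𝓕⁻ (φ : ℝ → ℂ) x := by
    rw [hF, ← h1]
    refine integral_congr_ae ?_
    filter_upwards [h2.coeFn_toLp] with x hx
    rw [hx, SchwartzMap.fourierInv_coe, smul_eq_mul, mul_comm]
  rw [← integral_fourierInv_mul_schwartz hh] at h3
  have e1 : ∀ x, g x • F x = φ x • F x := fun x => by rw [hφ]; simp
  have e2 : ∀ x, g x • 𝓕⁻ h x = 𝓕⁻ h x * φ x := fun x => by rw [hφ]; simp [mul_comm]
  simp_rw [e1, e2]
  exact h3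

theorem ae_comp_div_two_pi {p : ℝ → Prop} (hp : ∀ᵐ w, p w) :
    ∀ᵐ τ : ℝ, p (τ / (2 * Real.pi)) := by
  have hc : (2 * Real.pi)⁻¹ ≠ 0 := by positivity
  have hq : Measure.QuasiMeasurePreserving (fun τ : ℝ => (2 * Real.pi)⁻¹ * τ) volume volume := by
    refine ⟨by fun_prop, ?_⟩
    rw [Real.map_volume_mul_left hc]
    exact Measure.smul_absolutelyContinuous
  have := hq.ae hp
  filter_upwards [this] with τ hτ
  rwa [div_eq_inv_mul]

/-- Rescaling of the frequency between the two conventions for the Fourier transform. -/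
noncomputable def rescale (h : ℝ → ℂ) (w : ℝ) : ℂ := 2 * Real.pi * h (2 * Real.pi * w)

theorem integrable_rescale {h : ℝ → ℂ} (hh : Integrable h) : Integrable (rescale h) :=
  (hh.comp_mul_left' (by positivity : (2 * Real.pi) ≠ 0)).const_mul _

theorem memLp_rescale {h : ℝ → ℂ} (hh : Integrable h) (h2 : MemLp h 2 volume) :
    MemLp (rescale h) 2 volume := by
  rw [memLp_two_iff_integrable_sq_norm (integrable_rescale hh).aestronglyMeasurable]
  have h3 := (memLp_two_iff_integrable_sq_norm hh.aestronglyMeasurable).1 h2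
  have h4 := (h3.comp_mul_left' (by positivity : (2 * Real.pi) ≠ 0)).const_mul ((2 * Real.pi) ^ 2)
  refine h4.congr (Eventually.of_forall fun w => ?_)
  have : ‖(2 * Real.pi : ℂ)‖ = 2 * Real.pi := by
    rw [← Complex.ofReal_ofNat, ← Complex.ofReal_mul, Complex.norm_real,
      Real.norm_of_nonneg (by positivity)]
  simp only [rescale]
  rw [norm_mul, this]; ring

theorem fourierInv_rescale (h : ℝ → ℂ) (t : ℝ) :
    𝓕⁻ (rescale h) t = ∫ τ, h τ * wave τ t := by
  rw [Real.fourierInv_eq']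
  have e : ∀ w : ℝ, Complex.exp (((2 * Real.pi * inner ℝ w t : ℝ) : ℂ) * Complex.I) • rescale h w =
      (fun τ => (2 * Real.pi : ℂ) * (h τ * wave τ t)) (2 * Real.pi * w) := fun w => by
    have : Complex.exp (((2 * Real.pi * inner ℝ w t : ℝ) : ℂ) * Complex.I) =
        wave (2 * Real.pi * w) t := by
      rw [wave]; congr 3; simp; ring
    rw [this, rescale, smul_eq_mul]; ring
  simp_rw [e]
  rw [Measure.integral_comp_mul_left (fun τ => (2 * Real.pi : ℂ) * (h τ * wave τ t)),
    integral_const_mul, abs_of_pos (by positivity), Complex.real_smul, ← mul_assoc]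
  have : (((2 * Real.pi)⁻¹ : ℝ) : ℂ) * (2 * Real.pi : ℂ) = 1 := by
    push_cast
    rw [inv_mul_cancel₀]
    simp [Real.pi_ne_zero]
  rw [this, one_mul]

theorem integral_wave_ae_eq {h : ℝ → ℂ} (hh : Integrable h) (h2 : MemLp h 2 volume) :
    (𝓕⁻ ((memLp_rescale hh h2).toLp (rescale h)) : Lp ℂ 2 (volume : Measure ℝ)) =ᵐ[volume]
      fun t => ∫ τ, h τ * wave τ t := by
  filter_upwards [fourierInv_toLp_ae_eq (integrable_rescale hh) (memLp_rescale hh h2)] with t ht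
  rw [ht, fourierInv_rescale]

theorem memLp_integral_wave {h : ℝ → ℂ} (hh : Integrable h) (h2 : MemLp h 2 volume) :
    MemLp (fun t => ∫ τ, h τ * wave τ t) 2 volume :=
  (memLp_congr_ae (integral_wave_ae_eq hh h2)).1 (Lp.memLp _)

/-- Fourier inversion: the time Fourier transform of a superposition of waves. -/
theorem timeFT_integral_wave {h : ℝ → ℂ} (hh : Integrable h) (h2 : MemLp h 2 volume) :
    timeFT (fun t => ∫ τ, h τ * wave τ t) =ᵐ[volume] fun τ => 2 * Real.pi * h τ := by
  have hm := memLp_integral_wave hh h2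
  have e : hm.toLp _ = 𝓕⁻ ((memLp_rescale hh h2).toLp (rescale h)) :=
    Lp.ext (hm.coeFn_toLp.trans (integral_wave_ae_eq hh h2).symm)
  have e2 : 𝓕 (hm.toLp _) = (memLp_rescale hh h2).toLp (rescale h) := by
    rw [e]; exact FourierTransform.fourier_fourierInv_eq _
  filter_upwards [ae_comp_div_two_pi (memLp_rescale hh h2).coeFn_toLp] with τ hτ
  rw [timeFT, dif_pos hm, e2, hτ, rescale]
  have : 2 * Real.pi * (τ / (2 * Real.pi)) = τ := by field_simp
  rw [this]

/-- Fourier inversion for a square-integrable function of time with integrable transform. -/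
theorem ae_eq_integral_wave {G : ℝ → ℂ} (hG : MemLp G 2 volume)
    (hh : Integrable fun τ => (2 * Real.pi : ℂ)⁻¹ * timeFT G τ) :
    G =ᵐ[volume] fun t => ∫ τ, ((2 * Real.pi : ℂ)⁻¹ * timeFT G τ) * wave τ t := by
  set H : Lp ℂ 2 (volume : Measure ℝ) := 𝓕 (hG.toLp G) with hH
  have e : rescale (fun τ => (2 * Real.pi : ℂ)⁻¹ * timeFT G τ) = H := by
    ext w
    have h1 : (2 * Real.pi : ℂ) ≠ 0 := by simp [Real.pi_ne_zero]
    have h2 : 2 * Real.pi * w / (2 * Real.pi) = w := by field_simp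
    simp only [rescale, timeFT, dif_pos hG]
    rw [← mul_assoc, mul_inv_cancel₀ h1, one_mul, h2]
  have hHi : Integrable (H : ℝ → ℂ) := e ▸ integrable_rescale hh
  have h3 := fourierInv_toLp_ae_eq hHi (Lp.memLp H)
  rw [Lp.toLp_coeFn, hH, FourierTransform.fourierInv_fourier_eq] at h3
  filter_upwards [h3, hG.coeFn_toLp] with t h4 h5
  rw [← h5, h4, ← hH, ← e, fourierInv_rescale]

theorem measurable_timeFT (G : ℝ → ℂ) : Measurable (timeFT G) := by
  by_cases hG : MemLp G 2 volume
  · have : timeFT G = fun τ => (𝓕 (hG.toLp G) : Lp ℂ 2 (volume : Measure ℝ))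
        (τ / (2 * Real.pi)) := by
      ext τ; rw [timeFT, dif_pos hG]
    rw [this]
    exact (Lp.stronglyMeasurable _).measurable.comp (by fun_prop)
  · have : timeFT G = fun _ => 0 := by ext τ; rw [timeFT, dif_neg hG]
    rw [this]
    exact measurable_const

theorem lintegral_enorm_sq_eq_eLpNorm (f : ℝ → ℂ) :
    ∫⁻ x, ‖f x‖ₑ ^ 2 = eLpNorm f 2 volume ^ 2 := by
  rw [eLpNorm_eq_lintegral_rpow_enorm_toReal two_ne_zero ENNReal.ofNat_ne_top]
  simp only [ENNReal.toReal_ofNat, ENNReal.rpow_ofNat]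
  rw [sq_sqrt]

theorem memLp_two_iff_lintegral {f : ℝ → ℂ} (hf : AEStronglyMeasurable f volume) :
    MemLp f 2 volume ↔ ∫⁻ x, ‖f x‖ₑ ^ 2 < ⊤ := by
  rw [lintegral_enorm_sq_eq_eLpNorm]
  constructor
  · intro h
    exact ENNReal.pow_lt_top h.2
  · intro h
    exact ⟨hf, by simpa using h⟩

/-- Plancherel's identity for superpositions of waves. -/
theorem lintegral_integral_wave_sq {h : ℝ → ℂ} (hh : Integrable h) (h2 : MemLp h 2 volume) :
    ∫⁻ t, ‖∫ τ, h τ * wave τ t‖ₑ ^ 2 = ENNReal.ofReal (2 * Real.pi) * ∫⁻ τ, ‖h τ‖ₑ ^ 2 := by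
  have hpi : (0 : ℝ) < 2 * Real.pi := by positivity
  rw [lintegral_enorm_sq_eq_eLpNorm, ← eLpNorm_congr_ae (integral_wave_ae_eq hh h2)]
  set X := (memLp_rescale hh h2).toLp (rescale h)
  have e1 : eLpNorm (𝓕⁻ X : Lp ℂ 2 (volume : Measure ℝ)) 2 volume = eLpNorm (rescale h) 2 volume := by
    have : ‖(𝓕⁻ X : Lp ℂ 2 (volume : Measure ℝ))‖ₑ = ‖X‖ₑ := by
      rw [← ofReal_norm, ← ofReal_norm, ← Lp.norm_fourier_eq (𝓕⁻ X),
        FourierTransform.fourier_fourierInv_eq]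
    rw [Lp.enorm_def, Lp.enorm_def] at this
    rw [this, eLpNorm_congr_ae (memLp_rescale hh h2).coeFn_toLp]
  rw [e1, ← lintegral_enorm_sq_eq_eLpNorm]
  nth_rewrite 2 [← Real.smul_map_volume_mul_left hpi.ne']
  have e3 : ‖(2 * Real.pi : ℂ)‖ₑ = ENNReal.ofReal (2 * Real.pi) := by
    rw [← ofReal_norm, ← Complex.ofReal_ofNat, ← Complex.ofReal_mul, Complex.norm_real,
      Real.norm_of_nonneg hpi.le]
  have e4 : ∀ w, ‖rescale h w‖ₑ ^ 2 =
      ENNReal.ofReal (2 * Real.pi) ^ 2 * ‖h (2 * Real.pi * w)‖ₑ ^ 2 := fun w => by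
    rw [rescale, enorm_mul, e3, mul_pow]
  simp_rw [e4]
  rw [lintegral_const_mul' _ _ (by finiteness), lintegral_smul_measure,
    show Measure.map (fun x => 2 * Real.pi * x) volume =
      Measure.map (Homeomorph.mulLeft₀ (2 * Real.pi) hpi.ne').toMeasurableEquiv volume from rfl,
    lintegral_map_equiv, smul_eq_mul, ← mul_assoc, abs_of_pos hpi, sq]
  rfl

/-! ### Fourier series on the torus: uniqueness, products and the cubic term. -/

/-- The normalized Haar measure of the torus. -/
noncomputable abbrev haarT : Measure Torus := AddCircle.haarAddCircle

/-- Pairing with `v` is a bounded functional on continuous functions that vanishes on the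
characters, whose span is dense. -/
theorem integral_continuous_mul_eq_zero {v : Torus → ℂ} (hv : Integrable v haarT)
    (h : ∀ k, fourierCoeff v k = 0) (φ : C(Torus, ℂ)) : ∫ x, φ x * v x ∂haarT = 0 := by
  have hint : ∀ φ : C(Torus, ℂ), Integrable (fun x => φ x * v x) haarT := fun φ =>
    hv.bdd_mul φ.continuous.aestronglyMeasurable (Eventually.of_forall φ.norm_coe_le_norm)
  let T : C(Torus, ℂ) →ₗ[ℂ] ℂ :=
    { toFun := fun φ => ∫ x, φ x * v x ∂haarT
      map_add' := fun φ ψ => by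
        simp only [ContinuousMap.add_apply, add_mul]
        exact integral_add (hint φ) (hint ψ)
      map_smul' := fun c φ => by
        simp only [ContinuousMap.smul_apply, smul_eq_mul, mul_assoc, RingHom.id_apply]
        exact integral_const_mul _ _ }
  have hT : ∀ φ, ‖T φ‖ ≤ (∫ x, ‖v x‖ ∂haarT) * ‖φ‖ := fun φ => by
    refine (norm_integral_le_of_norm_le (hv.norm.mul_const ‖φ‖)
      (Eventually.of_forall fun x => ?_)).trans_eq (integral_mul_const _ _)
    rw [norm_mul, mul_comm]
    gcongr
    exact φ.norm_coe_le_norm x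
  let T' : C(Torus, ℂ) →L[ℂ] ℂ := T.mkContinuous _ hT
  have hker : (⊤ : Submodule ℂ C(Torus, ℂ)) ≤ LinearMap.ker (T' : C(Torus, ℂ) →ₗ[ℂ] ℂ) := by
    rw [← span_fourier_closure_eq_top]
    refine Submodule.topologicalClosure_minimal _ (Submodule.span_le.2 ?_) T'.isClosed_ker
    rintro _ ⟨n, rfl⟩
    have := h (-n)
    rw [fourierCoeff, neg_neg] at this
    exact this
  exact hker (Submodule.mem_top (x := φ))

/-- Uniqueness of Fourier coefficients of integrable functions. -/
theorem ae_eq_zero_of_fourierCoeff_eq_zero {v : Torus → ℂ} (hv : Integrable v haarT)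
    (h : ∀ k, fourierCoeff v k = 0) : v =ᵐ[haarT] 0 := by
  refine ae_eq_zero_of_forall_setIntegral_isClosed_eq_zero hv fun s hs => ?_
  -- The indicator of a closed set is a pointwise limit of continuous functions with values in `[0,
  -- 1]`, so `‖v‖` dominates.
  have h1 : Tendsto (fun n => ∫ x, ((hs.apprSeq n x : ℝ) : ℂ) * v x ∂haarT) atTop
      (𝓝 (∫ x, s.indicator (fun x => v x) x ∂haarT)) := by
    refine tendsto_integral_of_dominated_convergence (fun x => ‖v x‖) (fun n => ?_) hv.norm
      (fun n => Eventually.of_forall fun x => ?_) (Eventually.of_forall fun x => ?_)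
    · have : Continuous fun x => ((hs.apprSeq n x : ℝ) : ℂ) := by fun_prop
      exact this.aestronglyMeasurable.mul hv.1
    · rw [norm_mul, Complex.norm_real, Real.norm_of_nonneg (NNReal.coe_nonneg _)]
      refine mul_le_of_le_one_left (norm_nonneg _) ?_
      exact_mod_cast HasOuterApproxClosed.apprSeq_apply_le_one hs n x
    · have := (tendsto_pi_nhds.1 (HasOuterApproxClosed.tendsto_apprSeq hs)) x
      have h2 : Tendsto (fun n => ((hs.apprSeq n x : ℝ) : ℂ)) atTop
          (𝓝 (((indicator s (fun _ => (1 : NNReal)) x : NNReal) : ℝ) : ℂ)) :=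
        ((Complex.continuous_ofReal.comp NNReal.continuous_coe).tendsto _).comp this
      convert h2.mul_const (v x) using 2
      by_cases hx : x ∈ s <;> simp [hx]
  have h2 : ∀ n, ∫ x, ((hs.apprSeq n x : ℝ) : ℂ) * v x ∂haarT = 0 := fun n =>
    integral_continuous_mul_eq_zero hv h
      ⟨fun x => ((hs.apprSeq n x : ℝ) : ℂ), by fun_prop⟩
  simp_rw [h2] at h1
  rw [← integral_indicator hs.measurableSet]
  exact tendsto_nhds_unique h1 tendsto_const_nhds

theorem inner_toLp_fourierBasis {f : Torus → ℂ} (hf : MemLp f 2 haarT) (j : ℤ) :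
    inner ℂ (fourierBasis j) (hf.toLp f) = fourierCoeff f j := by
  rw [← HilbertBasis.repr_apply_apply, fourierBasis_repr]
  exact congrFun (fourierCoeff_congr_ae hf.coeFn_toLp) j

theorem fourierCoeff_conj (f : Torus → ℂ) (k : ℤ) :
    fourierCoeff (fun x => (starRingEnd ℂ) (f x)) k = (starRingEnd ℂ) (fourierCoeff f (-k)) := by
  rw [fourierCoeff, fourierCoeff, ← integral_conj]
  refine integral_congr_ae (Eventually.of_forall fun x => ?_)
  simp only [smul_eq_mul, map_mul, neg_neg]
  rw [← fourier_neg]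

/-- The Fourier coefficients of a product of square-integrable functions. -/
theorem hasSum_fourierCoeff_mul {f g : Torus → ℂ} (hf : MemLp f 2 haarT) (hg : MemLp g 2 haarT)
    (k : ℤ) : HasSum (fun j => fourierCoeff f (k - j) * fourierCoeff g j)
      (fourierCoeff (fun x => f x * g x) k) := by
  -- The coefficient of `f g` is the inner product of `e_k` times the conjugate of `f` with `g`;
  -- Parseval in the Fourier basis expands it as a convolution.
  set φ : Torus → ℂ := fun x => fourier k x * (starRingEnd ℂ) (f x) with hφ
  have hconj : MemLp (fun x => (starRingEnd ℂ) (f x)) 2 haarT := hf.star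
  have hφm : MemLp φ 2 haarT := by
    refine hconj.of_le ((fourier k).continuous.aestronglyMeasurable.mul hconj.1)
      (Eventually.of_forall fun x => ?_)
    rw [hφ, norm_mul, fourier_apply, Circle.norm_coe, one_mul]
  have h := HilbertBasis.hasSum_inner_mul_inner fourierBasis (hφm.toLp φ) (hg.toLp g)
  have e1 : ∀ j, inner ℂ (hφm.toLp φ) (fourierBasis j) = fourierCoeff f (k - j) := fun j => by
    rw [← inner_conj_symm, inner_toLp_fourierBasis, fourierCoeff, fourierCoeff, ← integral_conj]
    refine integral_congr_ae (Eventually.of_forall fun x => ?_)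
    simp only [hφ, smul_eq_mul, map_mul, Complex.conj_conj]
    rw [← fourier_neg, ← fourier_neg, neg_neg, ← mul_assoc, ← fourier_add]
    congr 2; ring_nf
  have e2 : inner ℂ (hφm.toLp φ) (hg.toLp g) = fourierCoeff (fun x => f x * g x) k := by
    rw [L2.inner_def, fourierCoeff]
    refine integral_congr_ae ?_
    filter_upwards [hφm.coeFn_toLp, hg.coeFn_toLp] with x h1 h2
    rw [h1, h2, RCLike.inner_apply', hφ]
    simp only [map_mul, Complex.conj_conj, smul_eq_mul]
    rw [fourier_neg]; ring
  simp_rw [e1, inner_toLp_fourierBasis] at h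
  rwa [e2] at h

theorem lintegral_enorm_sq_eq_tsum (f : L2T) :
    ∫⁻ x, ‖f x‖ₑ ^ 2 ∂haarT = ∑' k, ‖fourierCoeff f k‖ₑ ^ 2 := by
  have h := hasSum_sq_fourierCoeff f
  have hi : Integrable (fun x => ‖f x‖ ^ 2) haarT :=
    (memLp_two_iff_integrable_sq_norm (Lp.memLp f).1).1 (Lp.memLp f)
  have e : ∀ z : ℂ, ‖z‖ₑ ^ 2 = ENNReal.ofReal (‖z‖ ^ 2) := fun z => by
    rw [ENNReal.ofReal_pow (norm_nonneg _), ofReal_norm]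
  simp_rw [e]
  rw [← ofReal_integral_eq_lintegral_ofReal hi (Eventually.of_forall fun x => by positivity),
    ← h.tsum_eq, ENNReal.ofReal_tsum_of_nonneg (fun k => by positivity) h.summable]

/-- The function on the torus with given square-summable Fourier coefficients. -/
theorem exists_fourierCoeff_eq {c : ℤ → ℂ} (hc : ∑' k, ‖c k‖ₑ ^ 2 ≠ ⊤) :
    ∃ f : L2T, ∀ k, fourierCoeff f k = c k := by
  have hs : Summable fun k => ‖c k‖ ^ 2 := by
    have e : ∀ k, ‖c k‖ ^ 2 = (‖c k‖ₑ ^ 2).toReal := fun k => by simp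
    simp_rw [e]
    exact ENNReal.summable_toReal hc
  have hm : Memℓp c 2 := memℓp_gen (by simpa using hs)
  refine ⟨fourierBasis.repr.symm ⟨c, hm⟩, fun k => ?_⟩
  rw [← fourierBasis_repr, LinearIsometryEquiv.apply_symm_apply]

/-- An integrable function with square-summable Fourier coefficients is square-integrable. -/
theorem memLp_two_of_fourierCoeff {v : Torus → ℂ} (hv : Integrable v haarT)
    (hc : ∑' k, ‖fourierCoeff v k‖ₑ ^ 2 ≠ ⊤) :
    MemLp v 2 haarT ∧ ∫⁻ x, ‖v x‖ₑ ^ 2 ∂haarT = ∑' k, ‖fourierCoeff v k‖ₑ ^ 2 := by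
  -- The `L²` function with the same coefficients must coincide with `v`, by uniqueness for
  -- integrable functions; this upgrades the integrability of `v`.
  obtain ⟨V, hV⟩ := exists_fourierCoeff_eq hc
  have hVi : Integrable V haarT := (Lp.memLp V).integrable (by norm_num)
  have hz : (v + (-1 : ℂ) • (V : Torus → ℂ)) =ᵐ[haarT] 0 := by
    refine ae_eq_zero_of_fourierCoeff_eq_zero (hv.add (hVi.smul _)) fun k => ?_
    rw [fourierCoeff.add hv (hVi.smul _), Pi.add_apply, fourierCoeff.const_smul, hV]
    simp
  have hvV : v =ᵐ[haarT] V := by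
    filter_upwards [hz] with x hx
    simp only [Pi.add_apply, Pi.smul_apply, Pi.zero_apply, smul_eq_mul] at hx
    linear_combination hx
  refine ⟨(memLp_congr_ae hvV).2 (Lp.memLp V), ?_⟩
  simp_rw [← hV]
  rw [← lintegral_enorm_sq_eq_tsum]
  exact lintegral_congr_ae (hvV.mono fun x hx => by simp only; rw [hx])

theorem spaceFT_enorm_le {f : Torus → ℂ} (k : ℤ) : ‖fourierCoeff f k‖ₑ ≤ ‖spaceFT f k‖ₑ := by
  rw [spaceFT, enorm_mul]
  refine le_mul_of_one_le_left' ?_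
  rw [← ofReal_norm, ← Complex.ofReal_ofNat, ← Complex.ofReal_mul, Complex.norm_real,
    Real.norm_of_nonneg (by positivity), ENNReal.one_le_ofReal]
  linarith [Real.pi_gt_three]

/-- The square of a function and its cubic nonlinearity, in terms of Fourier coefficients. -/
theorem cubic_of_summable (g : L2T) (H : ℤ → ℂ)
    (hH : ∀ k, HasSum (fun j => spaceFT g (k - j) * spaceFT g j) (H k))
    (hS : ∑' k, ‖H k‖ₑ ^ 2 ≠ ⊤) :
    ∫⁻ x, ‖g x‖ₑ ^ 4 ∂haarT ≤ ∑' k, ‖H k‖ₑ ^ 2 ∧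
    ∀ k, HasSum (fun j => ((2 * Real.pi : ℂ) ^ 2)⁻¹ * (H j * (starRingEnd ℂ) (spaceFT g (j - k))))
      (spaceFT (cubic g) k) := by
  have hpi : (2 * Real.pi : ℂ) ≠ 0 := by simp [Real.pi_ne_zero]
  have hg := Lp.memLp g
  -- A priori the square is only integrable. Its coefficients are a multiple of `H`, so it lies in
  -- `L²`; then `g` is in `L⁴`, and `|g|² g` is the product of the two `L²` functions `g²` and the
  -- conjugate of `g`, to which the product formula applies once more.
  set v : Torus → ℂ := fun x => g x * g x with hv
  have hvi : Integrable v haarT := hg.integrable_mul hg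
  have hHv : ∀ k, H k = (2 * Real.pi : ℂ) ^ 2 * fourierCoeff v k := fun k => by
    refine (hH k).unique ?_
    have := (hasSum_fourierCoeff_mul hg hg k).mul_left ((2 * Real.pi : ℂ) ^ 2)
    refine this.congr_fun fun j => ?_
    simp only [spaceFT]; ring
  have hle : ∀ k, ‖fourierCoeff v k‖ₑ ≤ ‖H k‖ₑ := fun k => by
    rw [hHv, sq, mul_assoc, enorm_mul]
    exact (spaceFT_enorm_le k).trans (le_mul_of_one_le_left' (by
      rw [← ofReal_norm, ← Complex.ofReal_ofNat, ← Complex.ofReal_mul, Complex.norm_real,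
        Real.norm_of_nonneg (by positivity), ENNReal.one_le_ofReal]
      linarith [Real.pi_gt_three]))
  have hle2 : ∑' k, ‖fourierCoeff v k‖ₑ ^ 2 ≤ ∑' k, ‖H k‖ₑ ^ 2 :=
    ENNReal.tsum_le_tsum fun k => pow_le_pow_left' (hle k) 2
  obtain ⟨hvm, hvs⟩ := memLp_two_of_fourierCoeff hvi (ne_top_of_le_ne_top hS hle2)
  refine ⟨?_, fun k => ?_⟩
  · refine le_trans (le_of_eq ?_) (hvs.trans_le hle2)
    refine lintegral_congr fun x => ?_
    rw [hv, enorm_mul]; ring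
  · have hconj : MemLp (fun x => (starRingEnd ℂ) (g x)) 2 haarT := hg.star
    have h := hasSum_fourierCoeff_mul hvm hconj k
    have e : (fun x => v x * (starRingEnd ℂ) (g x)) = cubic g := by
      funext x
      simp only [hv, cubic]
      rw [mul_assoc, Complex.mul_conj, Complex.normSq_eq_norm_sq]
      ring
    rw [e] at h
    have h2 := (((Equiv.subLeft k).hasSum_iff).2 h).mul_left (2 * Real.pi : ℂ)
    refine h2.congr_fun fun j => ?_
    simp only [Function.comp, Equiv.subLeft_apply, fourierCoeff_conj, sub_sub_cancel, neg_sub,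
      hHv, spaceFT, map_mul, map_ofNat, Complex.conj_ofReal]
    field_simp

/-! ### Convolution squares and squares in physical space. -/

theorem hasSum_integral_freqMeasure {Ψ : ℤ × ℝ → ℂ} (h : Integrable Ψ freqMeasure) :
    HasSum (fun j : ℤ => ∫ τ, Ψ (j, τ)) (∫ q, Ψ q ∂freqMeasure) := by
  unfold freqMeasure at h ⊢
  have hi := h.integral_prod_left
  rw [integral_prod _ h, integral_countable hi]
  have hs : Summable fun j : ℤ => ∫ τ, Ψ (j, τ) := (integrable_count_iff.1 hi).of_norm
  have e : ∀ j : ℤ, Measure.count.real {j} • ∫ τ, Ψ (j, τ) = ∫ τ, Ψ (j, τ) := by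
    simp [Measure.real]
  simp_rw [e]
  exact hs.hasSum

/-- Self-convolution of a function of the frequency. -/
noncomputable def sqConv (f : ℤ × ℝ → ℂ) (r : ℤ × ℝ) : ℂ := ∫ q, f q * f (r - q) ∂freqMeasure

theorem measurable_sqConv {f : ℤ × ℝ → ℂ} (hf : Measurable f) : Measurable (sqConv f) := by
  have hm : Measurable fun z : (ℤ × ℝ) × (ℤ × ℝ) => f z.2 * f (z.1 - z.2) := by fun_prop
  exact hm.stronglyMeasurable.integral_prod_right'.measurable

theorem enorm_sqConv_le (f : ℤ × ℝ → ℂ) (r : ℤ × ℝ) :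
    ‖sqConv f r‖ₑ ≤ lconv (fun q => ‖f q‖ₑ) (fun q => ‖f q‖ₑ) r := by
  refine (enorm_integral_le_lintegral_enorm _).trans (le_of_eq ?_)
  simp only [enorm_mul]
  rfl

theorem mul_le_sq_add_sq (a b : ℝ≥0∞) : a * b ≤ a ^ 2 + b ^ 2 := by
  rcases le_total a b with h | h
  · calc a * b ≤ b * b := by gcongr
      _ ≤ _ := by rw [← sq]; exact le_add_self
  · calc a * b ≤ a * a := by gcongr
      _ ≤ _ := by rw [← sq]; exact le_self_add

theorem lintegral_lconv_slice {F G : ℤ × ℝ → ℝ≥0∞} (hF : Measurable F) (hG : Measurable G)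
    (k : ℤ) : ∫⁻ τ, lconv F G (k, τ) = ∑' j, (∫⁻ τ, F (j, τ)) * ∫⁻ τ, G (k - j, τ) := by
  calc ∫⁻ τ, lconv F G (k, τ)
      = ∫⁻ τ, ∫⁻ q, F q * G ((k, τ) - q) ∂freqMeasure := rfl
    _ = ∫⁻ q, ∫⁻ τ, F q * G ((k, τ) - q) ∂volume ∂freqMeasure :=
        lintegral_lintegral_swap (Measurable.aemeasurable (by fun_prop))
    _ = ∫⁻ q, F q * (∫⁻ τ, G (k - q.1, τ)) ∂freqMeasure := by
        refine lintegral_congr fun q => ?_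
        rw [lintegral_const_mul (F q) (by fun_prop),
          ← lintegral_sub_right_eq_self (fun τ : ℝ => G (k - q.1, τ)) q.2]
        rfl
    _ = _ := by
        rw [lintegral_freqMeasure]
        · exact tsum_congr fun j =>
            lintegral_mul_const (∫⁻ τ, G (k - j, τ)) (by fun_prop : Measurable fun τ => F (j, τ))
        · have : Measurable fun q : ℤ × ℝ => ∫⁻ τ, G (k - q.1, τ) :=
            Measurable.lintegral_prod_right' (f := fun z : (ℤ × ℝ) × ℝ => G (k - z.1.1, z.2))
              (by fun_prop)
          fun_prop

/-- A function of the frequency whose slices are integrable with square-summable integrals and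
whose weighted norm of order `3/8` is finite. -/
structure Admissible (f : ℤ × ℝ → ℂ) : Prop where
  measurable : Measurable f
  tsum_lt_top : ∑' k : ℤ, (∫⁻ τ, ‖f (k, τ)‖ₑ) ^ 2 < ⊤
  freqNorm_lt_top : freqNorm 0 (3 / 8) 1 f < ⊤

section Admissible

variable {f : ℤ × ℝ → ℂ}

theorem Admissible.lintegral_lt_top (hf : Admissible f) (k : ℤ) : ∫⁻ τ, ‖f (k, τ)‖ₑ < ⊤ := by
  have h := (ENNReal.le_tsum (f := fun k : ℤ => (∫⁻ τ, ‖f (k, τ)‖ₑ) ^ 2) k).trans_lt hf.tsum_lt_top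
  by_contra hcon
  rw [not_lt, top_le_iff] at hcon
  rw [hcon] at h
  simp at h

theorem Admissible.integrable_slice (hf : Admissible f) (k : ℤ) :
    Integrable fun τ => f (k, τ) :=
  ⟨(by have := hf.measurable; fun_prop : Measurable fun τ => f (k, τ)).aestronglyMeasurable,
    hf.lintegral_lt_top k⟩

theorem Admissible.lintegral_lconv_lt_top (hf : Admissible f) (k : ℤ) :
    ∫⁻ τ, lconv (fun q => ‖f q‖ₑ) (fun q => ‖f q‖ₑ) (k, τ) < ⊤ := by
  rw [lintegral_lconv_slice hf.measurable.enorm hf.measurable.enorm]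
  calc _ ≤ ∑' j : ℤ, ((∫⁻ τ, ‖f (j, τ)‖ₑ) ^ 2 + (∫⁻ τ, ‖f (k - j, τ)‖ₑ) ^ 2) :=
        ENNReal.tsum_le_tsum fun j => mul_le_sq_add_sq _ _
    _ = (∑' j : ℤ, (∫⁻ τ, ‖f (j, τ)‖ₑ) ^ 2) + ∑' j : ℤ, (∫⁻ τ, ‖f (j, τ)‖ₑ) ^ 2 := by
        rw [ENNReal.tsum_add]
        congr 1
        exact (Equiv.subLeft k).tsum_eq fun j => (∫⁻ τ, ‖f (j, τ)‖ₑ) ^ 2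
    _ < ⊤ := ENNReal.add_lt_top.2 ⟨hf.tsum_lt_top, hf.tsum_lt_top⟩

theorem Admissible.integrable_sqConv_slice (hf : Admissible f) (k : ℤ) :
    Integrable fun τ => sqConv f (k, τ) := by
  have hm := measurable_sqConv hf.measurable
  refine ⟨(by fun_prop : Measurable fun τ => sqConv f (k, τ)).aestronglyMeasurable, ?_⟩
  exact (lintegral_mono fun τ => enorm_sqConv_le f (k, τ)).trans_lt (hf.lintegral_lconv_lt_top k)

theorem Admissible.l2_lconv_lt_top (hf : Admissible f) :
    l2 freqMeasure (lconv (fun q => ‖f q‖ₑ) (fun q => ‖f q‖ₑ)) < ⊤ := by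
  obtain ⟨C, hC, h⟩ := exists_l2_lconv_le
  refine (h _ _ hf.measurable.enorm hf.measurable.enorm).trans_lt ?_
  have : l2 freqMeasure (fun p => ewt 0 (3 / 8) 1 p * ‖f p‖ₑ) ≠ ⊤ := hf.freqNorm_lt_top.ne
  finiteness

theorem Admissible.l2_sqConv_lt_top (hf : Admissible f) :
    l2 freqMeasure (fun r => ‖sqConv f r‖ₑ) < ⊤ :=
  (l2_mono (enorm_sqConv_le f)).trans_lt hf.l2_lconv_lt_top

theorem Admissible.memLp_sqConv_slice (hf : Admissible f) (k : ℤ) :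
    MemLp (fun τ => sqConv f (k, τ)) 2 volume := by
  have hm := measurable_sqConv hf.measurable
  rw [memLp_two_iff_lintegral (hf.integrable_sqConv_slice k).1, ← l2_sq]
  exact ENNReal.pow_lt_top
    ((l2_slice_le (F := fun r => ‖sqConv f r‖ₑ) (by fun_prop) k).trans_lt hf.l2_sqConv_lt_top)

theorem continuous_coeffAt {g : ℤ × ℝ → ℂ} {k : ℤ} (hg : Integrable fun τ => g (k, τ)) :
    Continuous fun t => coeffAt g t k := by
  refine continuous_of_dominated (bound := fun τ => ‖g (k, τ)‖)
    (fun t => (integrable_mul_wave hg t).1)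
    (fun t => Eventually.of_forall fun τ => ?_) hg.norm (Eventually.of_forall fun τ => ?_)
  · rw [norm_mul, norm_wave, mul_one]
  · exact continuous_const.mul (by fun_prop)

theorem enorm_coeffAt_le (g : ℤ × ℝ → ℂ) (t : ℝ) (k : ℤ) :
    ‖coeffAt g t k‖ₑ ≤ ∫⁻ τ, ‖g (k, τ)‖ₑ := by
  refine (enorm_integral_le_lintegral_enorm _).trans (le_of_eq ?_)
  refine lintegral_congr fun τ => ?_
  rw [enorm_mul, ← ofReal_norm (wave _ _)]; simp

/-- The self-convolution corresponds to the square in physical space. -/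
theorem Admissible.hasSum_coeffAt_mul (hf : Admissible f) (t : ℝ) (k : ℤ) :
    HasSum (fun j => coeffAt f t (k - j) * coeffAt f t j) (coeffAt (sqConv f) t k) := by
  have hfm := hf.measurable
  set Φ : ℝ → ℤ × ℝ → ℂ := fun τ q => f q * f ((k, τ) - q) * wave τ t with hΦ
  have hΦm : Measurable (Function.uncurry Φ) := by
    have : Measurable fun z : ℝ × (ℤ × ℝ) => f z.2 * f ((k, z.1) - z.2) * wave z.1 t := by fun_prop
    exact this
  have hint : Integrable (Function.uncurry Φ) (volume.prod freqMeasure) := by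
    refine ⟨hΦm.aestronglyMeasurable, ?_⟩
    unfold HasFiniteIntegral
    rw [lintegral_prod _ hΦm.enorm.aemeasurable]
    refine lt_of_le_of_lt (le_of_eq ?_) (hf.lintegral_lconv_lt_top k)
    refine lintegral_congr fun τ => lintegral_congr fun q => ?_
    simp only [Function.uncurry, hΦ, enorm_mul]
    rw [← ofReal_norm (wave _ _)]; simp
  have e1 : coeffAt (sqConv f) t k = ∫ τ, ∫ q, Φ τ q ∂freqMeasure := by
    unfold coeffAt sqConv
    refine integral_congr_ae (Eventually.of_forall fun τ => ?_)
    simp only [hΦ]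
    rw [integral_mul_const]
  -- A shift of `τ` by `q.2` separates the wave into one factor for each of the two functions.
  have e2 : ∀ q, ∫ τ, Φ τ q = f q * wave q.2 t * coeffAt f t (k - q.1) := by
    intro q
    have e3 : ∀ τ, Φ τ q = (fun τ => f q * wave q.2 t * (f (k - q.1, τ) * wave τ t)) (τ - q.2) := by
      intro τ
      have : wave τ t = wave q.2 t * wave (τ - q.2) t := by rw [← wave_add_left]; simp
      simp only [hΦ]
      have e : (k, τ) - q = (k - q.1, τ - q.2) := rfl
      rw [this, e]
      ring
    simp_rw [e3]
    rw [integral_sub_right_eq_self (fun τ => f q * wave q.2 t * (f (k - q.1, τ) * wave τ t)),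
      integral_const_mul]
    rfl
  have hint2 : Integrable (fun q => f q * wave q.2 t * coeffAt f t (k - q.1)) freqMeasure := by
    have := hint.integral_prod_right
    exact this.congr (Eventually.of_forall e2)
  rw [e1, integral_integral_swap hint]
  simp_rw [e2]
  refine (hasSum_integral_freqMeasure hint2).congr_fun fun j => ?_
  simp only
  rw [integral_mul_const, mul_comm]
  rfl

/-- Plancherel's identity for the square. -/
theorem Admissible.lintegral_tsum_lt_top (hf : Admissible f) :
    ∫⁻ t, ∑' k, ‖coeffAt (sqConv f) t k‖ₑ ^ 2 < ⊤ := by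
  have hm := measurable_sqConv hf.measurable
  rw [lintegral_tsum fun k => by
    have := (continuous_coeffAt (hf.integrable_sqConv_slice k)).measurable
    fun_prop]
  have e : ∀ k : ℤ, ∫⁻ t, ‖coeffAt (sqConv f) t k‖ₑ ^ 2 =
      ENNReal.ofReal (2 * Real.pi) * ∫⁻ τ, ‖sqConv f (k, τ)‖ₑ ^ 2 := fun k =>
    lintegral_integral_wave_sq (hf.integrable_sqConv_slice k) (hf.memLp_sqConv_slice k)
  simp_rw [e]
  rw [ENNReal.tsum_mul_left, ← lintegral_freqMeasure (F := fun r => ‖sqConv f r‖ₑ ^ 2)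
    (by fun_prop), ← l2_sq]
  have := hf.l2_sqConv_lt_top.ne
  finiteness

/-- At almost every time the function with coefficients `coeffAt f t` has a square-integrable
square, although admissibility gives only square-integrability of the function itself at each time.
This is why the cubic term is handled for almost every time. -/
theorem Admissible.ae_tsum_ne_top (hf : Admissible f) :
    ∀ᵐ t, ∑' k, ‖coeffAt (sqConv f) t k‖ₑ ^ 2 ≠ ⊤ := by
  refine (ae_lt_top' ?_ hf.lintegral_tsum_lt_top.ne).mono fun t ht => ht.ne
  refine AEMeasurable.tsum fun k => ?_
  have := (continuous_coeffAt (hf.integrable_sqConv_slice k)).measurable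
  fun_prop

theorem tsum_coeffAt_sq_le (f : ℤ × ℝ → ℂ) (t : ℝ) (k : ℤ) :
    ∑' j, ‖coeffAt f t (j - k)‖ₑ ^ 2 ≤ ∑' j : ℤ, (∫⁻ τ, ‖f (j, τ)‖ₑ) ^ 2 := by
  refine ((Equiv.subRight k).tsum_eq fun j => ‖coeffAt f t j‖ₑ ^ 2).trans_le ?_
  exact ENNReal.tsum_le_tsum fun j => pow_le_pow_left' (enorm_coeffAt_le f t j) 2

end Admissible

theorem enorm_wave (τ t : ℝ) : ‖wave τ t‖ₑ = 1 := by
  rw [← ofReal_norm, norm_wave, ENNReal.ofReal_one]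

/-- Integrating a superposition of waves over a time interval. -/
theorem integral_mul_intervalIntegral_wave {g : ℝ → ℂ} (hg : Integrable g) {w : ℝ → ℂ}
    (hw : Continuous w) (t : ℝ) :
    ∫ τ, g τ * (∫ x in (0 : ℝ)..t, wave τ x * w x) =
      ∫ x in (0 : ℝ)..t, (∫ τ, g τ * wave τ x) * w x := by
  have hw1 : IntegrableOn w (uIoc 0 t) := by
    have := (hw.intervalIntegrable (μ := volume) 0 t)
    exact this.def'
  simp_rw [intervalIntegral.intervalIntegral_eq_integral_uIoc, Complex.real_smul]
  have hint : Integrable (Function.uncurry fun τ x => g τ * (wave τ x * w x))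
      (volume.prod (volume.restrict (uIoc 0 t))) := by
    have h1 : Integrable (fun z : ℝ × ℝ => g z.1 * w z.2) (volume.prod (volume.restrict (uIoc 0 t))) :=
      hg.mul_prod hw1
    have h2 := h1.mul_bdd (g := fun z : ℝ × ℝ => wave z.1 z.2) (c := 1)
      continuous_wave.aestronglyMeasurable (Eventually.of_forall fun z => (norm_wave _ _).le)
    refine h2.congr (Eventually.of_forall fun z => ?_)
    simp only [Function.uncurry]
    ring
  have e1 : ∀ τ, g τ * (((if (0 : ℝ) ≤ t then (1 : ℝ) else -1 : ℝ) : ℂ) *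
      ∫ x in uIoc 0 t, wave τ x * w x) = ((if (0 : ℝ) ≤ t then (1 : ℝ) else -1 : ℝ) : ℂ) *
      ∫ x in uIoc 0 t, g τ * (wave τ x * w x) := fun τ => by
    rw [integral_const_mul]; ring
  simp_rw [e1]
  rw [integral_const_mul, integral_integral_swap hint]
  congr 1
  refine integral_congr_ae (Eventually.of_forall fun x => ?_)
  simp only
  rw [← integral_mul_const]
  refine integral_congr_ae (Eventually.of_forall fun τ => ?_)
  simp only
  ring

/-! ### The cubic nonlinearity on the frequency side. -/

/-- The space-time Fourier transform of `|u|² u`, up to a constant, in terms of that of `u`. -/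
noncomputable def cubicFT (f : ℤ × ℝ → ℂ) (p : ℤ × ℝ) : ℂ :=
  ∫ z, f z.2 * f (z.1 - z.2) * (starRingEnd ℂ) (f (z.1 - p)) ∂(freqMeasure.prod freqMeasure)

theorem measurable_conj {α : Type*} [MeasurableSpace α] {f : α → ℂ} (hf : Measurable f) :
    Measurable fun x => (starRingEnd ℂ) (f x) :=
  Complex.continuous_conj.measurable.comp hf

theorem measurable_cubicFT {f : ℤ × ℝ → ℂ} (hf : Measurable f) : Measurable (cubicFT f) := by
  have h3 : Measurable fun z : (ℤ × ℝ) × ((ℤ × ℝ) × (ℤ × ℝ)) =>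
      (starRingEnd ℂ) (f (z.2.1 - z.1)) := measurable_conj (by fun_prop)
  have hm : Measurable fun z : (ℤ × ℝ) × ((ℤ × ℝ) × (ℤ × ℝ)) =>
      f z.2.2 * f (z.2.1 - z.2.2) * (starRingEnd ℂ) (f (z.2.1 - z.1)) := by fun_prop
  exact hm.stronglyMeasurable.integral_prod_right'.measurable

theorem enorm_conj (z : ℂ) : ‖(starRingEnd ℂ) z‖ₑ = ‖z‖ₑ := by
  rw [← ofReal_norm, ← ofReal_norm, RCLike.norm_conj]

theorem enorm_cubicFT_le {f : ℤ × ℝ → ℂ} (hf : Measurable f) (p : ℤ × ℝ) :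
    ‖cubicFT f p‖ₑ ≤ triconv (fun q => ‖f q‖ₑ) (fun q => ‖f q‖ₑ) (fun q => ‖f q‖ₑ) p := by
  rw [triconv_eq_lintegral_prod hf.enorm hf.enorm hf.enorm]
  refine (enorm_integral_le_lintegral_enorm _).trans (le_of_eq ?_)
  refine lintegral_congr fun z => ?_
  rw [enorm_mul, enorm_mul, enorm_conj]

theorem integrable_cubicFT {f g h : ℤ × ℝ → ℂ} (hf : Measurable f) (hg : Measurable g)
    (hh : Measurable h) {p : ℤ × ℝ}
    (hp : triconv (fun q => ‖f q‖ₑ) (fun q => ‖g q‖ₑ) (fun q => ‖h q‖ₑ) p < ⊤) :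
    Integrable (fun z : (ℤ × ℝ) × (ℤ × ℝ) =>
      f z.2 * g (z.1 - z.2) * (starRingEnd ℂ) (h (z.1 - p))) (freqMeasure.prod freqMeasure) := by
  have h3 : Measurable fun z : (ℤ × ℝ) × (ℤ × ℝ) =>
      (starRingEnd ℂ) (h (z.1 - p)) := measurable_conj (by fun_prop)
  have hm : Measurable fun z : (ℤ × ℝ) × (ℤ × ℝ) =>
      f z.2 * g (z.1 - z.2) * (starRingEnd ℂ) (h (z.1 - p)) := by fun_prop
  refine ⟨hm.aestronglyMeasurable, ?_⟩
  rw [triconv_eq_lintegral_prod hf.enorm hg.enorm hh.enorm] at hp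
  refine lt_of_le_of_lt (le_of_eq ?_) hp
  refine lintegral_congr fun z => ?_
  rw [enorm_mul, enorm_mul, enorm_conj]

theorem l2_triconv_lt_top {s : ℝ} (hs : 0 ≤ s) {f g h : ℤ × ℝ → ℂ} (hf : Measurable f)
    (hg : Measurable g) (hh : Measurable h) (hf1 : freqNorm s (3 / 8) 1 f < ⊤)
    (hg1 : freqNorm s (3 / 8) 1 g < ⊤) (hh1 : freqNorm s (3 / 8) 1 h < ⊤) :
    l2 freqMeasure (fun p => ewt s (-(3 / 8)) 1 p *
      triconv (fun q => ‖f q‖ₑ) (fun q => ‖g q‖ₑ) (fun q => ‖h q‖ₑ) p) < ⊤ := by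
  obtain ⟨C, hC, H⟩ := exists_l2_triconv_le hs
  refine (H _ _ _ hf.enorm hg.enorm hh.enorm).trans_lt ?_
  have a1 := hf1.ne
  have a2 := hg1.ne
  have a3 := hh1.ne
  unfold freqNorm at a1 a2 a3
  finiteness

theorem ae_triconv_lt_top {s : ℝ} (hs : 0 ≤ s) {f g h : ℤ × ℝ → ℂ} (hf : Measurable f)
    (hg : Measurable g) (hh : Measurable h) (hf1 : freqNorm s (3 / 8) 1 f < ⊤)
    (hg1 : freqNorm s (3 / 8) 1 g < ⊤) (hh1 : freqNorm s (3 / 8) 1 h < ⊤) :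
    ∀ᵐ p ∂freqMeasure,
      triconv (fun q => ‖f q‖ₑ) (fun q => ‖g q‖ₑ) (fun q => ‖h q‖ₑ) p < ⊤ := by
  have h1 := l2_triconv_lt_top hs hf hg hh hf1 hg1 hh1
  have hT := measurable_triconv hf.enorm hg.enorm hh.enorm
  have h2 : ∫⁻ p, (ewt s (-(3 / 8)) 1 p *
      triconv (fun q => ‖f q‖ₑ) (fun q => ‖g q‖ₑ) (fun q => ‖h q‖ₑ) p) ^ 2 ∂freqMeasure ≠ ⊤ := by
    rw [← l2_sq]
    exact (ENNReal.pow_lt_top h1).ne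
  filter_upwards [ae_lt_top (by fun_prop) h2] with p hp
  by_contra hcon
  rw [not_lt, top_le_iff] at hcon
  have : ewt s (-(3 / 8)) 1 p ≠ 0 := by
    rw [ewt]; exact (ENNReal.ofReal_pos.2 (wt_pos one_pos p)).ne'
  rw [hcon, ENNReal.mul_top this] at hp
  simp at hp

section Admissible

variable {f : ℤ × ℝ → ℂ}

/-- The time integral of a wave decays like the inverse of the modulation, a weight of order `-1`,
while the trilinear estimate gives order `-3/8 = 5/8 - 1`. The gap `5/8` exceeds `1/2`, which is
what Cauchy-Schwarz in the time frequency requires. -/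
theorem Admissible.lintegral_timeInt_lt_top (hf : Admissible f) (t : ℝ) (k : ℤ) :
    ∫⁻ τ, triconv (fun q => ‖f q‖ₑ) (fun q => ‖f q‖ₑ) (fun q => ‖f q‖ₑ) (k, τ) *
      ‖timeInt (τ + (k : ℝ) ^ 2) t‖ₑ < ⊤ := by
  have hm := hf.measurable
  have hT := measurable_triconv hm.enorm hm.enorm hm.enorm
  have h1 := l2_triconv_lt_top le_rfl hm hm hm hf.freqNorm_lt_top hf.freqNorm_lt_top
    hf.freqNorm_lt_top
  have h2 := (lintegral_ewt_neg_one_mul_lt_top (b := 5 / 8) (l := 1) (by norm_num) one_pos hT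
    (by norm_num at h1 ⊢; exact h1) k).ne
  calc _ ≤ ∫⁻ τ, ENNReal.ofReal ((|t| + 2) * 2) * (ewt 0 (-1) 1 (k, τ) *
        triconv (fun q => ‖f q‖ₑ) (fun q => ‖f q‖ₑ) (fun q => ‖f q‖ₑ) (k, τ)) := by
        refine lintegral_mono fun τ => ?_
        rw [mul_comm, ← mul_assoc]
        refine mul_le_mul' ?_ le_rfl
        rw [ewt, ← ENNReal.ofReal_mul (by positivity), ← ofReal_norm]
        refine ENNReal.ofReal_le_ofReal ((norm_timeInt_le _ _).trans (le_of_eq ?_))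
        simp only [wt, modulation, Real.rpow_zero, Real.rpow_neg_one]
        field_simp
    _ < ⊤ := by
        rw [lintegral_const_mul _ (by fun_prop)]
        finiteness

end Admissible

theorem integral_of_ae_hasSum {α : Type*} [MeasurableSpace α] {μ : Measure α} {F : ℤ → α → ℂ}
    {G : α → ℂ} (hF : ∀ j, AEStronglyMeasurable (F j) μ) (hs : ∑' j, ∫⁻ t, ‖F j t‖ₑ ∂μ ≠ ⊤)
    (hG : ∀ᵐ t ∂μ, HasSum (fun j => F j t) (G t)) :
    Integrable G μ ∧ ∫ t, G t ∂μ = ∑' j, ∫ t, F j t ∂μ := by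
  have he : G =ᵐ[μ] fun t => ∑' j, F j t := hG.mono fun t ht => ht.tsum_eq.symm
  refine ⟨⟨?_, ?_⟩, ?_⟩
  · refine aestronglyMeasurable_of_tendsto_ae (atTop : Filter (Finset ℤ))
      (f := fun s t => ∑ j ∈ s, F j t) (fun s => ?_) hG
    exact Finset.aestronglyMeasurable_fun_sum s fun j _ => hF j
  · calc ∫⁻ t, ‖G t‖ₑ ∂μ ≤ ∫⁻ t, ∑' j, ‖F j t‖ₑ ∂μ :=
          lintegral_mono_ae (he.mono fun t ht => by rw [ht]; exact enorm_tsum_le_tsum_enorm)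
      _ = ∑' j, ∫⁻ t, ‖F j t‖ₑ ∂μ := lintegral_tsum fun j => (hF j).enorm
      _ < ⊤ := hs.lt_top
  · rw [integral_congr_ae he, integral_tsum hF hs]

/-- The function `u` has, at almost every time of `J`, the spatial Fourier coefficients that `f`
prescribes. -/
def RepresentsOn (f : ℤ × ℝ → ℂ) (u : ℝ → L2T) (J : Set ℝ) : Prop :=
  ∀ᵐ t ∂(volume.restrict J), ∀ k, spaceFT (u t) k = coeffAt f t k

/-- The `j`-th term of the series for the `k`-th spatial Fourier coefficient of `|u|² u`. -/
noncomputable def cubicTerm (f : ℤ × ℝ → ℂ) (k j : ℤ) (t : ℝ) : ℂ :=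
  ((2 * Real.pi : ℂ) ^ 2)⁻¹ *
    (coeffAt (sqConv f) t j * (starRingEnd ℂ) (coeffAt f t (j - k)))

section Admissible

variable {f : ℤ × ℝ → ℂ} {u : ℝ → L2T} {J : Set ℝ}

theorem Admissible.continuous_cubicTerm (hf : Admissible f) (k j : ℤ) :
    Continuous (cubicTerm f k j) := by
  have h1 := continuous_coeffAt (hf.integrable_sqConv_slice j)
  have h2 := continuous_coeffAt (hf.integrable_slice (j - k))
  exact continuous_const.mul (h1.mul (Complex.continuous_conj.comp h2))

theorem Admissible.ae_cubic (hf : Admissible f) (hu : RepresentsOn f u J) :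
    ∀ᵐ t ∂(volume.restrict J),
      ∫⁻ x, ‖u t x‖ₑ ^ 4 ∂haarT ≤ ∑' k, ‖coeffAt (sqConv f) t k‖ₑ ^ 2 ∧
      ∀ k, HasSum (fun j => cubicTerm f k j t) (spaceFT (cubic (u t)) k) := by
  filter_upwards [hu, ae_restrict_of_ae hf.ae_tsum_ne_top] with t ht hS
  have h := cubic_of_summable (u t) (coeffAt (sqConv f) t)
    (fun k => by simp_rw [ht]; exact hf.hasSum_coeffAt_mul t k) hS
  refine ⟨h.1, fun k => ?_⟩
  have h2 := h.2 k
  simp_rw [ht] at h2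
  exact h2

theorem Admissible.lintegral_cubic_lt_top (hf : Admissible f) (hu : RepresentsOn f u J)
    (hJ : volume J ≠ ⊤) : ∫⁻ t in J, ∫⁻ x, ‖u t x‖ₑ ^ 3 ∂haarT < ⊤ := by
  calc _ ≤ ∫⁻ t in J, (1 + ∑' k, ‖coeffAt (sqConv f) t k‖ₑ ^ 2) := by
        refine lintegral_mono_ae ((hf.ae_cubic hu).mono fun t ht => ?_)
        calc ∫⁻ x, ‖u t x‖ₑ ^ 3 ∂haarT ≤ ∫⁻ x, (1 + ‖u t x‖ₑ ^ 4) ∂haarT := by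
              refine lintegral_mono fun x => ?_
              rcases le_total ‖u t x‖ₑ 1 with h | h
              · exact (pow_le_one₀ zero_le h).trans le_self_add
              · exact (pow_le_pow_right₀ h (by norm_num)).trans le_add_self
          _ = 1 + ∫⁻ x, ‖u t x‖ₑ ^ 4 ∂haarT := by
              rw [lintegral_add_left measurable_const]; simp
          _ ≤ _ := by gcongr; exact ht.1
    _ = volume J + ∫⁻ t in J, ∑' k, ‖coeffAt (sqConv f) t k‖ₑ ^ 2 := by
        rw [lintegral_add_left measurable_const]; simp
    _ ≤ volume J + ∫⁻ t, ∑' k, ‖coeffAt (sqConv f) t k‖ₑ ^ 2 := by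
        gcongr; exact Measure.restrict_le_self
    _ < ⊤ := ENNReal.add_lt_top.2 ⟨hJ.lt_top, hf.lintegral_tsum_lt_top⟩

/-- By `a b ≤ a² + b²` the series is controlled by two `ℓ²` sums: that of the square is integrable
in time by Plancherel, and that of `f` is bounded uniformly in time. -/
theorem Admissible.tsum_lintegral_cubicTerm_ne_top (hf : Admissible f) (hJ : volume J ≠ ⊤)
    (k : ℤ) : ∑' j, ∫⁻ t in J, ‖cubicTerm f k j t‖ₑ ≠ ⊤ := by
  rw [← lintegral_tsum fun j => (hf.continuous_cubicTerm k j).measurable.enorm.aemeasurable]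
  set c : ℝ≥0∞ := ‖((2 * Real.pi : ℂ) ^ 2)⁻¹‖ₑ with hc
  set M : ℝ≥0∞ := ∑' j : ℤ, (∫⁻ τ, ‖f (j, τ)‖ₑ) ^ 2
  have hM : M ≠ ⊤ := hf.tsum_lt_top.ne
  have hc' : c ≠ ⊤ := enorm_ne_top
  have hcm : Measurable fun t => ∑' k, ‖coeffAt (sqConv f) t k‖ₑ ^ 2 := by
    refine Measurable.tsum fun k => ?_
    have := (continuous_coeffAt (hf.integrable_sqConv_slice k)).measurable
    fun_prop
  refine ne_of_lt ?_
  calc ∫⁻ t in J, ∑' j, ‖cubicTerm f k j t‖ₑ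
      ≤ ∫⁻ t in J, c * (∑' j, ‖coeffAt (sqConv f) t j‖ₑ ^ 2 + M) := by
        refine lintegral_mono fun t => ?_
        calc ∑' j, ‖cubicTerm f k j t‖ₑ
            ≤ ∑' j, c * (‖coeffAt (sqConv f) t j‖ₑ ^ 2 + ‖coeffAt f t (j - k)‖ₑ ^ 2) := by
              refine ENNReal.tsum_le_tsum fun j => ?_
              rw [cubicTerm, enorm_mul, enorm_mul, enorm_conj]
              exact mul_le_mul' le_rfl (mul_le_sq_add_sq _ _)
          _ = c * (∑' j, ‖coeffAt (sqConv f) t j‖ₑ ^ 2 + ∑' j, ‖coeffAt f t (j - k)‖ₑ ^ 2) := by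
              rw [ENNReal.tsum_mul_left, ENNReal.tsum_add]
          _ ≤ _ := mul_le_mul' le_rfl (add_le_add le_rfl (tsum_coeffAt_sq_le f t k))
    _ = c * ((∫⁻ t in J, ∑' j, ‖coeffAt (sqConv f) t j‖ₑ ^ 2) + M * volume J) := by
        rw [lintegral_const_mul _ (by fun_prop), lintegral_add_left hcm]
        simp
    _ ≤ c * ((∫⁻ t, ∑' j, ‖coeffAt (sqConv f) t j‖ₑ ^ 2) + M * volume J) :=
        mul_le_mul' le_rfl (add_le_add (lintegral_mono' Measure.restrict_le_self le_rfl) le_rfl)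
    _ < ⊤ := by
        have := hf.lintegral_tsum_lt_top.ne
        finiteness

theorem Admissible.integrableOn_cubic (hf : Admissible f) (hu : RepresentsOn f u J)
    (hJ : volume J ≠ ⊤) (k : ℤ) : IntegrableOn (fun t => spaceFT (cubic (u t)) k) J :=
  (integral_of_ae_hasSum (fun j => (hf.continuous_cubicTerm k j).aestronglyMeasurable)
    (hf.tsum_lintegral_cubicTerm_ne_top hJ k) ((hf.ae_cubic hu).mono fun _ ht => ht.2 k)).1

/-- The wave of frequency `ρ` from the square, the conjugate wave of frequency `ρ - τ` and the
factor of frequency `k²` multiply to the wave of frequency `τ + k²`, whose time integral is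
`timeInt`. The frequencies `τ` and `ρ` are exchanged with the time integral one at a time, so
integrability of the slices is enough. -/
theorem Admissible.integral_wave_cubicTerm (hf : Admissible f) (k j : ℤ) (t : ℝ) :
    ∫ x in (0 : ℝ)..t, wave ((k : ℝ) ^ 2) x * cubicTerm f k j x =
      ((2 * Real.pi : ℂ) ^ 2)⁻¹ * ∫ ρ, ∫ τ, sqConv f (j, ρ) *
        (starRingEnd ℂ) (f ((j, ρ) - (k, τ))) * timeInt (τ + (k : ℝ) ^ 2) t := by
  have hU := continuous_coeffAt (hf.integrable_slice (j - k))
  have hUc : Continuous fun x => (starRingEnd ℂ) (coeffAt f x (j - k)) :=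
    Complex.continuous_conj.comp hU
  have hfi := hf.integrable_slice (j - k)
  have hfc : Integrable fun τ => (starRingEnd ℂ) (f (j - k, τ)) :=
    hfi.norm.mono' (Complex.continuous_conj.comp_aestronglyMeasurable hfi.1)
      (Eventually.of_forall fun τ => by simp)
  have h1 : ∀ ρ : ℝ, ∫ τ, (starRingEnd ℂ) (f ((j, ρ) - (k, τ))) * timeInt (τ + (k : ℝ) ^ 2) t =
      ∫ x in (0 : ℝ)..t, wave ρ x * (wave ((k : ℝ) ^ 2) x *
        (starRingEnd ℂ) (coeffAt f x (j - k))) := by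
    intro ρ
    have e1 : ∀ τ, timeInt (τ + (k : ℝ) ^ 2) t =
        ∫ x in (0 : ℝ)..t, wave τ x * wave ((k : ℝ) ^ 2) x := fun τ => by
      simp_rw [timeInt, wave_add_left]
    have e3 : ∀ τ : ℝ, ((j, ρ) : ℤ × ℝ) - (k, τ) = (j - k, ρ - τ) := fun τ => rfl
    simp_rw [e1, e3]
    rw [integral_mul_intervalIntegral_wave (hfc.comp_sub_left ρ)
      (w := fun x => wave ((k : ℝ) ^ 2) x) (by fun_prop)]
    refine intervalIntegral.integral_congr fun x _ => ?_
    have e2 : ∫ τ, (starRingEnd ℂ) (f (j - k, ρ - τ)) * wave τ x =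
        wave ρ x * (starRingEnd ℂ) (coeffAt f x (j - k)) := by
      rw [coeffAt, ← integral_conj, ← integral_const_mul,
        ← integral_sub_left_eq_self _ volume ρ]
      refine integral_congr_ae (Eventually.of_forall fun τ => ?_)
      simp only [map_mul, conj_wave]
      rw [sub_sub_cancel, sub_eq_add_neg ρ τ, wave_add_left]
      ring
    rw [e2]
    ring
  have h2 : ∀ ρ : ℝ, ∫ τ, sqConv f (j, ρ) *
        (starRingEnd ℂ) (f ((j, ρ) - (k, τ))) * timeInt (τ + (k : ℝ) ^ 2) t =
      sqConv f (j, ρ) * ∫ x in (0 : ℝ)..t, wave ρ x * (wave ((k : ℝ) ^ 2) x *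
        (starRingEnd ℂ) (coeffAt f x (j - k))) := by
    intro ρ
    rw [← h1, ← integral_const_mul]
    simp only [mul_assoc]
  simp_rw [h2]
  rw [integral_mul_intervalIntegral_wave (hf.integrable_sqConv_slice j)
      (w := fun x => wave ((k : ℝ) ^ 2) x * (starRingEnd ℂ) (coeffAt f x (j - k))) (by fun_prop),
    ← intervalIntegral.integral_const_mul]
  refine intervalIntegral.integral_congr fun x _ => ?_
  simp only [cubicTerm]
  rw [show ∫ τ, sqConv f (j, τ) * wave τ x = coeffAt (sqConv f) x j from rfl]
  ring

/-- The Duhamel integral of `|u|² u`, on the frequency side. -/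
theorem Admissible.integral_wave_cubic (hf : Admissible f) {t : ℝ}
    (hu : RepresentsOn f u (uIoc 0 t)) (k : ℤ) :
    ∫ x in (0 : ℝ)..t, wave ((k : ℝ) ^ 2) x * spaceFT (cubic (u x)) k =
      ((2 * Real.pi : ℂ) ^ 2)⁻¹ * ∫ τ, cubicFT f (k, τ) * timeInt (τ + (k : ℝ) ^ 2) t := by
  have hfm := hf.measurable
  have hJ : volume (uIoc 0 t) ≠ ⊤ := by simp
  have hw : Continuous fun x => wave ((k : ℝ) ^ 2) x := by fun_prop
  have h1 := (integral_of_ae_hasSum (μ := volume.restrict (uIoc 0 t))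
    (F := fun j x => wave ((k : ℝ) ^ 2) x * cubicTerm f k j x)
    (G := fun x => wave ((k : ℝ) ^ 2) x * spaceFT (cubic (u x)) k)
    (fun j => (hw.mul (hf.continuous_cubicTerm k j)).aestronglyMeasurable)
    (by simp_rw [enorm_mul, enorm_wave, one_mul]; exact hf.tsum_lintegral_cubicTerm_ne_top hJ k)
    ((hf.ae_cubic hu).mono fun t ht => (ht.2 k).mul_left _)).2
  rw [intervalIntegral.intervalIntegral_eq_integral_uIoc, h1, Complex.real_smul, ← tsum_mul_left]
  have h2 : ∀ j, ((if (0 : ℝ) ≤ t then (1 : ℝ) else -1 : ℝ) : ℂ) *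
      ∫ x in uIoc 0 t, wave ((k : ℝ) ^ 2) x * cubicTerm f k j x =
      ((2 * Real.pi : ℂ) ^ 2)⁻¹ * ∫ ρ, ∫ τ, sqConv f (j, ρ) *
        (starRingEnd ℂ) (f ((j, ρ) - (k, τ))) * timeInt (τ + (k : ℝ) ^ 2) t := fun j => by
    rw [← hf.integral_wave_cubicTerm k j t, intervalIntegral.intervalIntegral_eq_integral_uIoc,
      Complex.real_smul]
  simp_rw [h2]
  rw [tsum_mul_left]
  congr 1
  have hK : Measurable fun τ : ℝ => timeInt (τ + (k : ℝ) ^ 2) t :=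
    (continuous_timeInt.comp (f := fun τ : ℝ => (τ + (k : ℝ) ^ 2, t)) (by fun_prop)).measurable
  set Θ : ℝ → ℤ × ℝ → ℂ := fun τ r => sqConv f r *
    (starRingEnd ℂ) (f (r - (k, τ))) * timeInt (τ + (k : ℝ) ^ 2) t with hΘ
  have hΘm : Measurable (Function.uncurry Θ) := by
    have hs := measurable_sqConv hfm
    have hc : Measurable fun z : ℝ × (ℤ × ℝ) => (starRingEnd ℂ) (f (z.2 - (k, z.1))) :=
      measurable_conj (by fun_prop)
    exact ((hs.comp measurable_snd).mul hc).mul (hK.comp measurable_fst)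
  -- The series over `j` and both frequency integrals converge absolutely together, because `Θ` is
  -- dominated by the trilinear convolution times the decay of `timeInt`.
  have hint : Integrable (Function.uncurry Θ) (volume.prod freqMeasure) := by
    refine ⟨hΘm.aestronglyMeasurable, ?_⟩
    unfold HasFiniteIntegral
    rw [lintegral_prod _ hΘm.enorm.aemeasurable]
    refine lt_of_le_of_lt ?_ (hf.lintegral_timeInt_lt_top t k)
    refine lintegral_mono fun τ => ?_
    simp only
    rw [triconv_eq hfm.enorm hfm.enorm, ← lintegral_mul_const _
      (by have := measurable_lconv hfm.enorm hfm.enorm; fun_prop)]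
    refine lintegral_mono fun r => ?_
    simp only [Function.uncurry, hΘ, enorm_mul, enorm_conj]
    exact mul_le_mul' (mul_le_mul' (enorm_sqConv_le f r) le_rfl) le_rfl
  have h3 : ∫ τ, cubicFT f (k, τ) * timeInt (τ + (k : ℝ) ^ 2) t =
      ∫ τ, ∫ r, Θ τ r ∂freqMeasure := by
    -- The integral that defines `cubicFT` converges absolutely only at almost every frequency;
    -- there Fubini exhibits `sqConv` as its inner integral.
    have hae := ae_triconv_lt_top le_rfl hfm hfm hfm hf.freqNorm_lt_top hf.freqNorm_lt_top
      hf.freqNorm_lt_top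
    have hae2 : ∀ᵐ τ : ℝ, triconv (fun q => ‖f q‖ₑ) (fun q => ‖f q‖ₑ) (fun q => ‖f q‖ₑ) (k, τ) < ⊤ := by
      have := Measure.ae_ae_of_ae_prod hae
      rw [Measure.ae_count_iff] at this
      exact this k
    refine integral_congr_ae (hae2.mono fun τ hτ => ?_)
    simp only [hΘ]
    rw [integral_mul_const, cubicFT, integral_prod _ (integrable_cubicFT hfm hfm hfm hτ)]
    simp only
    congr 1
    refine integral_congr_ae (Eventually.of_forall fun r => ?_)
    simp only
    rw [integral_mul_const]
    rfl
  rw [h3, integral_integral_swap hint]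
  exact (hasSum_integral_freqMeasure hint.integral_prod_right).tsum_eq

end Admissible

/-! ### Lipschitz bounds and the contraction. -/

theorem ewt_le_of_le_of_nonpos {s a a' l : ℝ} (ha : a' ≤ a) (ha0 : a ≤ 0) (hl : 1 ≤ l)
    (p : ℤ × ℝ) : ewt s a' l p ≤ ENNReal.ofReal (l ^ (a' - a)) * ewt s a 1 p := by
  have h0 : (0 : ℝ) < 1 + |modulation p| := by positivity
  have h1 : (0 : ℝ) < l + |modulation p| := by positivity
  rw [ewt, ewt, ← ENNReal.ofReal_mul (by positivity)]
  refine ENNReal.ofReal_le_ofReal ?_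
  rw [wt, wt, mul_left_comm]
  refine mul_le_mul_of_nonneg_left ?_ (Real.rpow_nonneg (bracket_pos _).le _)
  calc (l + |modulation p|) ^ a' = (l + |modulation p|) ^ (a' - a) * (l + |modulation p|) ^ a := by
        rw [← Real.rpow_add h1]; ring_nf
    _ ≤ l ^ (a' - a) * (1 + |modulation p|) ^ a := by
        refine mul_le_mul ?_ ?_ (by positivity) (by positivity)
        · exact Real.rpow_le_rpow_of_nonpos (by positivity) (by simp) (by linarith)
        · exact Real.rpow_le_rpow_of_nonpos h0 (by linarith) ha0

/-- Together with its counterpart for nonpositive orders, this is the source of smallness on short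
time intervals: `l + |τ + k²| ≥ l`, so a spare order of the weight is worth a power of `l`. -/
theorem ewt_le_of_le_of_nonneg {s a a' l : ℝ} (ha : a ≤ a') (ha0 : 0 ≤ a) (hl : 1 ≤ l)
    (p : ℤ × ℝ) : ewt s a 1 p ≤ ENNReal.ofReal (l ^ (a - a')) * ewt s a' l p := by
  have h0 : (0 : ℝ) < 1 + |modulation p| := by positivity
  have h1 : (0 : ℝ) < l + |modulation p| := by positivity
  rw [ewt, ewt, ← ENNReal.ofReal_mul (by positivity)]
  refine ENNReal.ofReal_le_ofReal ?_
  rw [wt, wt, mul_left_comm]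
  refine mul_le_mul_of_nonneg_left ?_ (Real.rpow_nonneg (bracket_pos _).le _)
  calc (1 + |modulation p|) ^ a ≤ (l + |modulation p|) ^ a :=
        Real.rpow_le_rpow h0.le (by linarith) ha0
    _ = (l + |modulation p|) ^ (a - a') * (l + |modulation p|) ^ a' := by
        rw [← Real.rpow_add h1]; ring_nf
    _ ≤ l ^ (a - a') * (l + |modulation p|) ^ a' := by
        refine mul_le_mul_of_nonneg_right ?_ (by positivity)
        exact Real.rpow_le_rpow_of_nonpos (by positivity) (by simp) (by linarith)

theorem freqNorm_le_mul {s b l s' b' l' : ℝ} {c : ℝ≥0∞} {f : ℤ × ℝ → ℂ} (hf : Measurable f)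
    (h : ∀ p, ewt s b l p ≤ c * ewt s' b' l' p) : freqNorm s b l f ≤ c * freqNorm s' b' l' f := by
  rw [freqNorm, freqNorm, ← l2_const_mul _ (by fun_prop)]
  refine l2_mono fun p => ?_
  rw [← mul_assoc]
  exact mul_le_mul' (h p) le_rfl

theorem freqNorm_mono_left {s s' b l : ℝ} (h : s ≤ s') (hl : 0 < l) (f : ℤ × ℝ → ℂ) :
    freqNorm s b l f ≤ freqNorm s' b l f :=
  l2_mono fun p => mul_le_mul' (ewt_mono_left h b hl p) le_rfl

theorem freqNorm_add_le {s b l : ℝ} {f g : ℤ × ℝ → ℂ} (hf : Measurable f) (hg : Measurable g) :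
    freqNorm s b l (fun p => f p + g p) ≤ freqNorm s b l f + freqNorm s b l g := by
  refine le_trans (l2_mono fun p => ?_) (l2_add_le (by fun_prop) (by fun_prop))
  rw [← mul_add]
  exact mul_le_mul' le_rfl (enorm_add_le _ _)

theorem freqNorm_sub_le {s b l : ℝ} {f g : ℤ × ℝ → ℂ} (hf : Measurable f) (hg : Measurable g) :
    freqNorm s b l (fun p => f p - g p) ≤ freqNorm s b l f + freqNorm s b l g := by
  refine le_trans (l2_mono fun p => ?_) (l2_add_le (by fun_prop) (by fun_prop))
  rw [← mul_add]
  exact mul_le_mul' le_rfl enorm_sub_le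

/-- The nonlinearity `ξ u - (σ + i) |u|² u` on the frequency side. -/
noncomputable def nonlin (ξ σ : ℝ) (f : ℤ × ℝ → ℂ) (p : ℤ × ℝ) : ℂ :=
  ξ * f p - ((σ : ℂ) + Complex.I) * (((2 * Real.pi : ℂ) ^ 2)⁻¹ * cubicFT f p)

theorem measurable_nonlin (ξ σ : ℝ) {f : ℤ × ℝ → ℂ} (hf : Measurable f) :
    Measurable (nonlin ξ σ f) := by
  have := measurable_cubicFT hf
  unfold nonlin
  fun_prop

/-- Telescoping in the three factors. Finiteness at the point `p` is needed to subtract the two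
integrals under one integral sign. -/
theorem enorm_cubicFT_sub_le {f g : ℤ × ℝ → ℂ} (hf : Measurable f) (hg : Measurable g)
    {p : ℤ × ℝ} (hfp : triconv (fun q => ‖f q‖ₑ) (fun q => ‖f q‖ₑ) (fun q => ‖f q‖ₑ) p < ⊤)
    (hgp : triconv (fun q => ‖g q‖ₑ) (fun q => ‖g q‖ₑ) (fun q => ‖g q‖ₑ) p < ⊤) :
    ‖cubicFT f p - cubicFT g p‖ₑ ≤
      triconv (fun q => ‖f q‖ₑ) (fun q => ‖f q‖ₑ) (fun q => ‖f q - g q‖ₑ) p +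
      triconv (fun q => ‖f q‖ₑ) (fun q => ‖f q - g q‖ₑ) (fun q => ‖g q‖ₑ) p +
      triconv (fun q => ‖f q - g q‖ₑ) (fun q => ‖g q‖ₑ) (fun q => ‖g q‖ₑ) p := by
  have hd : Measurable fun q => ‖f q - g q‖ₑ := by fun_prop
  rw [cubicFT, cubicFT, ← integral_sub (integrable_cubicFT hf hf hf hfp)
    (integrable_cubicFT hg hg hg hgp),
    triconv_eq_lintegral_prod hf.enorm hf.enorm hd,
    triconv_eq_lintegral_prod hf.enorm hd hg.enorm,
    triconv_eq_lintegral_prod hd hg.enorm hg.enorm,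
    ← lintegral_add_left (by fun_prop), ← lintegral_add_left (by fun_prop)]
  refine (enorm_integral_le_lintegral_enorm _).trans (lintegral_mono fun z => ?_)
  have e : f z.2 * f (z.1 - z.2) * (starRingEnd ℂ) (f (z.1 - p)) -
      g z.2 * g (z.1 - z.2) * (starRingEnd ℂ) (g (z.1 - p)) =
      f z.2 * f (z.1 - z.2) * (starRingEnd ℂ) (f (z.1 - p) - g (z.1 - p)) +
      f z.2 * (f (z.1 - z.2) - g (z.1 - z.2)) * (starRingEnd ℂ) (g (z.1 - p)) +
      (f z.2 - g z.2) * g (z.1 - z.2) * (starRingEnd ℂ) (g (z.1 - p)) := by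
    rw [map_sub]; ring
  simp only
  rw [e]
  refine (enorm_add_le _ _).trans (add_le_add ((enorm_add_le _ _).trans (add_le_add ?_ ?_)) ?_) <;>
  simp only [enorm_mul, enorm_conj, le_refl]

/-- The nonlinearity is locally Lipschitz. -/
theorem exists_freqNorm_nonlin_sub_le (ξ σ : ℝ) {s : ℝ} (hs : 0 ≤ s) : ∃ C : ℝ≥0∞, C ≠ ⊤ ∧
    ∀ f g : ℤ × ℝ → ℂ, Measurable f → Measurable g → freqNorm s (3 / 8) 1 f < ⊤ →
      freqNorm s (3 / 8) 1 g < ⊤ →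
      freqNorm s (-(3 / 8)) 1 (fun p => nonlin ξ σ f p - nonlin ξ σ g p) ≤
        C * (1 + freqNorm s (3 / 8) 1 f + freqNorm s (3 / 8) 1 g) ^ 2 *
          freqNorm s (3 / 8) 1 (fun p => f p - g p) := by
  obtain ⟨C, hC, h⟩ := exists_l2_triconv_le hs
  set K : ℝ≥0∞ := ‖((σ : ℂ) + Complex.I) * ((2 * Real.pi : ℂ) ^ 2)⁻¹‖ₑ
  have hK : K ≠ ⊤ := enorm_ne_top
  refine ⟨‖(ξ : ℂ)‖ₑ + 3 * (K * C), by have : ‖(ξ : ℂ)‖ₑ ≠ ⊤ := enorm_ne_top; finiteness,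
    fun f g hf hg hfN hgN => ?_⟩
  set a := freqNorm s (3 / 8) 1 f with ha
  set b := freqNorm s (3 / 8) 1 g with hb
  set d := freqNorm s (3 / 8) 1 (fun p => f p - g p) with hd
  have hdm : Measurable fun q => ‖f q - g q‖ₑ := by fun_prop
  have hfm := hf.enorm
  have hgm := hg.enorm
  set T₁ := triconv (fun q => ‖f q‖ₑ) (fun q => ‖f q‖ₑ) (fun q => ‖f q - g q‖ₑ)
  set T₂ := triconv (fun q => ‖f q‖ₑ) (fun q => ‖f q - g q‖ₑ) (fun q => ‖g q‖ₑ)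
  set T₃ := triconv (fun q => ‖f q - g q‖ₑ) (fun q => ‖g q‖ₑ) (fun q => ‖g q‖ₑ)
  have m₁ : Measurable T₁ := measurable_triconv hfm hfm hdm
  have m₂ : Measurable T₂ := measurable_triconv hfm hdm hgm
  have m₃ : Measurable T₃ := measurable_triconv hdm hgm hgm
  set w := ewt s (-(3 / 8)) 1
  have hw : Measurable w := measurable_ewt _ _ _
  have hlin : l2 freqMeasure (fun p => w p * ‖f p - g p‖ₑ) ≤ d := by
    refine l2_mono fun p => mul_le_mul' (ENNReal.ofReal_le_ofReal ?_) le_rfl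
    refine mul_le_mul_of_nonneg_left ?_ (Real.rpow_nonneg (bracket_pos _).le _)
    exact Real.rpow_le_rpow_of_exponent_le (by simp) (by norm_num)
  have hbound : ∀ᵐ p ∂freqMeasure, w p * ‖nonlin ξ σ f p - nonlin ξ σ g p‖ₑ ≤
      ‖(ξ : ℂ)‖ₑ * (w p * ‖f p - g p‖ₑ) + K * (w p * T₁ p + w p * T₂ p + w p * T₃ p) := by
    filter_upwards [ae_triconv_lt_top hs hf hf hf hfN hfN hfN,
      ae_triconv_lt_top hs hg hg hg hgN hgN hgN] with p hfp hgp
    have e : nonlin ξ σ f p - nonlin ξ σ g p = ξ * (f p - g p) -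
        ((σ : ℂ) + Complex.I) * ((2 * Real.pi : ℂ) ^ 2)⁻¹ * (cubicFT f p - cubicFT g p) := by
      rw [nonlin, nonlin]; ring
    calc w p * ‖nonlin ξ σ f p - nonlin ξ σ g p‖ₑ
        ≤ w p * (‖(ξ : ℂ)‖ₑ * ‖f p - g p‖ₑ + K * (T₁ p + T₂ p + T₃ p)) := by
          refine mul_le_mul' le_rfl ?_
          rw [e]
          refine enorm_sub_le.trans ?_
          rw [enorm_mul, enorm_mul _ (cubicFT f p - cubicFT g p)]
          exact add_le_add le_rfl (mul_le_mul' le_rfl (enorm_cubicFT_sub_le hf hg hfp hgp))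
      _ = _ := by ring
  calc freqNorm s (-(3 / 8)) 1 (fun p => nonlin ξ σ f p - nonlin ξ σ g p)
      ≤ l2 freqMeasure (fun p => ‖(ξ : ℂ)‖ₑ * (w p * ‖f p - g p‖ₑ) +
          K * (w p * T₁ p + w p * T₂ p + w p * T₃ p)) := l2_mono_ae hbound
    _ ≤ ‖(ξ : ℂ)‖ₑ * l2 freqMeasure (fun p => w p * ‖f p - g p‖ₑ) +
          K * (l2 freqMeasure (fun p => w p * T₁ p) + l2 freqMeasure (fun p => w p * T₂ p) +
            l2 freqMeasure (fun p => w p * T₃ p)) := by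
        refine (l2_add_le (by fun_prop) (by fun_prop)).trans ?_
        rw [l2_const_mul _ (by fun_prop), l2_const_mul _ (by fun_prop)]
        refine add_le_add le_rfl (mul_le_mul' le_rfl ?_)
        exact (l2_add_le (by fun_prop) (by fun_prop)).trans
          (add_le_add (l2_add_le (by fun_prop) (by fun_prop)) le_rfl)
    _ ≤ ‖(ξ : ℂ)‖ₑ * d + K * (C * (a * a * d) + C * (a * d * b) + C * (d * b * b)) := by
        refine add_le_add (mul_le_mul' le_rfl hlin) (mul_le_mul' le_rfl
          (add_le_add (add_le_add ?_ ?_) ?_))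
        · exact h _ _ _ hfm hfm hdm
        · exact h _ _ _ hfm hdm hgm
        · exact h _ _ _ hdm hgm hgm
    _ ≤ ‖(ξ : ℂ)‖ₑ * ((1 + a + b) ^ 2 * d) + K * (C * ((1 + a + b) ^ 2 * d) +
          C * ((1 + a + b) ^ 2 * d) + C * ((1 + a + b) ^ 2 * d)) := by
        have e1 : a ≤ 1 + a + b := le_add_self.trans le_self_add
        have e2 : b ≤ 1 + a + b := le_add_self
        have e0 : 1 ≤ 1 + a + b := by rw [add_assoc]; exact le_self_add
        have f1 : d ≤ (1 + a + b) ^ 2 * d := le_mul_of_one_le_left' (one_le_pow₀ e0)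
        have f2 : a * a * d ≤ (1 + a + b) ^ 2 * d := by
          rw [sq]; exact mul_le_mul' (mul_le_mul' e1 e1) le_rfl
        have f3 : a * d * b ≤ (1 + a + b) ^ 2 * d := by
          rw [sq, mul_right_comm]; exact mul_le_mul' (mul_le_mul' e1 e2) le_rfl
        have f4 : d * b * b ≤ (1 + a + b) ^ 2 * d := by
          rw [sq, mul_comm _ d, mul_assoc]; exact mul_le_mul' le_rfl (mul_le_mul' e2 e2)
        exact add_le_add (mul_le_mul' le_rfl f1) (mul_le_mul' le_rfl (add_le_add (add_le_add
          (mul_le_mul' le_rfl f2) (mul_le_mul' le_rfl f3)) (mul_le_mul' le_rfl f4)))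
    _ = _ := by ring

theorem nonlin_zero (ξ σ : ℝ) : nonlin ξ σ (fun _ => 0) = fun _ => 0 := by
  funext p
  simp [nonlin, cubicFT]

theorem freqNorm_zero (s b l : ℝ) : freqNorm s b l (fun _ => 0) = 0 := by
  simp [freqNorm, l2]

theorem freqNorm_nonlin_lt_top (ξ σ : ℝ) {s b l : ℝ} (hs : 0 ≤ s) (hb : b ≤ 5 / 8) (hl : 1 ≤ l)
    {f : ℤ × ℝ → ℂ} (hf : Measurable f) (hfN : freqNorm s (3 / 8) 1 f < ⊤) :
    freqNorm 0 (b - 1) l (nonlin ξ σ f) < ⊤ := by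
  obtain ⟨C, hC, h⟩ := exists_freqNorm_nonlin_sub_le ξ σ hs
  -- The nonlinearity vanishes at zero, so the Lipschitz bound against zero is a bound on its size.
  have h1 := h f (fun _ => 0) hf measurable_const hfN (by rw [freqNorm_zero]; simp)
  simp only [nonlin_zero, sub_zero, freqNorm_zero, add_zero] at h1
  have h2 : freqNorm s (-(3 / 8)) 1 (nonlin ξ σ f) < ⊤ := by
    refine h1.trans_lt ?_
    have := hfN.ne
    finiteness
  refine (freqNorm_mono_left hs (by linarith) _).trans_lt ?_
  refine (freqNorm_le_mul (measurable_nonlin ξ σ hf)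
    (ewt_le_of_le_of_nonpos (a := -(3 / 8)) (by linarith) (by norm_num) hl)).trans_lt ?_
  have := h2.ne
  finiteness

theorem IsCutoff.integrable_duhamelKernel_mul {b C l : ℝ} (hb : 1 / 2 < b) {g : ℝ → ℂ}
    (hg : IsCutoff C l g) (hC : 0 < C) (hl : 0 < l) {n : ℤ × ℝ → ℂ} (hn : Measurable n)
    (hfin : freqNorm 0 (b - 1) l n < ⊤) (p : ℤ × ℝ) :
    Integrable fun τ => duhamelKernel g (modulation p) (τ + (p.1 : ℝ) ^ 2) * n (p.1, τ) := by
  have hK := measurable_duhamelKernel hg.measurable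
  have h1 : Measurable fun τ : ℝ => duhamelKernel g (modulation p) (τ + (p.1 : ℝ) ^ 2) :=
    hK.comp (by fun_prop : Measurable fun τ : ℝ => (modulation p, τ + (p.1 : ℝ) ^ 2))
  refine ⟨(h1.mul (by fun_prop)).aestronglyMeasurable, ?_⟩
  calc ∫⁻ τ, ‖duhamelKernel g (modulation p) (τ + (p.1 : ℝ) ^ 2) * n (p.1, τ)‖ₑ
      ≤ ∫⁻ τ, ENNReal.ofReal (8 * C * l * (2 / l ^ 2)) *
          (ewt 0 (-1) l (p.1, τ) * ‖n (p.1, τ)‖ₑ) := by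
        refine lintegral_mono fun τ => ?_
        rw [enorm_mul, ← mul_assoc]
        refine mul_le_mul' ?_ le_rfl
        rw [ewt, ← ENNReal.ofReal_mul (by positivity), ← ofReal_norm]
        refine ENNReal.ofReal_le_ofReal ((hg.norm_duhamelKernel_le hC hl _ _).trans ?_)
        have e : ∀ x : ℝ, 1 / (l + |x|) ^ 2 ≤ 1 / l ^ 2 := fun x =>
          one_div_le_one_div_of_le (by positivity)
            (pow_le_pow_left₀ hl.le (by linarith [abs_nonneg x]) 2)
        have hθ : 0 < l + |τ + (p.1 : ℝ) ^ 2| := by positivity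
        simp only [wt, Real.rpow_zero, one_mul, Real.rpow_neg_one]
        have e2 : l + |modulation (p.1, τ)| = l + |τ + (p.1 : ℝ) ^ 2| := rfl
        rw [e2]
        calc _ ≤ 8 * C * (l / (l + |τ + (p.1 : ℝ) ^ 2|) * (1 / l ^ 2 + 1 / l ^ 2)) := by
              refine mul_le_mul_of_nonneg_left (mul_le_mul_of_nonneg_left
                (add_le_add (e _) (e _)) (by positivity)) (by positivity)
          _ = _ := by field_simp; ring
    _ < ⊤ := by
        rw [lintegral_const_mul _ (by fun_prop)]
        have := (lintegral_ewt_neg_one_lt_top hb hl hn hfin p.1).ne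
        finiteness

/-- The map whose fixed points give the solutions of the equation, on the frequency side. -/
noncomputable def duhamelMap (ξ σ : ℝ) (g : ℝ → ℂ) (c : ℤ → ℂ) (f : ℤ × ℝ → ℂ) (p : ℤ × ℝ) : ℂ :=
  freeOp g c p + duhamelOp g (nonlin ξ σ f) p

theorem measurable_duhamelMap (ξ σ : ℝ) {g : ℝ → ℂ} (hg : Measurable g) (c : ℤ → ℂ)
    {f : ℤ × ℝ → ℂ} (hf : Measurable f) : Measurable (duhamelMap ξ σ g c f) :=
  (measurable_freeOp hg c).add (measurable_duhamelOp hg (measurable_nonlin ξ σ hf))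

/-- The map is linear in the datum and in the nonlinearity. The Duhamel operator asks for order `b -
1` with parameter `l`, whereas the Lipschitz bound supplies order `-3/8` with parameter `1`; as `b ≤
5/8`, the comparison gains `l^(b-5/8)`. -/
theorem exists_freqNorm_duhamelMap_sub_le (ξ σ : ℝ) {s b C₀ : ℝ} (hs : 0 ≤ s) (hb : 1 / 2 < b)
    (hb2 : b ≤ 5 / 8) (hC₀ : 0 < C₀) : ∃ C : ℝ≥0∞, C ≠ ⊤ ∧ ∀ l : ℝ, 1 ≤ l → ∀ g, IsCutoff C₀ l g →
    ∀ (c d : ℤ → ℂ) (f h : ℤ × ℝ → ℂ), Measurable f → Measurable h →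
      freqNorm s (3 / 8) 1 f < ⊤ → freqNorm s (3 / 8) 1 h < ⊤ →
      freqNorm s b l (fun p => duhamelMap ξ σ g c f p - duhamelMap ξ σ g d h p) ≤
        C * ENNReal.ofReal (l ^ (b - 1 / 2)) * seqNorm s (fun k => ‖c k - d k‖ₑ) +
        C * ENNReal.ofReal (l ^ (b - 5 / 8)) *
          (1 + freqNorm s (3 / 8) 1 f + freqNorm s (3 / 8) 1 h) ^ 2 *
          freqNorm s (3 / 8) 1 (fun p => f p - h p) := by
  have hb1 : b < 1 := by linarith
  obtain ⟨C₁, hC₁, H₁⟩ := exists_freqNorm_freeOp_le hb1 hC₀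
  obtain ⟨C₂, hC₂, H₂⟩ := exists_freqNorm_duhamelOp_le hb hb1 hC₀
  obtain ⟨C₃, hC₃, H₃⟩ := exists_freqNorm_nonlin_sub_le ξ σ hs
  refine ⟨C₁ + C₂ * C₃, by finiteness, fun l hl g hg c d f h hf hh hfN hhN => ?_⟩
  have hl0 : 0 < l := by linarith
  have hnf := measurable_nonlin ξ σ hf
  have hnh := measurable_nonlin ξ σ hh
  have e : ∀ p, duhamelMap ξ σ g c f p - duhamelMap ξ σ g d h p =
      freeOp g (fun k => c k - d k) p +
        duhamelOp g (fun p => nonlin ξ σ f p - nonlin ξ σ h p) p := by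
    intro p
    have i1 := hg.integrable_duhamelKernel_mul hb hC₀ hl0 hnf
      (freqNorm_nonlin_lt_top ξ σ hs hb2 hl hf hfN) p
    have i2 := hg.integrable_duhamelKernel_mul hb hC₀ hl0 hnh
      (freqNorm_nonlin_lt_top ξ σ hs hb2 hl hh hhN) p
    have : duhamelOp g (fun p => nonlin ξ σ f p - nonlin ξ σ h p) p =
        duhamelOp g (nonlin ξ σ f) p - duhamelOp g (nonlin ξ σ h) p := by
      unfold duhamelOp
      rw [← integral_sub i1 i2]
      simp only [mul_sub]
    rw [this, duhamelMap, duhamelMap, freeOp, freeOp, freeOp]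
    ring
  simp_rw [e]
  have hsub : Measurable fun p => nonlin ξ σ f p - nonlin ξ σ h p := hnf.sub hnh
  refine (freqNorm_add_le (measurable_freeOp hg.measurable _)
    (measurable_duhamelOp hg.measurable hsub)).trans (add_le_add ?_ ?_)
  · refine (H₁ s l hl0 g hg _).trans ?_
    exact mul_le_mul' (mul_le_mul' le_self_add le_rfl) le_rfl
  · calc _ ≤ C₂ * freqNorm s (b - 1) l (fun p => nonlin ξ σ f p - nonlin ξ σ h p) :=
          H₂ s l hl0 g hg _ hsub
      _ ≤ C₂ * (ENNReal.ofReal (l ^ (b - 5 / 8)) * (C₃ *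
          (1 + freqNorm s (3 / 8) 1 f + freqNorm s (3 / 8) 1 h) ^ 2 *
          freqNorm s (3 / 8) 1 (fun p => f p - h p))) := by
          refine mul_le_mul' le_rfl ((freqNorm_le_mul hsub (ewt_le_of_le_of_nonpos
            (a := -(3 / 8)) (by linarith) (by norm_num) hl)).trans ?_)
          refine mul_le_mul' (le_of_eq ?_) (H₃ f h hf hh hfN hhN)
          congr 2; ring
      _ = (C₂ * C₃) * ENNReal.ofReal (l ^ (b - 5 / 8)) *
          (1 + freqNorm s (3 / 8) 1 f + freqNorm s (3 / 8) 1 h) ^ 2 *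
          freqNorm s (3 / 8) 1 (fun p => f p - h p) := by ring
      _ ≤ _ := mul_le_mul' (mul_le_mul' (mul_le_mul' le_add_self le_rfl) le_rfl) le_rfl

theorem freeOp_zero (g : ℝ → ℂ) : freeOp g (fun _ => 0) = fun _ => 0 := by
  funext p; simp [freeOp]

theorem duhamelMap_zero (ξ σ : ℝ) (g : ℝ → ℂ) :
    duhamelMap ξ σ g (fun _ => 0) (fun _ => 0) = fun _ => 0 := by
  funext p
  rw [duhamelMap, nonlin_zero, freeOp_zero]
  simp [duhamelOp]

theorem exists_ofReal_rpow_neg_mul_le {a : ℝ} (ha : 0 < a) {C : ℝ≥0∞} (hC : C ≠ ⊤) {ε : ℝ≥0∞}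
    (hε : 0 < ε) : ∃ l₀ : ℝ, 1 ≤ l₀ ∧ ∀ l, l₀ ≤ l → C * ENNReal.ofReal (l ^ (-a)) ≤ ε := by
  have h1 : Tendsto (fun l : ℝ => C * ENNReal.ofReal (l ^ (-a))) atTop (𝓝 (C * ENNReal.ofReal 0)) :=
    ENNReal.Tendsto.const_mul (ENNReal.tendsto_ofReal (tendsto_rpow_neg_atTop ha)) (Or.inr hC)
  rw [ENNReal.ofReal_zero, mul_zero] at h1
  obtain ⟨l₀, h⟩ := ((h1.eventually_le_const hε).and (eventually_ge_atTop 1)).exists_forall_of_atTop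
  exact ⟨l₀, (h l₀ le_rfl).2, fun l hl => (h l hl).1⟩

/-- For large `l` the map is a contraction. -/
theorem exists_contraction (ξ σ : ℝ) {s b C₀ : ℝ} (hs : 0 ≤ s) (hb : 1 / 2 < b)
    (hb2 : b ≤ 5 / 8) (hC₀ : 0 < C₀) : ∃ C : ℝ≥0∞, C ≠ ⊤ ∧ ∀ A M : ℝ≥0∞, A ≠ ⊤ → M ≠ ⊤ →
    ∃ l₀ : ℝ, 1 ≤ l₀ ∧ ∀ l, l₀ ≤ l → ∀ g, IsCutoff C₀ l g → ∀ (c : ℤ → ℂ) (f : ℤ × ℝ → ℂ),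
      seqNorm s (fun k => ‖c k‖ₑ) ≤ A → Measurable f → freqNorm s (3 / 8) 1 f ≤ M →
      freqNorm s b l (duhamelMap ξ σ g c f) ≤ ENNReal.ofReal (l ^ (b - 3 / 8)) ∧
      ∀ (d : ℤ → ℂ) (h : ℤ × ℝ → ℂ), Measurable h → freqNorm s (3 / 8) 1 h ≤ M →
        freqNorm s b l (fun p => duhamelMap ξ σ g c f p - duhamelMap ξ σ g d h p) ≤
          C * ENNReal.ofReal (l ^ (b - 1 / 2)) * seqNorm s (fun k => ‖c k - d k‖ₑ) +
          2⁻¹ * ENNReal.ofReal (l ^ (b - 3 / 8)) * freqNorm s (3 / 8) 1 (fun p => f p - h p) := by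
  obtain ⟨C, hC, H⟩ := exists_freqNorm_duhamelMap_sub_le ξ σ hs hb hb2 hC₀
  refine ⟨C, hC, fun A M hA hM => ?_⟩
  -- Relative to the radius `l^(b-3/8)`, the datum term carries `l^(-1/8)` and the nonlinear term
  -- `l^(-1/4)`; `l₁` and `l₂` make each at most one half. The factor `1 + M` lets the same choice
  -- serve the bound on the size and the Lipschitz bound.
  obtain ⟨l₁, hl₁, h₁⟩ := exists_ofReal_rpow_neg_mul_le (a := 1 / 8) (by norm_num)
    (C := C * A) (by finiteness) (ε := 2⁻¹) (by simp)
  obtain ⟨l₂, hl₂, h₂⟩ := exists_ofReal_rpow_neg_mul_le (a := 1 / 4) (by norm_num)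
    (C := C * (1 + M + M) ^ 2 * (1 + M)) (by finiteness) (ε := 2⁻¹) (by simp)
  refine ⟨max l₁ l₂, hl₁.trans (le_max_left _ _), fun l hl g hg c f hc hf hfM => ?_⟩
  have hl1 : 1 ≤ l := hl₁.trans ((le_max_left _ _).trans hl)
  have hl0 : 0 < l := by linarith
  have k₁ := h₁ l ((le_max_left _ _).trans hl)
  have k₂ := h₂ l ((le_max_right _ _).trans hl)
  have hfN : freqNorm s (3 / 8) 1 f < ⊤ := hfM.trans_lt hM.lt_top
  have e1 : ENNReal.ofReal (l ^ (b - 1 / 2)) =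
      ENNReal.ofReal (l ^ (-(1 / 8) : ℝ)) * ENNReal.ofReal (l ^ (b - 3 / 8)) := by
    rw [← ENNReal.ofReal_mul (by positivity), ← Real.rpow_add hl0]; congr 2; ring
  have e2 : ENNReal.ofReal (l ^ (b - 5 / 8)) =
      ENNReal.ofReal (l ^ (-(1 / 4) : ℝ)) * ENNReal.ofReal (l ^ (b - 3 / 8)) := by
    rw [← ENNReal.ofReal_mul (by positivity), ← Real.rpow_add hl0]; congr 2; ring
  constructor
  · have h := H l hl1 g hg c (fun _ => 0) f (fun _ => 0) hf measurable_const hfN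
      (by rw [freqNorm_zero]; simp)
    simp only [duhamelMap_zero, sub_zero, freqNorm_zero, add_zero] at h
    refine h.trans ?_
    rw [e1, e2]
    calc _ ≤ C * (ENNReal.ofReal (l ^ (-(1 / 8) : ℝ)) * ENNReal.ofReal (l ^ (b - 3 / 8))) * A +
          C * (ENNReal.ofReal (l ^ (-(1 / 4) : ℝ)) * ENNReal.ofReal (l ^ (b - 3 / 8))) *
            (1 + M + M) ^ 2 * (1 + M) := by
          refine add_le_add (mul_le_mul' le_rfl hc) (mul_le_mul' (mul_le_mul' le_rfl ?_) ?_)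
          · exact pow_le_pow_left' ((add_le_add le_rfl hfM).trans le_self_add) 2
          · exact hfM.trans le_add_self
      _ = (C * A * ENNReal.ofReal (l ^ (-(1 / 8) : ℝ)) +
          C * (1 + M + M) ^ 2 * (1 + M) * ENNReal.ofReal (l ^ (-(1 / 4) : ℝ))) *
          ENNReal.ofReal (l ^ (b - 3 / 8)) := by ring
      _ ≤ (2⁻¹ + 2⁻¹) * ENNReal.ofReal (l ^ (b - 3 / 8)) :=
          mul_le_mul' (add_le_add k₁ k₂) le_rfl
      _ = _ := by rw [ENNReal.inv_two_add_inv_two, one_mul]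
  · intro d h hh hhM
    refine (H l hl1 g hg c d f h hf hh hfN (hhM.trans_lt hM.lt_top)).trans ?_
    refine add_le_add le_rfl (mul_le_mul' ?_ le_rfl)
    rw [e2]
    calc _ ≤ C * (ENNReal.ofReal (l ^ (-(1 / 4) : ℝ)) * ENNReal.ofReal (l ^ (b - 3 / 8))) *
            (1 + M + M) ^ 2 * (1 + M) := by
          refine (mul_le_mul' le_rfl (pow_le_pow_left' (add_le_add (add_le_add le_rfl hfM) hhM) 2)
            ).trans ?_
          exact le_mul_of_one_le_right' le_self_add
      _ = C * (1 + M + M) ^ 2 * (1 + M) * ENNReal.ofReal (l ^ (-(1 / 4) : ℝ)) *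
          ENNReal.ofReal (l ^ (b - 3 / 8)) := by ring
      _ ≤ _ := mul_le_mul' k₂ le_rfl

/-- The ball of radius `l^(b-3/8)` is sent into the unit ball of the norm of order `3/8`, whatever
`l` is; this explains the radius in the contraction argument. -/
theorem freqNorm_three_eighths_le {s b l : ℝ} (hb : 1 / 2 < b) (hl : 1 ≤ l) {f : ℤ × ℝ → ℂ}
    (hf : Measurable f) :
    freqNorm s (3 / 8) 1 f ≤ ENNReal.ofReal (l ^ (3 / 8 - b)) * freqNorm s b l f :=
  freqNorm_le_mul hf (ewt_le_of_le_of_nonneg (by linarith) (by norm_num) hl)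

theorem seqNorm_zero_sq (c : ℤ → ℝ≥0∞) : seqNorm 0 c ^ 2 = ∑' k, c k ^ 2 := by
  rw [seqNorm_sq]; simp

theorem Admissible.of_freqNorm_lt_top {b l : ℝ} (hb : 1 / 2 < b) (hl : 1 ≤ l) {f : ℤ × ℝ → ℂ}
    (hf : Measurable f) (h : freqNorm 0 b l f < ⊤) : Admissible f := by
  refine ⟨hf, ?_, ?_⟩
  · rw [← seqNorm_zero_sq]
    refine ENNReal.pow_lt_top ((seqNorm_lintegral_le (s := 0) (b := b) (by linarith) hf).trans_lt ?_)
    have := bracketIntegral_ne_top (a := 2 * b) (by linarith)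
    have := h.ne
    finiteness
  · refine (freqNorm_three_eighths_le hb hl hf).trans_lt ?_
    have := h.ne
    finiteness

/-! ### The fixed point map as the Duhamel formula. -/

theorem schrodingerSymbol_eq (t : ℝ) (k : ℤ) : schrodingerSymbol t k = wave (-(k : ℝ) ^ 2) t := by
  rw [schrodingerSymbol, wave]; congr 1; push_cast; ring

/-- The map `duhamelMap` is the Duhamel formula on the frequency side. -/
theorem coeffAt_duhamelMap (ξ σ : ℝ) {s b C l : ℝ} (hs : 0 ≤ s) (hb : 1 / 2 < b) (hb2 : b ≤ 5 / 8)
    {g : ℝ → ℂ} (hg : IsCutoff C l g) (hC : 0 < C) (hl : 1 ≤ l) {c : ℤ → ℂ} {f : ℤ × ℝ → ℂ}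
    (hf : Admissible f) (hfs : freqNorm s (3 / 8) 1 f < ⊤) {u : ℝ → L2T} {t : ℝ}
    (ht : |t| ≤ 1 / l) (hu : RepresentsOn f u (uIoc 0 t)) (k : ℤ) :
    coeffAt (duhamelMap ξ σ g c f) t k = schrodingerSymbol t k * c k +
      ∫ τ in (0 : ℝ)..t, schrodingerSymbol (t - τ) k *
        ((ξ : ℂ) * spaceFT (u τ) k - ((σ : ℂ) + Complex.I) * spaceFT (cubic (u τ)) k) := by
  have hl0 : 0 < l := by linarith
  have hfm := hf.measurable
  have hn := measurable_nonlin ξ σ hfm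
  have hnfin := freqNorm_nonlin_lt_top ξ σ hs hb2 hl hfm hfs
  have hK : Measurable fun τ : ℝ => timeInt (τ + (k : ℝ) ^ 2) t :=
    (continuous_timeInt.comp (f := fun τ : ℝ => (τ + (k : ℝ) ^ 2, t)) (by fun_prop)).measurable
  have hcubicI : Integrable fun τ => cubicFT f (k, τ) * timeInt (τ + (k : ℝ) ^ 2) t := by
    have hc := measurable_cubicFT hfm
    refine ⟨((by fun_prop : Measurable fun τ => cubicFT f (k, τ)).mul hK).aestronglyMeasurable, ?_⟩
    refine lt_of_le_of_lt (lintegral_mono fun τ => ?_) (hf.lintegral_timeInt_lt_top t k)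
    rw [enorm_mul]
    exact mul_le_mul' (enorm_cubicFT_le hfm _) le_rfl
  have hlinI : Integrable fun τ => f (k, τ) * timeInt (τ + (k : ℝ) ^ 2) t :=
    (hf.integrable_slice k).mul_bdd (c := |t|) hK.aestronglyMeasurable
      (Eventually.of_forall fun τ => norm_timeInt_le_abs _ _)
  have hfree : Integrable fun τ => freeOp g c (k, τ) * wave τ t := by
    refine integrable_mul_wave ?_ t
    exact ((hg.integrable hC hl0).comp_add_right ((k : ℝ) ^ 2)).mul_const (c k)
  have hduh : Integrable fun τ => duhamelOp g (nonlin ξ σ f) (k, τ) * wave τ t := by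
    refine integrable_mul_wave ?_ t
    obtain ⟨C₂, hC₂, H₂⟩ := exists_freqNorm_duhamelOp_le hb (by linarith) hC
    have hadm : Admissible (duhamelOp g (nonlin ξ σ f)) := by
      refine Admissible.of_freqNorm_lt_top hb hl (measurable_duhamelOp hg.measurable hn) ?_
      refine (H₂ 0 l hl0 g hg _ hn).trans_lt ?_
      have := hnfin.ne
      finiteness
    exact hadm.integrable_slice k
  have h1 : coeffAt (duhamelMap ξ σ g c f) t k =
      coeffAt (freeOp g c) t k + coeffAt (duhamelOp g (nonlin ξ σ f)) t k := by
    unfold coeffAt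
    rw [← integral_add hfree hduh]
    simp only [duhamelMap, add_mul]
  rw [h1, coeffAt_freeOp hg c ht, coeffAt_duhamelOp hb hg hC hl0 hn hnfin ht,
    schrodingerSymbol_eq]
  congr 1
  have hcub := hf.integral_wave_cubic hu k
  have hlin : ∫ x in (0 : ℝ)..t, wave ((k : ℝ) ^ 2) x * spaceFT (u x) k =
      ∫ τ, f (k, τ) * timeInt (τ + (k : ℝ) ^ 2) t := by
    have e1 : ∀ τ, timeInt (τ + (k : ℝ) ^ 2) t =
        ∫ x in (0 : ℝ)..t, wave τ x * wave ((k : ℝ) ^ 2) x := fun τ => by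
      simp_rw [timeInt, wave_add_left]
    simp_rw [e1]
    rw [integral_mul_intervalIntegral_wave (hf.integrable_slice k)
      (w := fun x => wave ((k : ℝ) ^ 2) x) (by fun_prop),
      intervalIntegral.intervalIntegral_eq_integral_uIoc,
      intervalIntegral.intervalIntegral_eq_integral_uIoc]
    congr 1
    refine integral_congr_ae (Eventually.mono hu fun x hx => ?_)
    simp only
    rw [hx, mul_comm]
    rfl
  have hU : IntegrableOn (fun x => spaceFT (u x) k) (uIoc 0 t) := by
    have hc : IntegrableOn (fun x => coeffAt f x k) (uIoc 0 t) :=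
      ((continuous_coeffAt (hf.integrable_slice k)).intervalIntegrable 0 t).def'
    exact hc.congr (Eventually.mono hu fun x hx => (hx k).symm)
  have hV := hf.integrableOn_cubic hu (by simp) k
  have hw : ∀ {F : ℝ → ℂ}, IntegrableOn F (uIoc 0 t) →
      IntervalIntegrable (fun x => wave ((k : ℝ) ^ 2) x * F x) volume 0 t := fun hF => by
    rw [intervalIntegrable_iff]
    exact hF.bdd_mul (c := 1)
      (by fun_prop : Continuous fun x => wave ((k : ℝ) ^ 2) x).aestronglyMeasurable
      (Eventually.of_forall fun x => (norm_wave _ _).le)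
  -- The factorization `S(t - x) = S(t) S(-x)` takes `S(t)` out of the integral and leaves the time
  -- integrals against `wave (k²)` computed before.
  have h2 : ∀ x, schrodingerSymbol (t - x) k *
        ((ξ : ℂ) * spaceFT (u x) k - ((σ : ℂ) + Complex.I) * spaceFT (cubic (u x)) k) =
      wave (-(k : ℝ) ^ 2) t * ((ξ : ℂ) * (wave ((k : ℝ) ^ 2) x * spaceFT (u x) k) -
        ((σ : ℂ) + Complex.I) * (wave ((k : ℝ) ^ 2) x * spaceFT (cubic (u x)) k)) := fun x => by
    have : wave (-(k : ℝ) ^ 2) (t - x) = wave (-(k : ℝ) ^ 2) t * wave ((k : ℝ) ^ 2) x := by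
      rw [sub_eq_add_neg t x, wave_add_right]
      congr 1
      unfold wave; congr 3; ring
    rw [schrodingerSymbol_eq, this]; ring
  simp_rw [h2]
  rw [intervalIntegral.integral_const_mul, intervalIntegral.integral_sub ((hw hU).const_mul _)
    ((hw hV).const_mul _), intervalIntegral.integral_const_mul,
    intervalIntegral.integral_const_mul, hlin, hcub]
  congr 1
  rw [← integral_const_mul, ← integral_const_mul, ← integral_const_mul,
    ← integral_sub (hlinI.const_mul _) ((hcubicI.const_mul _).const_mul _)]
  refine integral_congr_ae (Eventually.of_forall fun τ => ?_)
  simp only [nonlin]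
  ring

/-! ### Fixed points and their realization in physical space. -/

theorem freqNorm_congr_ae {s b l : ℝ} {f g : ℤ × ℝ → ℂ} (h : f =ᵐ[freqMeasure] g) :
    freqNorm s b l f = freqNorm s b l g :=
  l2_congr_ae (h.mono fun p hp => by simp only [hp])

theorem eLpNorm_two_eq_l2 {α : Type*} [MeasurableSpace α] (μ : Measure α) (φ : α → ℂ) :
    eLpNorm φ 2 μ = l2 μ fun x => ‖φ x‖ₑ := by
  rw [eLpNorm_eq_lintegral_rpow_enorm_toReal two_ne_zero ENNReal.ofNat_ne_top, l2]
  simp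

theorem ewt_eq_enorm {s b l : ℝ} (hl : 0 < l) (p : ℤ × ℝ) :
    ewt s b l p = ‖((wt s b l p : ℝ) : ℂ)‖ₑ := by
  rw [← ofReal_norm, Complex.norm_real, Real.norm_of_nonneg (wt_pos hl p).le, ewt]

/-- Banach's fixed point theorem in a ball of the weighted space. -/
theorem exists_fixedPoint_freqNorm {s b l : ℝ} (hl : 0 < l) {Ψ : (ℤ × ℝ → ℂ) → ℤ × ℝ → ℂ}
    (hm : ∀ f, Measurable f → Measurable (Ψ f)) {R : ℝ≥0∞} (hR : R ≠ ⊤)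
    (hmap : ∀ f, Measurable f → freqNorm s b l f ≤ R → freqNorm s b l (Ψ f) ≤ R)
    (hc : ∀ f h, Measurable f → Measurable h → freqNorm s b l f ≤ R → freqNorm s b l h ≤ R →
      freqNorm s b l (fun p => Ψ f p - Ψ h p) ≤ 2⁻¹ * freqNorm s b l (fun p => f p - h p)) :
    ∃ f, Measurable f ∧ freqNorm s b l f ≤ R ∧ Ψ f =ᵐ[freqMeasure] f := by
  -- Multiplication by `W` identifies the weighted space with `L²`, which is complete; `dec` divides
  -- by `W` and yields measurable representatives. The map `T` below has the default value zero
  -- where the image is not in `L²`, which does not occur on the ball `S`.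
  set W : ℤ × ℝ → ℂ := fun p => ((wt s b l p : ℝ) : ℂ) with hW
  have hWm : Measurable W := by fun_prop
  have hW0 : ∀ p, W p ≠ 0 := fun p => by
    simp only [hW]; exact_mod_cast (wt_pos hl p).ne'
  have hfreq : ∀ f : ℤ × ℝ → ℂ, freqNorm s b l f = eLpNorm (fun p => W p * f p) 2 freqMeasure :=
    fun f => by
      rw [eLpNorm_two_eq_l2, freqNorm]
      simp only [enorm_mul, ewt_eq_enorm hl, hW]
  have hmem : ∀ f : ℤ × ℝ → ℂ, Measurable f → freqNorm s b l f ≤ R →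
      MemLp (fun p => W p * f p) 2 freqMeasure := fun f hf hfR =>
    ⟨(hWm.mul hf).aestronglyMeasurable, by rw [← hfreq]; exact hfR.trans_lt hR.lt_top⟩
  set dec : Lp ℂ 2 freqMeasure → ℤ × ℝ → ℂ := fun φ p => φ p / W p with hdec
  have hdecm : ∀ φ, Measurable (dec φ) := fun φ =>
    (Lp.stronglyMeasurable φ).measurable.div hWm
  have hWdec : ∀ φ : Lp ℂ 2 freqMeasure, ∀ p, W p * dec φ p = φ p := fun φ p =>
    mul_div_cancel₀ _ (hW0 p)
  have hdecN : ∀ φ : Lp ℂ 2 freqMeasure, freqNorm s b l (dec φ) = edist φ 0 := fun φ => by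
    rw [hfreq, edist_zero_right, Lp.enorm_def]
    simp only [hWdec]
  have hdecS : ∀ φ ψ : Lp ℂ 2 freqMeasure,
      freqNorm s b l (fun p => dec φ p - dec ψ p) = edist φ ψ := fun φ ψ => by
    rw [hfreq, Lp.edist_def]
    congr 1
    funext p
    rw [mul_sub, hWdec, hWdec, Pi.sub_apply]
  set S : Set (Lp ℂ 2 freqMeasure) := {φ | edist φ 0 ≤ R} with hS
  have hSR : ∀ φ ∈ S, freqNorm s b l (dec φ) ≤ R := fun φ hφ => (hdecN φ).trans_le hφ
  have hSc : IsComplete S :=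
    (isClosed_le (continuous_id.edist continuous_const) continuous_const).isComplete
  classical
  set T : Lp ℂ 2 freqMeasure → Lp ℂ 2 freqMeasure := fun φ =>
    if h : MemLp (fun p => W p * Ψ (dec φ) p) 2 freqMeasure then h.toLp _ else 0 with hT
  have hTeq : ∀ φ ∈ S, dec (T φ) =ᵐ[freqMeasure] Ψ (dec φ) := fun φ hφ => by
    have h := hmem _ (hm _ (hdecm φ)) (hmap _ (hdecm φ) (hSR φ hφ))
    simp only [hT, dif_pos h]
    filter_upwards [h.coeFn_toLp] with p hp
    simp only [hdec]
    rw [hp, mul_div_cancel_left₀ _ (hW0 p)]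
  have hTS : MapsTo T S S := fun φ hφ => by
    change edist (T φ) 0 ≤ R
    rw [← hdecN, freqNorm_congr_ae (hTeq φ hφ)]
    exact hmap _ (hdecm φ) (hSR φ hφ)
  have hcontr : ContractingWith (2⁻¹ : NNReal) (hTS.restrict T S S) := by
    refine ⟨by rw [← NNReal.coe_lt_coe]; norm_num, fun φ ψ => ?_⟩
    change edist (T φ.1) (T ψ.1) ≤ _ * edist φ.1 ψ.1
    rw [← hdecS, ← hdecS]
    have e : (fun p => dec (T φ.1) p - dec (T ψ.1) p) =ᵐ[freqMeasure]
        fun p => Ψ (dec φ.1) p - Ψ (dec ψ.1) p := by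
      filter_upwards [hTeq _ φ.2, hTeq _ ψ.2] with p h1 h2
      rw [h1, h2]
    rw [freqNorm_congr_ae e]
    refine (hc _ _ (hdecm _) (hdecm _) (hSR _ φ.2) (hSR _ ψ.2)).trans (le_of_eq ?_)
    simp
  have h0 : (0 : Lp ℂ 2 freqMeasure) ∈ S := by simp [hS]
  obtain ⟨φ, hφ, hfix, -⟩ := hcontr.exists_fixedPoint' hSc hTS h0 (edist_ne_top _ _)
  refine ⟨dec φ, hdecm φ, hSR φ hφ, ?_⟩
  have := hTeq φ hφ
  rw [hfix] at this
  exact this.symm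

theorem coeffAt_congr_ae {f g : ℤ × ℝ → ℂ} (h : f =ᵐ[freqMeasure] g) (t : ℝ) (k : ℤ) :
    coeffAt f t k = coeffAt g t k := by
  have h1 := Measure.ae_ae_of_ae_prod h
  rw [Measure.ae_count_iff] at h1
  exact integral_congr_ae ((h1 k).mono fun τ hτ => by simp only [hτ])

theorem spaceFT_sub (f g : L2T) (k : ℤ) :
    spaceFT (f - g : L2T) k = spaceFT f k - spaceFT g k := by
  have hf : Integrable f haarT := (Lp.memLp f).integrable one_le_two
  have hg : Integrable g haarT := (Lp.memLp g).integrable one_le_two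
  have h1 : fourierCoeff (f - g : L2T) k = fourierCoeff (fun x => f x - g x) k := by
    unfold fourierCoeff
    refine integral_congr_ae ?_
    filter_upwards [Lp.coeFn_sub f g] with x hx
    rw [hx, Pi.sub_apply]
  have h2 : fourierCoeff (fun x => f x - g x) k = fourierCoeff f k - fourierCoeff g k := by
    unfold fourierCoeff
    simp only [smul_sub]
    refine integral_sub ?_ ?_
    · exact hf.bdd_mul (c := 1) (by fun_prop) (Eventually.of_forall fun x => by
        rw [fourier_apply, Circle.norm_coe])
    · exact hg.bdd_mul (c := 1) (by fun_prop) (Eventually.of_forall fun x => by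
        rw [fourier_apply, Circle.norm_coe])
  rw [spaceFT, h1, h2, spaceFT, spaceFT]
  ring

theorem hsNorm_eq_seqNorm (s : ℝ) (f : L2T) : hsNorm s f = seqNorm s fun k => ‖spaceFT f k‖ₑ := by
  rw [hsNorm, seqNorm, l2, lintegral_count]
  congr 1
  refine tsum_congr fun k => ?_
  rw [ENNReal.ofReal_mul (Real.rpow_nonneg (bracket_pos _).le _), ofReal_norm]

/-- The coefficients are bounded by the slice integrals, which are square-summable and do not depend
on time. Hence there is a function at every time, not only at almost every one. -/
theorem Admissible.exists_realization {f : ℤ × ℝ → ℂ} (hf : Admissible f) :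
    ∃ u : ℝ → L2T, ∀ t k, spaceFT (u t) k = coeffAt f t k := by
  have h : ∀ t, ∃ g : L2T, ∀ k, spaceFT g k = coeffAt f t k := by
    intro t
    have h1 : ∑' k, ‖(2 * (Real.pi : ℂ))⁻¹ * coeffAt f t k‖ₑ ^ 2 ≠ ⊤ := by
      simp_rw [enorm_mul, mul_pow]
      rw [ENNReal.tsum_mul_left]
      have h2 : ∑' k, ‖coeffAt f t k‖ₑ ^ 2 ≠ ⊤ := by
        refine ne_top_of_le_ne_top hf.tsum_lt_top.ne (ENNReal.tsum_le_tsum fun k => ?_)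
        exact pow_le_pow_left' (enorm_coeffAt_le f t k) 2
      have : ‖(2 * (Real.pi : ℂ))⁻¹‖ₑ ≠ ⊤ := enorm_ne_top
      finiteness
    obtain ⟨g, hg⟩ := exists_fourierCoeff_eq h1
    refine ⟨g, fun k => ?_⟩
    rw [spaceFT, hg, mul_inv_cancel_left₀]
    simp [Real.pi_ne_zero]
  choose u hu using h
  exact ⟨u, hu⟩

section Realization

variable {s b l : ℝ} {f : ℤ × ℝ → ℂ} {u : ℝ → L2T}

theorem hsNorm_realization_le (hl : 0 < l) (hf : Measurable f)
    (hu : ∀ t k, spaceFT (u t) k = coeffAt f t k) (t : ℝ) :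
    hsNorm s (u t) ≤ ENNReal.ofReal (l ^ (1 / 2 - b)) * (bracketIntegral (2 * b)) ^ (1 / 2 : ℝ) *
      freqNorm s b l f := by
  rw [hsNorm_eq_seqNorm]
  refine (seqNorm_mono fun k => ?_).trans (seqNorm_lintegral_le hl hf)
  rw [hu]
  exact enorm_coeffAt_le f t k

/-- Each coefficient is continuous in time, and twice the slice integrals dominate all differences;
these have finite `H^s` norm because `b > 1/2`. Dominated convergence over `k` gives continuity in
norm. -/
theorem continuousInHs_realization (hs : 0 ≤ s) (hb : 1 / 2 < b) (hl : 1 ≤ l) (hf : Measurable f)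
    (hN : freqNorm s b l f < ⊤) (hu : ∀ t k, spaceFT (u t) k = coeffAt f t k) (δ : ℝ) :
    ContinuousInHs s δ u := by
  have hl0 : 0 < l := by linarith
  have hB := bracketIntegral_ne_top (a := 2 * b) (by linarith)
  have hN' := hN.ne
  have hadm : Admissible f := Admissible.of_freqNorm_lt_top hb hl hf
    ((freqNorm_mono_left hs hl0 f).trans_lt hN)
  refine ⟨fun t _ => ?_, fun t₀ _ => ?_⟩
  · refine (hsNorm_realization_le (b := b) hl0 hf hu t).trans_lt ?_
    finiteness
  · have h1 : Tendsto (fun t => ∫⁻ k : ℤ, (ENNReal.ofReal (bracket k ^ s) *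
        ‖coeffAt f t k - coeffAt f t₀ k‖ₑ) ^ 2 ∂Measure.count) (𝓝[Icc (-δ) δ] t₀)
        (𝓝 (∫⁻ k : ℤ, 0 ∂Measure.count)) := by
      refine tendsto_lintegral_filter_of_dominated_convergence
        (fun k : ℤ => (ENNReal.ofReal (bracket k ^ s) *
          (2 * ∫⁻ τ, ‖f (k, τ)‖ₑ)) ^ 2) (Eventually.of_forall fun t => measurable_from_top)
        (Eventually.of_forall fun t => Eventually.of_forall fun k => ?_) ?_
        (Eventually.of_forall fun k => ?_)
      · refine pow_le_pow_left' (mul_le_mul' le_rfl (enorm_sub_le.trans ?_)) 2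
        rw [two_mul]
        exact add_le_add (enorm_coeffAt_le f t k) (enorm_coeffAt_le f t₀ k)
      · have e : ∀ k : ℤ, (ENNReal.ofReal (bracket k ^ s) * (2 * ∫⁻ τ, ‖f (k, τ)‖ₑ)) ^ 2 =
            4 * (ENNReal.ofReal (bracket k ^ s) * ∫⁻ τ, ‖f (k, τ)‖ₑ) ^ 2 := fun k => by ring
        simp_rw [e]
        rw [lintegral_const_mul _ measurable_from_top, lintegral_count, ← seqNorm_sq]
        have h2 : seqNorm s (fun k => ∫⁻ τ, ‖f (k, τ)‖ₑ) ≠ ⊤ :=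
          ne_top_of_le_ne_top (by finiteness) (seqNorm_lintegral_le (b := b) hl0 hf)
        finiteness
      · have h2 : Tendsto (fun t => ‖coeffAt f t k - coeffAt f t₀ k‖ₑ) (𝓝 t₀) (𝓝 0) := by
          have hc := (continuous_coeffAt (hadm.integrable_slice k)).tendsto t₀
          have := (hc.sub_const (coeffAt f t₀ k)).enorm
          simpa using this
        have h3 := (ENNReal.Tendsto.pow (n := 2) (ENNReal.Tendsto.const_mul
          (a := ENNReal.ofReal (bracket k ^ s)) h2 (Or.inr ENNReal.ofReal_ne_top))).mono_left (nhdsWithin_le_nhds (s := Icc (-δ) δ))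
        simpa using h3
    have h2 := ((ENNReal.continuous_rpow_const (y := (1 / 2 : ℝ))).tendsto _).comp h1
    have e : ∀ t, hsNorm s (u t - u t₀) = (∫⁻ k : ℤ, (ENNReal.ofReal (bracket k ^ s) *
        ‖coeffAt f t k - coeffAt f t₀ k‖ₑ) ^ 2 ∂Measure.count) ^ (1 / 2 : ℝ) := fun t => by
      rw [hsNorm_eq_seqNorm, seqNorm, l2]
      simp_rw [spaceFT_sub, hu]
    simp_rw [e]
    simpa [Function.comp_def] using h2

theorem memLp_slice {f : ℤ × ℝ → ℂ} (hb : 0 ≤ b) (hs : 0 ≤ s) (hl : 1 ≤ l) (hf : Measurable f)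
    (hN : freqNorm s b l f < ⊤) (k : ℤ) : MemLp (fun τ => f (k, τ)) 2 volume := by
  have hm : Measurable fun τ => f (k, τ) := by fun_prop
  rw [memLp_two_iff_lintegral hm.aestronglyMeasurable, ← l2_sq]
  refine ENNReal.pow_lt_top ((l2_slice_le (F := fun r => ‖f r‖ₑ) (by fun_prop) k).trans_lt ?_)
  refine lt_of_le_of_lt (l2_mono fun p => ?_) hN
  refine le_mul_of_one_le_left' ?_
  rw [ewt, ENNReal.one_le_ofReal, wt]
  exact one_le_mul_of_one_le_of_one_le (Real.one_le_rpow (one_le_bracket _) hs)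
    (Real.one_le_rpow (by linarith [abs_nonneg (modulation p)]) hb)

theorem bracket_le (x : ℝ) : bracket x ≤ 1 + |x| := by
  rw [bracket, Real.sqrt_le_left (by positivity)]
  nlinarith [abs_nonneg x, sq_abs x]

/-- Because `l ≥ 1`, the weight with parameter `l` dominates the bracket of the modulation; the
factor `2π` comes from `û = 2π f`. -/
theorem xNorm_realization_le (hs : 0 ≤ s) (hb : 1 / 2 < b) (hl : 1 ≤ l) (hf : Measurable f)
    (hN : freqNorm s b l f < ⊤) (hu : ∀ t k, spaceFT (u t) k = coeffAt f t k) :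
    xNorm s b u ≤ ENNReal.ofReal (2 * Real.pi) * freqNorm s b l f := by
  have hl0 : 0 < l := by linarith
  have hadm : Admissible f := Admissible.of_freqNorm_lt_top hb hl hf
    ((freqNorm_mono_left hs hl0 f).trans_lt hN)
  have hmem := memLp_slice (by linarith) hs hl hf hN
  have e : ∀ k, (fun t => spaceFT (u t) k) = fun t => ∫ τ, f (k, τ) * wave τ t := fun k => by
    funext t; rw [hu]; rfl
  have hm : ∀ k, MemLp (fun t => spaceFT (u t) k) 2 volume := fun k => by
    rw [e]; exact memLp_integral_wave (hadm.integrable_slice k) (hmem k)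
  rw [xNorm, if_pos hm]
  have h1 : ∀ k : ℤ, ∫⁻ τ : ℝ, ENNReal.ofReal
      (bracket k ^ s * bracket (τ + (k : ℝ) ^ 2) ^ b * ‖spaceTimeFT u k τ‖) ^ 2 ≤
      ∫⁻ τ : ℝ, (ENNReal.ofReal (2 * Real.pi) * (ewt s b l (k, τ) * ‖f (k, τ)‖ₑ)) ^ 2 := by
    intro k
    refine lintegral_mono_ae ?_
    have := timeFT_integral_wave (hadm.integrable_slice k) (hmem k)
    rw [← e k] at this
    filter_upwards [this] with τ hτ
    refine pow_le_pow_left' ?_ 2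
    rw [spaceTimeFT, hτ, ewt, ← ofReal_norm (f (k, τ)), ← ENNReal.ofReal_mul (wt_pos hl0 _).le,
      ← ENNReal.ofReal_mul (by positivity)]
    refine ENNReal.ofReal_le_ofReal ?_
    have e1 : ‖2 * (Real.pi : ℂ) * f (k, τ)‖ = 2 * Real.pi * ‖f (k, τ)‖ := by
      rw [norm_mul, norm_mul, Complex.norm_real, Real.norm_of_nonneg Real.pi_pos.le]; simp
    have e2 : bracket (τ + (k : ℝ) ^ 2) ^ b ≤ (l + |modulation (k, τ)|) ^ b := by
      refine Real.rpow_le_rpow (bracket_pos _).le ((bracket_le _).trans ?_) (by linarith)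
      exact add_le_add hl le_rfl
    rw [e1, wt]
    have e3 := Real.rpow_nonneg (bracket_pos k).le s
    calc bracket k ^ s * bracket (τ + (k : ℝ) ^ 2) ^ b * (2 * Real.pi * ‖f (k, τ)‖)
        ≤ bracket k ^ s * (l + |modulation (k, τ)|) ^ b * (2 * Real.pi * ‖f (k, τ)‖) := by
          refine mul_le_mul_of_nonneg_right (mul_le_mul_of_nonneg_left e2 e3) ?_
          have := Real.pi_pos
          positivity
      _ = _ := by ring
  calc _ ≤ (∑' k : ℤ, ∫⁻ τ : ℝ, (ENNReal.ofReal (2 * Real.pi) *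
        (ewt s b l (k, τ) * ‖f (k, τ)‖ₑ)) ^ 2) ^ (1 / 2 : ℝ) :=
        ENNReal.rpow_le_rpow (ENNReal.tsum_le_tsum h1) (by norm_num)
    _ = l2 freqMeasure (fun p => ENNReal.ofReal (2 * Real.pi) * (ewt s b l p * ‖f p‖ₑ)) := by
        rw [l2, lintegral_freqMeasure (by fun_prop)]
    _ = _ := by rw [l2_const_mul _ (by fun_prop), freqNorm]

theorem xNormRestr_le_xNorm (s b δ : ℝ) (u : ℝ → L2T) : xNormRestr s b δ u ≤ xNorm s b u :=
  iInf₂_le u (Eventually.of_forall fun _ => rfl)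

/-- A fixed point of `duhamelMap` is a solution. -/
theorem isSolution_realization (ξ σ : ℝ) {C : ℝ} (hs : 0 ≤ s) (hb : 1 / 2 < b) (hb2 : b ≤ 5 / 8)
    {g : ℝ → ℂ} (hg : IsCutoff C l g) (hC : 0 < C) (hl : 1 ≤ l) (u₀ : L2T) (hf : Measurable f)
    (hN : freqNorm s b l f < ⊤)
    (hfix : duhamelMap ξ σ g (fun k => spaceFT u₀ k) f =ᵐ[freqMeasure] f)
    (hu : ∀ t k, spaceFT (u t) k = coeffAt f t k) :
    IsSolution ξ σ s b (1 / l) u₀ u := by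
  have hl0 : 0 < l := by linarith
  have hadm : Admissible f := Admissible.of_freqNorm_lt_top hb hl hf
    ((freqNorm_mono_left hs hl0 f).trans_lt hN)
  have hN' := hN.ne
  have hrep : ∀ J, RepresentsOn f u J := fun J => Eventually.of_forall hu
  have hJ : volume (Icc (-(1 / l)) (1 / l)) ≠ ⊤ := by simp
  refine ⟨continuousInHs_realization hs hb hl hf hN hu _, ?_, ?_, ?_, ?_⟩
  · refine (xNormRestr_le_xNorm _ _ _ _).trans_lt
      ((xNorm_realization_le hs hb hl hf hN hu).trans_lt ?_)
    finiteness
  · exact hadm.lintegral_cubic_lt_top (hrep _) hJ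
  · intro k
    refine Integrable.sub (Integrable.const_mul ?_ _)
      (Integrable.const_mul (hadm.integrableOn_cubic (hrep _) hJ k) _)
    simp_rw [hu]
    exact (continuous_coeffAt (hadm.integrable_slice k)).integrableOn_Icc
  · intro t ht k
    have h3 : freqNorm s (3 / 8) 1 f < ⊤ := by
      refine (freqNorm_three_eighths_le hb hl hf).trans_lt ?_
      finiteness
    rw [hu, ← coeffAt_congr_ae hfix]
    exact coeffAt_duhamelMap ξ σ hs hb hb2 hg hC hl hadm h3 (abs_le.2 ht) (hrep _) k

end Realization

/-! ### Representatives of arbitrary solutions, and uniqueness. -/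

theorem le_seqNorm {s : ℝ} (hs : 0 ≤ s) (c : ℤ → ℝ≥0∞) (k : ℤ) : c k ≤ seqNorm s c := by
  refine le_of_sq_le_sq ?_
  rw [seqNorm_sq]
  refine le_trans ?_ (ENNReal.le_tsum k)
  refine pow_le_pow_left' (le_mul_of_one_le_left' ?_) 2
  rw [ENNReal.one_le_ofReal]
  exact Real.one_le_rpow (one_le_bracket _) hs

theorem L2T_ext {f g : L2T} (h : ∀ k, spaceFT f k = spaceFT g k) : f = g := by
  have h0 : ((f - g : L2T) : Torus → ℂ) =ᵐ[haarT] 0 := by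
    refine ae_eq_zero_of_fourierCoeff_eq_zero ((Lp.memLp (f - g)).integrable one_le_two) fun k => ?_
    have h1 := spaceFT_sub f g k
    rw [h k, sub_self, spaceFT] at h1
    exact (mul_eq_zero.1 h1).resolve_left (by simp [Real.pi_ne_zero])
  exact sub_eq_zero.1 ((Lp.eq_zero_iff_ae_eq_zero).2 h0)

theorem one_add_abs_le_two_mul_bracket (x : ℝ) : 1 + |x| ≤ 2 * bracket x := by
  have h1 := one_le_bracket x
  have h2 : |x| ≤ bracket x := Real.abs_le_sqrt (by linarith)
  linarith

theorem continuousOn_spaceFT {s δ : ℝ} (hs : 0 ≤ s) {v : ℝ → L2T} (hv : ContinuousInHs s δ v)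
    (k : ℤ) : ContinuousOn (fun t => spaceFT (v t) k) (Icc (-δ) δ) := by
  intro t₀ ht₀
  rw [ContinuousWithinAt, tendsto_iff_edist_tendsto_0]
  refine tendsto_of_tendsto_of_tendsto_of_le_of_le tendsto_const_nhds (hv.2 t₀ ht₀)
    (fun _ => zero_le) fun t => ?_
  simp only
  rw [edist_eq_enorm_sub, ← spaceFT_sub, hsNorm_eq_seqNorm]
  exact le_seqNorm hs (fun k => ‖spaceFT (v t - v t₀ : L2T) k‖ₑ) k

/-- A function in the Bourgain space has a representation by waves. -/
theorem exists_representative {s b δ : ℝ} (hs : 0 ≤ s) (hb : 1 / 2 < b) (hδ : 0 < δ) {v : ℝ → L2T}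
    (hv : ContinuousInHs s δ v) (hX : xNormRestr s b δ v < ⊤) :
    ∃ f : ℤ × ℝ → ℂ, Measurable f ∧ freqNorm 0 b 1 f < ⊤ ∧
      ∀ t ∈ Icc (-δ) δ, ∀ k, spaceFT (v t) k = coeffAt f t k := by
  simp only [xNormRestr, iInf_lt_iff] at hX
  obtain ⟨w, hw, hwX⟩ := hX
  rw [xNorm] at hwX
  split_ifs at hwX with hmem
  swap
  · simp at hwX
  set f : ℤ × ℝ → ℂ := fun p => (2 * Real.pi : ℂ)⁻¹ * timeFT (fun t => spaceFT (w t) p.1) p.2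
    with hf
  have hfm : Measurable f := by
    refine measurable_from_prod_countable_right fun k => ?_
    have := measurable_timeFT fun t => spaceFT (w t) k
    exact this.const_mul _
  have hfN : freqNorm 0 b 1 f < ⊤ := by
    refine (freqNorm_mono_left hs one_pos f).trans_lt ?_
    have hle : ∀ p, ewt s b 1 p * ‖f p‖ₑ ≤ ENNReal.ofReal (2 ^ b) *
        ENNReal.ofReal (bracket p.1 ^ s * bracket (p.2 + (p.1 : ℝ) ^ 2) ^ b *
          ‖spaceTimeFT w p.1 p.2‖) := by
      intro p
      have hp := Real.pi_gt_three
      rw [ewt, ← ofReal_norm (f p), ← ENNReal.ofReal_mul (wt_pos one_pos _).le,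
        ← ENNReal.ofReal_mul (by positivity)]
      refine ENNReal.ofReal_le_ofReal ?_
      have e1 : ‖f p‖ ≤ ‖spaceTimeFT w p.1 p.2‖ := by
        simp only [hf, norm_mul, norm_inv, Complex.norm_real, Real.norm_of_nonneg Real.pi_pos.le]
        refine mul_le_of_le_one_left (norm_nonneg _) (inv_le_one_of_one_le₀ ?_)
        simp; linarith
      have e2 : (1 + |modulation p|) ^ b ≤ 2 ^ b * bracket (p.2 + (p.1 : ℝ) ^ 2) ^ b := by
        rw [← Real.mul_rpow two_pos.le (bracket_pos _).le]
        exact Real.rpow_le_rpow (by positivity) (one_add_abs_le_two_mul_bracket _) (by linarith)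
      have e3 := Real.rpow_nonneg (bracket_pos p.1).le s
      have e4 := Real.rpow_nonneg (bracket_pos (p.2 + (p.1 : ℝ) ^ 2)).le b
      calc wt s b 1 p * ‖f p‖
          ≤ bracket p.1 ^ s * (2 ^ b * bracket (p.2 + (p.1 : ℝ) ^ 2) ^ b) *
              ‖spaceTimeFT w p.1 p.2‖ := by
            rw [wt]
            refine mul_le_mul (mul_le_mul_of_nonneg_left e2 e3) e1 (norm_nonneg _) (by positivity)
        _ = _ := by ring
    have hm : Measurable fun p : ℤ × ℝ => ENNReal.ofReal (bracket p.1 ^ s *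
        bracket (p.2 + (p.1 : ℝ) ^ 2) ^ b * ‖spaceTimeFT w p.1 p.2‖) := by
      refine measurable_from_prod_countable_right fun k => ?_
      have h1 : Measurable (spaceTimeFT w k) := measurable_timeFT fun t => spaceFT (w t) k
      have h2 : Measurable fun τ : ℝ => bracket (τ + (k : ℝ) ^ 2) := by
        unfold bracket; fun_prop
      have h3 : Measurable fun τ : ℝ => bracket k ^ s * bracket (τ + (k : ℝ) ^ 2) ^ b *
          ‖spaceTimeFT w k τ‖ := ((h2.pow_const b).const_mul _).mul h1.norm
      exact h3.ennreal_ofReal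
    refine (l2_mono hle).trans_lt ?_
    rw [l2_const_mul _ hm.aemeasurable]
    refine ENNReal.mul_lt_top ENNReal.ofReal_lt_top ?_
    rw [l2, lintegral_freqMeasure (hm.pow_const 2).aemeasurable]
    exact hwX
  refine ⟨f, hfm, hfN, fun t ht k => ?_⟩
  have hadm := Admissible.of_freqNorm_lt_top hb le_rfl hfm hfN
  have h1 : (fun t => spaceFT (w t) k) =ᵐ[volume] fun t => coeffAt f t k :=
    ae_eq_integral_wave (hmem k) (hadm.integrable_slice k)
  have h2 : (fun t => spaceFT (v t) k) =ᵐ[volume.restrict (Icc (-δ) δ)] fun t => coeffAt f t k := by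
    filter_upwards [hw, ae_restrict_of_ae h1] with t ht1 ht2
    rw [← ht1]; exact ht2
  -- Agreement at almost every time becomes agreement at every time of the interval, because both
  -- sides are continuous there.
  exact Measure.eqOn_Icc_of_ae_eq volume (by linarith) h2 (continuousOn_spaceFT hs hv k)
    (continuous_coeffAt (hadm.integrable_slice k)).continuousOn ht

/-- The Duhamel formula on a set of times, with the sequence `c` of initial Fourier
coefficients. -/
def DuhamelOn (ξ σ : ℝ) (c : ℤ → ℂ) (u : ℝ → L2T) (J : Set ℝ) : Prop :=
  ∀ t ∈ J, ∀ k, spaceFT (u t) k = schrodingerSymbol t k * c k +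
    ∫ τ in (0 : ℝ)..t, schrodingerSymbol (t - τ) k *
      ((ξ : ℂ) * spaceFT (u τ) k - ((σ : ℂ) + Complex.I) * spaceFT (cubic (u τ)) k)

/-- At time `t` the Duhamel formula sees only the times between `0` and `t`, where `f` represents
the solution. So the image of `f` is again a representative on `J`, although `f`, being arbitrary
outside `J`, need not be a fixed point. -/
theorem DuhamelOn.coeffAt_duhamelMap_eq {ξ σ b C l : ℝ} (hb : 1 / 2 < b) (hb2 : b ≤ 5 / 8)
    {g : ℝ → ℂ} (hg : IsCutoff C l g) (hC : 0 < C) (hl : 1 ≤ l) {c : ℤ → ℂ} {f : ℤ × ℝ → ℂ}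
    (hf : Admissible f) {u : ℝ → L2T} {J : Set ℝ} (hJ : J.OrdConnected) (h0 : 0 ∈ J)
    (hJl : ∀ t ∈ J, |t| ≤ 1 / l) (hu : ∀ t ∈ J, ∀ k, spaceFT (u t) k = coeffAt f t k)
    (hD : DuhamelOn ξ σ c u J) :
    ∀ t ∈ J, ∀ k, spaceFT (u t) k = coeffAt (duhamelMap ξ σ g c f) t k := by
  intro t ht k
  have hsub : uIoc 0 t ⊆ J := uIoc_subset_uIcc.trans (hJ.uIcc_subset h0 ht)
  have hrep : RepresentsOn f u (uIoc 0 t) :=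
    (ae_restrict_iff' measurableSet_uIoc).2 (Eventually.of_forall fun x hx => hu x (hsub hx))
  rw [hD t ht k, coeffAt_duhamelMap ξ σ le_rfl hb hb2 hg hC hl hf hf.freqNorm_lt_top (hJl t ht)
    hrep]

theorem enorm_coeffAt_sub_le {b l : ℝ} (hl : 0 < l) {f h : ℤ × ℝ → ℂ} (hf : Admissible f)
    (hh : Admissible h) (t : ℝ) (k : ℤ) :
    ‖coeffAt f t k - coeffAt h t k‖ₑ ≤ ENNReal.ofReal (l ^ (1 / 2 - b)) *
      (bracketIntegral (2 * b)) ^ (1 / 2 : ℝ) * freqNorm 0 b l (fun p => f p - h p) := by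
  have e : coeffAt f t k - coeffAt h t k = coeffAt (fun p => f p - h p) t k := by
    unfold coeffAt
    rw [← integral_sub (integrable_mul_wave (hf.integrable_slice k) t)
      (integrable_mul_wave (hh.integrable_slice k) t)]
    simp only [sub_mul]
  rw [e]
  refine (enorm_coeffAt_le _ t k).trans ?_
  refine le_trans ?_ (seqNorm_lintegral_le hl (hf.measurable.sub hh.measurable))
  exact le_seqNorm le_rfl (fun k => ∫⁻ τ, ‖f (k, τ) - h (k, τ)‖ₑ) k

/-- Uniqueness on a short time interval, whose length depends only on the size of the
representatives. -/
theorem exists_local_uniqueness (ξ σ : ℝ) {b : ℝ} (hb : 1 / 2 < b) (hb2 : b ≤ 5 / 8)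
    {A M : ℝ≥0∞} (hA : A ≠ ⊤) (hM : M ≠ ⊤) : ∃ l : ℝ, 1 ≤ l ∧
    ∀ (c : ℤ → ℂ) (f h : ℤ × ℝ → ℂ) (u v : ℝ → L2T) (J : Set ℝ),
      seqNorm 0 (fun k => ‖c k‖ₑ) ≤ A → Admissible f → Admissible h →
      freqNorm 0 (3 / 8) 1 f ≤ M → freqNorm 0 (3 / 8) 1 h ≤ M → J.OrdConnected → 0 ∈ J →
      (∀ t ∈ J, |t| ≤ 1 / l) →
      (∀ t ∈ J, ∀ k, spaceFT (u t) k = coeffAt f t k) →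
      (∀ t ∈ J, ∀ k, spaceFT (v t) k = coeffAt h t k) →
      DuhamelOn ξ σ c u J → DuhamelOn ξ σ c v J → ∀ t ∈ J, u t = v t := by
  obtain ⟨C₀, hC₀, hcut⟩ := exists_isCutoff
  obtain ⟨C, hC, H⟩ := exists_contraction ξ σ (s := 0) le_rfl hb hb2 hC₀
  have hM1 : M + 1 ≠ ⊤ := by finiteness
  -- The bound `M + 1` covers the given representatives, of size at most `M`, and all their images,
  -- of size at most `1`.
  obtain ⟨l, hl, hl₀⟩ := H A (M + 1) hA hM1
  refine ⟨l, hl, fun c f h u v J hcA hf hh hfM hhM hJ h0 hJl hu hv hDu hDv t ht => ?_⟩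
  have hl0 : 0 < l := by linarith
  obtain ⟨g, hg⟩ := hcut l hl0
  have hone : ENNReal.ofReal (l ^ (3 / 8 - b)) * ENNReal.ofReal (l ^ (b - 3 / 8)) = 1 := by
    rw [← ENNReal.ofReal_mul (by positivity), ← Real.rpow_add hl0]; simp
  have step : ∀ (F : ℤ × ℝ → ℂ) (w : ℝ → L2T), Admissible F → freqNorm 0 (3 / 8) 1 F ≤ M + 1 →
      (∀ t ∈ J, ∀ k, spaceFT (w t) k = coeffAt F t k) → DuhamelOn ξ σ c w J →
      Admissible (duhamelMap ξ σ g c F) ∧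
      freqNorm 0 (3 / 8) 1 (duhamelMap ξ σ g c F) ≤ M + 1 ∧
      ∀ t ∈ J, ∀ k, spaceFT (w t) k = coeffAt (duhamelMap ξ σ g c F) t k := by
    intro F w hF hFM hw hD
    have hm := measurable_duhamelMap ξ σ hg.measurable c hF.measurable
    have hN := (hl₀ l le_rfl g hg c F hcA hF.measurable hFM).1
    refine ⟨Admissible.of_freqNorm_lt_top hb hl hm (hN.trans_lt ENNReal.ofReal_lt_top), ?_,
      hD.coeffAt_duhamelMap_eq hb hb2 hg hC₀ hl hF hJ h0 hJl hw⟩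
    refine (freqNorm_three_eighths_le hb hl hm).trans ((mul_le_mul' le_rfl hN).trans ?_)
    rw [hone]
    exact le_add_self
  -- The solutions stay fixed while their representatives are replaced by images under the map. The
  -- distance of order `3/8` is halved each time, because the powers of `l` from the contraction
  -- bound and from the embedding cancel.
  have iter : ∀ n : ℕ, ∃ F G : ℤ × ℝ → ℂ, (Admissible F ∧ freqNorm 0 (3 / 8) 1 F ≤ M + 1 ∧
      ∀ t ∈ J, ∀ k, spaceFT (u t) k = coeffAt F t k) ∧
      (Admissible G ∧ freqNorm 0 (3 / 8) 1 G ≤ M + 1 ∧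
      ∀ t ∈ J, ∀ k, spaceFT (v t) k = coeffAt G t k) ∧
      freqNorm 0 (3 / 8) 1 (fun p => F p - G p) ≤ 2⁻¹ ^ n * (M + M) := by
    intro n
    induction n with
    | zero =>
      refine ⟨f, h, ⟨hf, hfM.trans le_self_add, hu⟩, ⟨hh, hhM.trans le_self_add, hv⟩, ?_⟩
      rw [pow_zero, one_mul]
      exact (freqNorm_sub_le hf.measurable hh.measurable).trans (add_le_add hfM hhM)
    | succ n ih =>
      obtain ⟨F, G, ⟨hF, hFM, hFu⟩, ⟨hG, hGM, hGv⟩, hFG⟩ := ih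
      refine ⟨_, _, step F u hF hFM hFu hDu, step G v hG hGM hGv hDv, ?_⟩
      have h1 := (hl₀ l le_rfl g hg c F hcA hF.measurable hFM).2 c G hG.measurable hGM
      have h2 : seqNorm 0 (fun k => ‖c k - c k‖ₑ) = 0 := by simp [seqNorm, l2]
      rw [h2, mul_zero, zero_add] at h1
      refine (freqNorm_three_eighths_le hb hl
        ((measurable_duhamelMap ξ σ hg.measurable c hF.measurable).sub
        (measurable_duhamelMap ξ σ hg.measurable c hG.measurable))).trans ?_
      calc _ ≤ ENNReal.ofReal (l ^ (3 / 8 - b)) * (2⁻¹ * ENNReal.ofReal (l ^ (b - 3 / 8)) *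
            (2⁻¹ ^ n * (M + M))) :=
            mul_le_mul' le_rfl (h1.trans (mul_le_mul' le_rfl hFG))
        _ = (ENNReal.ofReal (l ^ (3 / 8 - b)) * ENNReal.ofReal (l ^ (b - 3 / 8))) *
            (2⁻¹ ^ (n + 1) * (M + M)) := by ring
        _ = _ := by rw [hone, one_mul]
  refine L2T_ext fun k => ?_
  set K : ℝ≥0∞ := ENNReal.ofReal (l ^ (1 / 2 - b)) * (bracketIntegral (2 * b)) ^ (1 / 2 : ℝ) *
    (2⁻¹ * ENNReal.ofReal (l ^ (b - 3 / 8))) with hK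
  have hKt : K ≠ ⊤ := by
    have := bracketIntegral_ne_top (a := 2 * b) (by linarith)
    finiteness
  -- The iteration controls only the norm of order `3/8`, too weak for values at a fixed time. One
  -- further application of the map gives order `b > 1/2`, which controls them.
  have hbound : ∀ n : ℕ, ‖spaceFT (u t) k - spaceFT (v t) k‖ₑ ≤ K * (M + M) * 2⁻¹ ^ n := by
    intro n
    obtain ⟨F, G, ⟨hF, hFM, hFu⟩, ⟨hG, hGM, hGv⟩, hFG⟩ := iter n
    obtain ⟨sF, -, sFu⟩ := step F u hF hFM hFu hDu
    obtain ⟨sG, -, sGv⟩ := step G v hG hGM hGv hDv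
    rw [sFu t ht k, sGv t ht k]
    refine (enorm_coeffAt_sub_le (b := b) hl0 sF sG t k).trans ?_
    have h1 := (hl₀ l le_rfl g hg c F hcA hF.measurable hFM).2 c G hG.measurable hGM
    have h2 : seqNorm 0 (fun k => ‖c k - c k‖ₑ) = 0 := by simp [seqNorm, l2]
    rw [h2, mul_zero, zero_add] at h1
    refine (mul_le_mul' le_rfl (h1.trans (mul_le_mul' le_rfl hFG))).trans (le_of_eq ?_)
    rw [hK]; ring
  have hlim : Tendsto (fun n : ℕ => K * (M + M) * 2⁻¹ ^ n) atTop (𝓝 (K * (M + M) * 0)) :=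
    ENNReal.Tendsto.const_mul (ENNReal.tendsto_pow_atTop_nhds_zero_of_lt_one (by simp))
      (Or.inr (by finiteness))
  rw [mul_zero] at hlim
  have h3 := ge_of_tendsto' hlim hbound
  rw [nonpos_iff_eq_zero, enorm_eq_zero, sub_eq_zero] at h3
  exact h3

/-- Translation in time is multiplication by a function of modulus one on the frequency side. It
therefore preserves all the weighted norms, and the uniqueness argument can be restarted at any time
with the same constants. -/
theorem coeffAt_mul_wave (f : ℤ × ℝ → ℂ) (t₀ t : ℝ) (k : ℤ) :
    coeffAt (fun p => f p * wave p.2 t₀) t k = coeffAt f (t₀ + t) k := by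
  unfold coeffAt
  refine integral_congr_ae (Eventually.of_forall fun τ => ?_)
  simp only [wave_add_right]
  ring

theorem freqNorm_mul_wave (s b l : ℝ) (f : ℤ × ℝ → ℂ) (t₀ : ℝ) :
    freqNorm s b l (fun p => f p * wave p.2 t₀) = freqNorm s b l f := by
  unfold freqNorm
  simp only [enorm_mul, enorm_wave, mul_one]

theorem schrodingerSymbol_add (t r : ℝ) (k : ℤ) :
    schrodingerSymbol (t + r) k = schrodingerSymbol t k * schrodingerSymbol r k := by
  simp only [schrodingerSymbol_eq, wave_add_right]

/-- The Duhamel formula may be started at any time. -/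
theorem IsDuhamelSolution.restart {ξ σ δ : ℝ} (hδ : 0 < δ) {u₀ : L2T} {u : ℝ → L2T}
    (h : IsDuhamelSolution ξ σ δ u₀ u) {t₀ : ℝ} (ht₀ : t₀ ∈ Icc (-δ) δ) :
    DuhamelOn ξ σ (fun k => spaceFT (u t₀) k) (fun t => u (t₀ + t))
      {t | t₀ + t ∈ Icc (-δ) δ} := by
  intro t ht k
  set N : ℝ → ℂ := fun τ => (ξ : ℂ) * spaceFT (u τ) k -
    ((σ : ℂ) + Complex.I) * spaceFT (cubic (u τ)) k with hN
  have hII : ∀ {x y : ℝ}, x ∈ Icc (-δ) δ → y ∈ Icc (-δ) δ → ∀ r,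
      IntervalIntegrable (fun τ => schrodingerSymbol (r - τ) k * N τ) volume x y := by
    intro x y hx hy r
    rw [intervalIntegrable_iff]
    have h1 : IntegrableOn N (uIoc x y) := (h.integrableOn k).mono_set
      (uIoc_subset_uIcc.trans (ordConnected_Icc.uIcc_subset hx hy))
    simp only [schrodingerSymbol_eq]
    exact h1.bdd_mul (c := 1)
      (by fun_prop : Continuous fun τ => wave (-(k : ℝ) ^ 2) (r - τ)).aestronglyMeasurable
      (Eventually.of_forall fun x => (norm_wave _ _).le)
  have h0 : (0 : ℝ) ∈ Icc (-δ) δ := ⟨by linarith, hδ.le⟩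
  have e1 := h.duhamel (t₀ + t) ht k
  have e2 := h.duhamel t₀ ht₀ k
  have e3 : ∫ τ in (0 : ℝ)..t, schrodingerSymbol (t - τ) k * N (t₀ + τ) =
      ∫ τ in t₀..(t₀ + t), schrodingerSymbol (t₀ + t - τ) k * N τ := by
    have := intervalIntegral.integral_comp_add_left (a := 0) (b := t)
      (fun τ => schrodingerSymbol (t₀ + t - τ) k * N τ) t₀
    rw [add_zero] at this
    rw [← this]
    simp only [add_sub_add_left_eq_sub]
  have e4 : ∫ τ in (0 : ℝ)..t₀, schrodingerSymbol (t₀ + t - τ) k * N τ =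
      schrodingerSymbol t k * ∫ τ in (0 : ℝ)..t₀, schrodingerSymbol (t₀ - τ) k * N τ := by
    rw [← intervalIntegral.integral_const_mul]
    refine intervalIntegral.integral_congr fun τ _ => ?_
    rw [← mul_assoc, ← schrodingerSymbol_add]
    congr 2; ring
  change spaceFT (u (t₀ + t)) k = schrodingerSymbol t k * spaceFT (u t₀) k +
    ∫ τ in (0 : ℝ)..t, schrodingerSymbol (t - τ) k * N (t₀ + τ)
  rw [e1, e2, e3, ← intervalIntegral.integral_add_adjacent_intervals (hII h0 ht₀ _)
    (hII ht₀ ht _), e4, add_comm t₀ t, schrodingerSymbol_add]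
  ring

theorem IsDuhamelSolution.apply_zero {ξ σ δ : ℝ} (hδ : 0 < δ) {u₀ : L2T} {u : ℝ → L2T}
    (h : IsDuhamelSolution ξ σ δ u₀ u) : u 0 = u₀ := by
  refine L2T_ext fun k => ?_
  rw [h.duhamel 0 ⟨by linarith, hδ.le⟩ k]
  simp [schrodingerSymbol_eq]

/-- Uniqueness in the Bourgain space, without a smallness condition. -/
theorem IsSolution.eqOn {ξ σ s b δ : ℝ} (hs : 0 ≤ s) (hb : 1 / 2 < b) (hb2 : b ≤ 5 / 8)
    (hδ : 0 < δ) {u₀ : L2T} {u v : ℝ → L2T} (hu : IsSolution ξ σ s b δ u₀ u)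
    (hv : IsSolution ξ σ s b δ u₀ v) : EqOn v u (Icc (-δ) δ) := by
  obtain ⟨f, hfm, hfN, hfu⟩ := exists_representative hs hb hδ hu.continuousInHs hu.xNormRestr_lt_top
  obtain ⟨h, hhm, hhN, hhv⟩ := exists_representative hs hb hδ hv.continuousInHs hv.xNormRestr_lt_top
  have hf := Admissible.of_freqNorm_lt_top hb le_rfl hfm hfN
  have hh := Admissible.of_freqNorm_lt_top hb le_rfl hhm hhN
  -- `A` bounds the data at all restart times at once, and `M` the two representatives and all their
  -- time translates. Hence the step length `1 / l` is the same for every restart.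
  set A := seqNorm 0 (fun k => ∫⁻ τ, ‖f (k, τ)‖ₑ) with hA
  have hAt : A ≠ ⊤ := by
    have h1 := hf.tsum_lt_top
    rw [← seqNorm_zero_sq] at h1
    intro hcon
    rw [hA] at hcon
    rw [hcon] at h1
    simp at h1
  set M := max (freqNorm 0 (3 / 8) 1 f) (freqNorm 0 (3 / 8) 1 h) with hM
  have hMt : M ≠ ⊤ := (max_lt hf.freqNorm_lt_top hh.freqNorm_lt_top).ne
  obtain ⟨l, hl, H⟩ := exists_local_uniqueness ξ σ hb hb2 hAt hMt
  have hl0 : 0 < l := by linarith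
  have main : ∀ n : ℕ, ∀ t ∈ Icc (-δ) δ, |t| ≤ n / l → u t = v t := by
    intro n
    induction n with
    | zero =>
      intro t _ ht
      have h0 : t = 0 := by
        rw [Nat.cast_zero, zero_div] at ht
        exact abs_nonpos_iff.1 ht
      rw [h0, hu.isDuhamelSolution.apply_zero hδ, hv.isDuhamelSolution.apply_zero hδ]
    | succ n ih =>
      intro t ht htn
      have hn : (0 : ℝ) < (n : ℝ) + 1 := by positivity
      -- This point between `0` and `t` is covered by the induction hypothesis and lies within `1 /
      -- l` of `t`, for either sign of `t`.
      set t₀ : ℝ := n / (n + 1) * t with ht₀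
      have hle : |t₀| ≤ |t| := by
        rw [ht₀, abs_mul, abs_of_nonneg (by positivity)]
        refine mul_le_of_le_one_left (abs_nonneg t) ?_
        rw [div_le_one hn]; linarith
      have ht₀I : t₀ ∈ Icc (-δ) δ := abs_le.1 (hle.trans (abs_le.2 ht))
      have ht₀n : |t₀| ≤ n / l := by
        rw [ht₀, abs_mul, abs_of_nonneg (by positivity)]
        calc (n : ℝ) / (n + 1) * |t| ≤ n / (n + 1) * (((n + 1 : ℕ) : ℝ) / l) :=
              mul_le_mul_of_nonneg_left htn (by positivity)
          _ = n / l := by push_cast; field_simp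
      have hdiff : |t - t₀| ≤ 1 / l := by
        have e : t - t₀ = 1 / (n + 1) * t := by rw [ht₀]; field_simp; ring
        rw [e, abs_mul, abs_of_nonneg (by positivity)]
        calc (1 : ℝ) / (n + 1) * |t| ≤ 1 / (n + 1) * (((n + 1 : ℕ) : ℝ) / l) :=
              mul_le_mul_of_nonneg_left htn (by positivity)
          _ = 1 / l := by push_cast; field_simp
      have heq : u t₀ = v t₀ := ih t₀ ht₀I ht₀n
      -- Near the ends of the interval `J` is not symmetric; the local result needs only an
      -- order-connected set that contains `0` and on which the cutoff equals one.
      set J : Set ℝ := {r | t₀ + r ∈ Icc (-δ) δ} ∩ Icc (-(1 / l)) (1 / l) with hJ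
      have hJo : J.OrdConnected := by
        refine OrdConnected.inter ⟨fun x hx y hy z hz => ?_⟩ ordConnected_Icc
        exact ⟨hx.1.trans (by linarith [hz.1]), le_trans (by linarith [hz.2]) hy.2⟩
      have hadm : ∀ {F : ℤ × ℝ → ℂ}, Measurable F → freqNorm 0 b 1 F < ⊤ →
          Admissible fun p => F p * wave p.2 t₀ := fun hF hN =>
        Admissible.of_freqNorm_lt_top hb le_rfl (by fun_prop) (by rw [freqNorm_mul_wave]; exact hN)
      have hDv := hv.isDuhamelSolution.restart hδ ht₀I
      rw [← heq] at hDv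
      have key := H (fun k => spaceFT (u t₀) k) (fun p => f p * wave p.2 t₀)
        (fun p => h p * wave p.2 t₀) (fun r => u (t₀ + r)) (fun r => v (t₀ + r)) J
        (seqNorm_mono fun k => by rw [hfu t₀ ht₀I]; exact enorm_coeffAt_le f t₀ k)
        (hadm hfm hfN) (hadm hhm hhN)
        (by rw [freqNorm_mul_wave]; exact le_max_left _ _)
        (by rw [freqNorm_mul_wave]; exact le_max_right _ _) hJo
        ⟨by simpa using ht₀I, by constructor <;> simp [hl0.le]⟩
        (fun r hr => abs_le.2 hr.2)
        (fun r hr k => by rw [coeffAt_mul_wave]; exact hfu _ hr.1 k)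
        (fun r hr k => by rw [coeffAt_mul_wave]; exact hhv _ hr.1 k)
        (fun r hr => hu.isDuhamelSolution.restart hδ ht₀I r hr.1)
        (fun r hr => hDv r hr.1) (t - t₀) ⟨by simpa using ht, abs_le.1 hdiff⟩
      simpa using key
  intro t ht
  obtain ⟨n, hn⟩ := exists_nat_ge (|t| * l)
  exact (main n t ht ((le_div_iff₀ hl0).2 hn)).symm

/-! ### The solution map and its Lipschitz continuity. -/

theorem hsNorm_le_add_sub (s : ℝ) (f g : L2T) : hsNorm s f ≤ hsNorm s g + hsNorm s (f - g) := by
  simp only [hsNorm_eq_seqNorm]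
  refine le_trans (l2_mono fun k => ?_) (l2_add_le measurable_from_top.aemeasurable
    measurable_from_top.aemeasurable)
  rw [← mul_add]
  refine mul_le_mul' le_rfl ?_
  simp only [spaceFT_sub]
  calc ‖spaceFT f k‖ₑ = ‖spaceFT g k + (spaceFT f k - spaceFT g k)‖ₑ := by rw [add_sub_cancel]
    _ ≤ _ := enorm_add_le _ _

/-- Solutions for all data in a ball, on a common time interval, in terms of representatives that
depend on the data in a Lipschitz way. -/
theorem exists_solutions (ξ σ : ℝ) {s b : ℝ} (hs : 0 ≤ s) (hb : 1 / 2 < b) (hb2 : b ≤ 5 / 8)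
    {A : ℝ≥0∞} (hA : A ≠ ⊤) : ∃ l : ℝ, 1 ≤ l ∧ ∃ Φ : L2T → ℝ → L2T,
      (∀ v₀, hsNorm s v₀ ≤ A → IsSolution ξ σ s b (1 / l) v₀ (Φ v₀)) ∧
      ∃ K : ℝ≥0∞, K ≠ ⊤ ∧ ∀ v₀ w₀, hsNorm s v₀ ≤ A → hsNorm s w₀ ≤ A →
        supHsNorm s (1 / l) (fun t => Φ w₀ t - Φ v₀ t) ≤ K * hsNorm s (w₀ - v₀) ∧
        xNormRestr s b (1 / l) (fun t => Φ w₀ t - Φ v₀ t) ≤ K * hsNorm s (w₀ - v₀) := by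
  obtain ⟨C₀, hC₀, hcut⟩ := exists_isCutoff
  obtain ⟨C, hC, H⟩ := exists_contraction ξ σ hs hb hb2 hC₀
  -- The value `M = 1` suffices, because the ball of radius `R = l^(b-3/8)` lies in the unit ball of
  -- the norm of order `3/8`.
  obtain ⟨l, hl, hl₀⟩ := H A 1 hA ENNReal.one_ne_top
  have hl0 : 0 < l := by linarith
  obtain ⟨g, hg⟩ := hcut l hl0
  have hone : ENNReal.ofReal (l ^ (3 / 8 - b)) * ENNReal.ofReal (l ^ (b - 3 / 8)) = 1 := by
    rw [← ENNReal.ofReal_mul (by positivity), ← Real.rpow_add hl0]; simp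
  have hone' : ENNReal.ofReal (l ^ (b - 3 / 8)) * ENNReal.ofReal (l ^ (3 / 8 - b)) = 1 := by
    rw [mul_comm, hone]
  set R := ENNReal.ofReal (l ^ (b - 3 / 8)) with hR
  have hRt : R ≠ ⊤ := ENNReal.ofReal_ne_top
  have hsmall : ∀ f, Measurable f → freqNorm s b l f ≤ R → freqNorm s (3 / 8) 1 f ≤ 1 :=
    fun f hf hfR => (freqNorm_three_eighths_le hb hl hf).trans
      ((mul_le_mul' le_rfl hfR).trans hone.le)
  have hdiff : ∀ (c d : ℤ → ℂ) (f h : ℤ × ℝ → ℂ), seqNorm s (fun k => ‖c k‖ₑ) ≤ A →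
      Measurable f → Measurable h → freqNorm s b l f ≤ R → freqNorm s b l h ≤ R →
      freqNorm s b l (fun p => duhamelMap ξ σ g c f p - duhamelMap ξ σ g d h p) ≤
        C * ENNReal.ofReal (l ^ (b - 1 / 2)) * seqNorm s (fun k => ‖c k - d k‖ₑ) +
          2⁻¹ * freqNorm s b l (fun p => f p - h p) := by
    intro c d f h hc hf hh hfR hhR
    refine ((hl₀ l le_rfl g hg c f hc hf (hsmall f hf hfR)).2 d h hh (hsmall h hh hhR)).trans
      (add_le_add le_rfl ?_)
    calc _ ≤ 2⁻¹ * R * (ENNReal.ofReal (l ^ (3 / 8 - b)) * freqNorm s b l (fun p => f p - h p)) :=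
          mul_le_mul' le_rfl (freqNorm_three_eighths_le hb hl (hf.sub hh))
      _ = 2⁻¹ * (R * ENNReal.ofReal (l ^ (3 / 8 - b))) * freqNorm s b l (fun p => f p - h p) := by
          ring
      _ = _ := by rw [hone', mul_one]
  have hex : ∀ v₀ : L2T, ∃ (f : ℤ × ℝ → ℂ) (u : ℝ → L2T), hsNorm s v₀ ≤ A →
      Measurable f ∧ freqNorm s b l f ≤ R ∧
      duhamelMap ξ σ g (fun k => spaceFT v₀ k) f =ᵐ[freqMeasure] f ∧
      ∀ t k, spaceFT (u t) k = coeffAt f t k := by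
    intro v₀
    by_cases hv : hsNorm s v₀ ≤ A
    · have hcA : seqNorm s (fun k => ‖spaceFT v₀ k‖ₑ) ≤ A := by rwa [← hsNorm_eq_seqNorm]
      obtain ⟨f, hf, hfR, hfix⟩ := exists_fixedPoint_freqNorm (s := s) (b := b) hl0
        (Ψ := duhamelMap ξ σ g fun k => spaceFT v₀ k)
        (fun f hf => measurable_duhamelMap ξ σ hg.measurable _ hf) hRt
        (fun f hf hfR => (hl₀ l le_rfl g hg _ f hcA hf (hsmall f hf hfR)).1)
        (fun f h hf hh hfR hhR => by
          have h1 := hdiff _ (fun k => spaceFT v₀ k) f h hcA hf hh hfR hhR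
          have h2 : seqNorm s (fun k => ‖spaceFT v₀ k - spaceFT v₀ k‖ₑ) = 0 := by
            simp [seqNorm, l2]
          rwa [h2, mul_zero, zero_add] at h1)
      obtain ⟨u, hu⟩ := (Admissible.of_freqNorm_lt_top hb hl hf
        (((freqNorm_mono_left hs hl0 f).trans hfR).trans_lt hRt.lt_top)).exists_realization
      exact ⟨f, u, fun _ => ⟨hf, hfR, hfix, hu⟩⟩
    -- For data outside the ball a default is chosen, so that the solution map is defined on all of
    -- `L2T`.
    · exact ⟨fun _ => 0, fun _ => 0, fun h => absurd h hv⟩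
  choose F Φ hFΦ using hex
  refine ⟨l, hl, Φ, fun v₀ hv => ?_, ?_⟩
  · obtain ⟨hf, hfR, hfix, hu⟩ := hFΦ v₀ hv
    exact isSolution_realization ξ σ hs hb hb2 hg hC₀ hl v₀ hf (hfR.trans_lt hRt.lt_top) hfix hu
  set B := ENNReal.ofReal (l ^ (1 / 2 - b)) * (bracketIntegral (2 * b)) ^ (1 / 2 : ℝ) with hB
  have hBt : B ≠ ⊤ := by
    have := bracketIntegral_ne_top (a := 2 * b) (by linarith)
    finiteness
  set D := C * ENNReal.ofReal (l ^ (b - 1 / 2)) with hD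
  have hDt : D ≠ ⊤ := by finiteness
  refine ⟨(B + ENNReal.ofReal (2 * Real.pi)) * (2 * D), by finiteness, fun v₀ w₀ hv hw => ?_⟩
  obtain ⟨hf, hfR, hfix, hu⟩ := hFΦ v₀ hv
  obtain ⟨hh, hhR, hhfix, hhu⟩ := hFΦ w₀ hw
  set d := freqNorm s b l (fun p => F w₀ p - F v₀ p) with hd
  have hdt : d < ⊤ := (freqNorm_sub_le hh hf).trans_lt
    (ENNReal.add_lt_top.2 ⟨hhR.trans_lt hRt.lt_top, hfR.trans_lt hRt.lt_top⟩)
  -- Subtracting the two fixed point equations gives `d ≤ D ‖w₀ - v₀‖ + d / 2`. The last term can be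
  -- absorbed because `d` is finite, both fixed points being in the ball.
  have hle : d ≤ 2 * D * hsNorm s (w₀ - v₀) := by
    have h1 := hdiff (fun k => spaceFT w₀ k) (fun k => spaceFT v₀ k) (F w₀) (F v₀)
      (by rwa [← hsNorm_eq_seqNorm]) hh hf hhR hfR
    have h2 : (fun p => duhamelMap ξ σ g (fun k => spaceFT w₀ k) (F w₀) p -
        duhamelMap ξ σ g (fun k => spaceFT v₀ k) (F v₀) p) =ᵐ[freqMeasure]
        fun p => F w₀ p - F v₀ p := by
      filter_upwards [hfix, hhfix] with p e1 e2
      rw [e1, e2]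
    have h3 : seqNorm s (fun k => ‖spaceFT w₀ k - spaceFT v₀ k‖ₑ) = hsNorm s (w₀ - v₀) := by
      rw [hsNorm_eq_seqNorm]; simp only [spaceFT_sub]
    rw [freqNorm_congr_ae h2, h3] at h1
    have h4 : 2⁻¹ * d + 2⁻¹ * d ≤ D * hsNorm s (w₀ - v₀) + 2⁻¹ * d := by
      rw [← add_mul, ENNReal.inv_two_add_inv_two, one_mul]; exact h1
    have h5 : 2⁻¹ * d ≤ D * hsNorm s (w₀ - v₀) :=
      (ENNReal.add_le_add_iff_right (ENNReal.mul_ne_top (by simp) hdt.ne)).1 h4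
    calc d = 2 * (2⁻¹ * d) := by
          rw [← mul_assoc, ENNReal.mul_inv_cancel two_ne_zero ENNReal.ofNat_ne_top, one_mul]
      _ ≤ 2 * (D * hsNorm s (w₀ - v₀)) := mul_le_mul' le_rfl h5
      _ = _ := by ring
  have hreal : ∀ t k, spaceFT (Φ w₀ t - Φ v₀ t : L2T) k =
      coeffAt (fun p => F w₀ p - F v₀ p) t k := by
    intro t k
    have a1 := Admissible.of_freqNorm_lt_top hb hl hf
      (((freqNorm_mono_left hs hl0 _).trans hfR).trans_lt hRt.lt_top)
    have a2 := Admissible.of_freqNorm_lt_top hb hl hh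
      (((freqNorm_mono_left hs hl0 _).trans hhR).trans_lt hRt.lt_top)
    rw [spaceFT_sub, hu, hhu]
    unfold coeffAt
    rw [← integral_sub (integrable_mul_wave (a2.integrable_slice k) t)
      (integrable_mul_wave (a1.integrable_slice k) t)]
    simp only [sub_mul]
  constructor
  · refine iSup₂_le fun t _ => ?_
    refine (hsNorm_realization_le (b := b) hl0 (hh.sub hf) hreal t).trans ?_
    calc B * d ≤ (B + ENNReal.ofReal (2 * Real.pi)) * (2 * D * hsNorm s (w₀ - v₀)) :=
          mul_le_mul' le_self_add hle
      _ = _ := by ring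
  · refine (xNormRestr_le_xNorm _ _ _ _).trans
      ((xNorm_realization_le hs hb hl (hh.sub hf) hdt hreal).trans ?_)
    calc ENNReal.ofReal (2 * Real.pi) * d
        ≤ (B + ENNReal.ofReal (2 * Real.pi)) * (2 * D * hsNorm s (w₀ - v₀)) :=
          mul_le_mul' le_add_self hle
      _ = _ := by ring

end CGPE

theorem mainTheorem1 (ξ σ : ℝ) (hξ : 0 < ξ) (hσ : 0 < σ) (s : ℝ) (hs : 0 ≤ s)
    (b : ℝ) (hb₁ : 1 / 2 < b) (hb₂ : b < 5 / 8) (u₀ : CGPE.L2T) (hu₀ : u₀ ∈ CGPE.Hs s) :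
    ∃ δ : ℝ, 0 < δ ∧ δ ≤ 1 ∧
      -- existence and uniqueness for the datum `u₀`
      (∃ u : ℝ → CGPE.L2T, CGPE.IsSolution ξ σ s b δ u₀ u ∧
        ∀ v : ℝ → CGPE.L2T, CGPE.IsSolution ξ σ s b δ u₀ v → EqOn v u (Icc (-δ) δ)) ∧
      -- on a neighbourhood of `u₀` the solution map is defined and continuous
      ∃ r : ℝ≥0∞, 0 < r ∧ ∃ Φ : CGPE.L2T → ℝ → CGPE.L2T,
        (∀ v₀ ∈ CGPE.Hs s, CGPE.hsNorm s (v₀ - u₀) < r →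
          CGPE.IsSolution ξ σ s b δ v₀ (Φ v₀) ∧
          ∀ v : ℝ → CGPE.L2T, CGPE.IsSolution ξ σ s b δ v₀ v → EqOn v (Φ v₀) (Icc (-δ) δ)) ∧
        ∀ v₀ ∈ CGPE.Hs s, CGPE.hsNorm s (v₀ - u₀) < r →
          ∀ ε : ℝ≥0∞, 0 < ε → ∃ ρ : ℝ≥0∞, 0 < ρ ∧
            ∀ w₀ ∈ CGPE.Hs s, CGPE.hsNorm s (w₀ - u₀) < r → CGPE.hsNorm s (w₀ - v₀) < ρ →
              CGPE.supHsNorm s δ (fun t => Φ w₀ t - Φ v₀ t) < ε ∧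
              CGPE.xNormRestr s b δ (fun t => Φ w₀ t - Φ v₀ t) < ε := by
  have hb2 : b ≤ 5 / 8 := hb₂.le
  have hu : CGPE.hsNorm s u₀ < ⊤ := hu₀
  -- Data within distance `1` of `u₀` have norm at most `‖u₀‖ + 1`, so a single time `δ = 1 / l` and
  -- a single Lipschitz constant serve the whole ball of radius `r = 1`.
  obtain ⟨l, hl, Φ, hsol, K, hK, hlip⟩ := CGPE.exists_solutions ξ σ hs hb₁ hb2
    (A := CGPE.hsNorm s u₀ + 1) (ENNReal.add_ne_top.2 ⟨hu.ne, ENNReal.one_ne_top⟩)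
  have hδ : 0 < 1 / l := by positivity
  have hball : ∀ v₀, CGPE.hsNorm s (v₀ - u₀) < 1 → CGPE.hsNorm s v₀ ≤ CGPE.hsNorm s u₀ + 1 :=
    fun v₀ hv => (CGPE.hsNorm_le_add_sub s v₀ u₀).trans (add_le_add le_rfl hv.le)
  have huniq : ∀ v₀, CGPE.hsNorm s v₀ ≤ CGPE.hsNorm s u₀ + 1 → ∀ v : ℝ → CGPE.L2T,
      CGPE.IsSolution ξ σ s b (1 / l) v₀ v → EqOn v (Φ v₀) (Icc (-(1 / l)) (1 / l)) :=
    fun v₀ hv₀ v hv => CGPE.IsSolution.eqOn hs hb₁ hb2 hδ (hsol v₀ hv₀) hv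
  refine ⟨1 / l, hδ, (div_le_one (by linarith)).2 hl,
    ⟨Φ u₀, hsol u₀ le_self_add, huniq u₀ le_self_add⟩, 1, one_pos, Φ,
    fun v₀ _ hv => ⟨hsol v₀ (hball v₀ hv), huniq v₀ (hball v₀ hv)⟩, fun v₀ _ hv ε hε => ?_⟩
  obtain ⟨ρ, hρ, hlt⟩ := ENNReal.exists_nnreal_pos_mul_lt hK hε.ne'
  refine ⟨ρ, ENNReal.coe_pos.2 hρ, fun w₀ _ hw hwv => ?_⟩
  have hle : K * CGPE.hsNorm s (w₀ - v₀) < ε := by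
    refine lt_of_le_of_lt (mul_le_mul' le_rfl hwv.le) ?_
    rwa [mul_comm]
  have h := hlip v₀ w₀ (hball v₀ hv) (hball w₀ hw)
  exact ⟨h.1.trans_lt hle, h.2.trans_lt hle⟩
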